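/- Let $0<q<1$ and $m\ge 1$. For $i\in\{1,\dots,m\}$ put $i'=m+1-i$ and let $\rho=(\rho_1,\dots,\rho_m)$ be $(n-\frac12,\dots,\frac12,0,-\frac12,\dots,\frac12-n)$ if $m=2n+1$ and $(n-1,\dots,1,0,0,-1,\dots,1-n)$ if $m=2n$. Let $C_{ij}=C^{ij}=q^{-\rho_i}\delta_{ij'}$, $\mu=1+q^{2-m}$, and let $\hat R$ be the braid matrix of $O_q(m)$, $$\hat R^{ab}_{ij}=q^{\delta_{ij}-\delta_{ij'}}\delta_{aj}\delta_{bi}+(q-q^{-1})\,[i<j]\,\delta_{ai}\delta_{bj}-(q-q^{-1})\,[i<b]\,q^{\rho_b-\rho_i}\,\delta_{ab'}\delta_{ji'},$$ where $[\cdot]$ is $1$ if the condition holds and $0$ otherwise. It has the form $\hat R=q\mathcal P_S-q^{-1}\mathcal P_A+q^{1-m}\mathcal P_1$ with complementary projections $\mathcal P_S,\mathcal P_A,\mathcal P_1$. Repeated indices are summed. Let $\mathcal P$ be the complex algebra generated by $x^1,\dots,x^m$ with the relations $(\mathcal P_A)^{ij}_{kl}x^kx^l=0$, let $\mathcal P_k\subset\mathcal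 P$ be its homogeneous elements of degree $k$, $\mathcal O_q$ the corresponding algebra of formal power series $\sum_n F_n$ with $F_n\in\mathcal P_n$, and $\mathbf x^2=x^iC_{ij}x^j$ (which is central). The partial derivatives $\partial^j$ and $\overline{\partial^j}$ are the operators on $\mathcal P$, extended termwise to $\mathcal O_q$, with $\partial^i(1)=\overline{\partial^i}(1)=0$ and $$\partial^ix^j=C^{ij}+q(\hat R^{-1})^{ij}_{kl}x^k\partial^l,\qquad \overline{\partial^i}x^j=C^{ij}+q^{-1}\hat R^{ij}_{kl}x^k\overline{\partial^l}.$$ Put $\Delta=\partial^iC_{ij}\partial^j$. For $f$ analytic at the origin, $f(\mathbf x^2)\in\mathcal O_q$ is given by the Taylor expansion of $f$ at $0$, and $\mathcal P\otimes f(\mathbf x^2)=\{R(\mathbf x)f(\mathbf x^2): R\in\mathcal P\}$. With $[u]_p=\frac{p^u-1}{p-1}$, $[k]_p!=[1]_p\cdots[k]_p$, let $E_p(t)=\sum_{j\ge0}p^{j(j-1)/2}\frac{t^j}{[j]_p!}$, and let $e_p(t)=\sum_{j\ge0}\frac{t^j}{[j]_p!}$ for $|t|<\frac1{1-p}$, continued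 analytically by $e_p(t)=1/E_p(-t)$. Let $\Gamma_{p}(t)=(1-p)^{1-t}\prod_{k\ge0}\frac{1-p^{k+1}}{1-p^{k+t}}$, and $$\int_{\mathbb S^{m-1}_q}R=\sum_{k\ge0}\frac{2\,\Gamma_{q^2}(\frac12)^m}{\mu^{2k}[k]_{q^2}!\,\Gamma_{q^2}(k+\frac m2)}(\Delta^kR)(0)\qquad(R\in\mathcal P).$$ Let $\int_0^{\lambda}h(r)\,d_qr=(1-q)\lambda\sum_{l=0}^{\infty}h(q^l\lambda)q^l$ and $\int_0^{\gamma\cdot\infty}h(r)\,d_qr=(1-q)\gamma\sum_{l\in\mathbb Z}h(q^l\gamma)q^l$. For $\gamma,\lambda>0$ and $R_k\in\mathcal P_k$ define, and extend additively to finite sums, $$\int_{\gamma\cdot\mathbb R^m_q}R_k(\mathbf x)f(\mathbf x^2)=\int_0^{\gamma\cdot\infty}d_qr\,r^{m+k-1}f(r^2)\int_{\mathbb S^{m-1}_q}R_k,\qquad \int_{\mathbb B^m_q(\lambda)}R_k(\mathbf x)f(\mathbf x^2)=\int_0^{\lambda}d_qr\,r^{m+k-1}f(r^2)\int_{\mathbb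 S^{m-1}_q}R_k,$$ for $f$ real-analytic on $[0,\infty)$, respectively on $[0,\lambda^2]$, such that the series on the right converge absolutely. Then, for every $j\in\{1,\dots,m\}$: 1. for all $\alpha,\gamma>0$ and every $F\in\mathcal P\otimes e_{q^2}(-\alpha\mathbf x^2)$, the integral $\int_{\gamma\cdot\mathbb R^m_q}\partial^jF$ is defined, does not depend on the way in which $\partial^jF$ is written as a finite sum of terms $R_k(\mathbf x)f(\mathbf x^2)$ as above, and equals $0$; 2. for all $\beta>0$ and every $F\in\mathcal P\otimes E_{q^2}(-\beta\mathbf x^2)$, the integral $\int_{\mathbb B^m_q(\lambda)}\overline{\partial^j}F$ with $\lambda=\frac1{\sqrt{(1-q^2)\beta}}$ is defined, does not depend on the way in which $\overline{\partial^j}F$ is written as such a sum, and equals $0$. -/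

import Mathlib

noncomputable section

namespace QEuclid

/-! ### One-variable `q`-calculus (base `p`, later `p = q ^ 2`) -/

/-- The `p`-number `[u]_p = (p ^ u - 1) / (p - 1)`. -/
def qNum (p u : ℝ) : ℝ := (p ^ u - 1) / (p - 1)

/-- The `p`-factorial `[k]_p! = [1]_p [2]_p ⋯ [k]_p`. -/
def qFactorial (p : ℝ) (k : ℕ) : ℝ := ∏ i ∈ Finset.range k, qNum p ((i : ℝ) + 1)

/-- The `p`-Gamma function
`Γ_p(t) = (p; p)_∞ / (p ^ t; p)_∞ * (1 - p) ^ (1 - t)`, for `0 < p < 1` and `0 < t`. -/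
def qGamma (p t : ℝ) : ℝ :=
  (∏' k : ℕ, (1 - p ^ (k + 1))) / (∏' k : ℕ, (1 - p ^ (t + (k : ℝ)))) * (1 - p) ^ (1 - t)

/-- The entire exponential `E_p(t) = ∑_j p ^ (j (j - 1) / 2) t ^ j / [j]_p!`. -/
def qExpE (p t : ℝ) : ℝ := ∑' j : ℕ, p ^ (j * (j - 1) / 2) * t ^ j / qFactorial p j

/-- The exponential `e_p(t)`: the series `∑_j t ^ j / [j]_p!` on its disc of convergence
`|t| < 1 / (1 - p)`, continued analytically outside of it by `e_p(t) = 1 / E_p(-t)`. -/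
def qExpe (p t : ℝ) : ℝ :=
  if |t| < 1 / (1 - p) then ∑' j : ℕ, t ^ j / qFactorial p j else (qExpE p (-t))⁻¹

/-- The Jackson integral `∫_0^a h(r) d_q r`. -/
def jackson (q a : ℝ) (h : ℝ → ℂ) : ℂ :=
  ((1 - q) * a : ℝ) * ∑' l : ℕ, h (q ^ l * a) * ((q ^ l : ℝ) : ℂ)

/-- Convergence of the series that defines `∫_0^a h(r) d_q r`. -/
def JacksonSummable (q a : ℝ) (h : ℝ → ℂ) : Prop :=
  Summable fun l : ℕ => h (q ^ l * a) * ((q ^ l : ℝ) : ℂ)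

/-- The infinite Jackson integral `∫_0^{γ·∞} h(r) d_q r`. -/
def jacksonInf (q γ : ℝ) (h : ℝ → ℂ) : ℂ :=
  ((1 - q) * γ : ℝ) * ∑' l : ℤ, h (q ^ l * γ) * ((q ^ l : ℝ) : ℂ)

/-- Convergence of the series that defines `∫_0^{γ·∞} h(r) d_q r`. -/
def JacksonInfSummable (q γ : ℝ) (h : ℝ → ℂ) : Prop :=
  Summable fun l : ℤ => h (q ^ l * γ) * ((q ^ l : ℝ) : ℂ)

/-! ### The `R`-matrix and the metric of `O_q(m)`

The indices `1, …, m` are `0, …, m - 1` here, and `i' = m + 1 - i` is `Fin.rev i`. -/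

/-- The weights `ρ = (m/2 - 1, m/2 - 2, …, 1 - m/2)` of the orthogonal series:
`(n - 1/2, …, 1/2, 0, -1/2, …, 1/2 - n)` for `m = 2 n + 1` and
`(n - 1, …, 1, 0, 0, -1, …, 1 - n)` for `m = 2 n`. -/
def rho (m : ℕ) (i : Fin m) : ℝ :=
  if 2 * (i : ℕ) + 1 < m then (m : ℝ) / 2 - 1 - (i : ℕ)
  else if 2 * (i : ℕ) + 1 = m then 0
  else (m : ℝ) / 2 - (i : ℕ)

/-- The metric `C_{ij} = C^{ij} = q ^ (-ρ_i) δ_{i j'}`. -/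
def metric (m : ℕ) (q : ℝ) : Matrix (Fin m) (Fin m) ℂ :=
  Matrix.of fun i j => if j = Fin.rev i then ((q ^ (-rho m i) : ℝ) : ℂ) else 0

/-- The braid matrix `R̂ ^ {ab} _ {ij}` of `O_q(m)`; the row is `(a, b)`, the column `(i, j)`.
It acts by `e_i ⊗ e_j ↦ q ^ (δ_{ij} - δ_{ij'}) e_j ⊗ e_i`, plus
`(q - q⁻¹) e_i ⊗ e_j` if `i < j`, minus
`(q - q⁻¹) ∑_{b > i} q ^ (ρ_b - ρ_i) e_{b'} ⊗ e_b` if `j = i'`. -/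
def Rhat (m : ℕ) (q : ℝ) : Matrix (Fin m × Fin m) (Fin m × Fin m) ℂ :=
  Matrix.of fun ab ij =>
    (if ab.1 = ij.2 ∧ ab.2 = ij.1 then
      ((q ^ ((if ij.1 = ij.2 then (1 : ℤ) else 0)
        - (if ij.2 = Fin.rev ij.1 then (1 : ℤ) else 0)) : ℝ) : ℂ) else 0)
    + (if ab = ij ∧ ij.1 < ij.2 then ((q - q⁻¹ : ℝ) : ℂ) else 0)
    - (if ab.1 = Fin.rev ab.2 ∧ ij.2 = Fin.rev ij.1 ∧ ij.1 < ab.2 then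
      (((q - q⁻¹) * q ^ (rho m ab.2 - rho m ij.1) : ℝ) : ℂ) else 0)

/-- The projection `P_A` on the eigenspace of `R̂ = q P_S - q⁻¹ P_A + q ^ (1 - m) P_1` for the
eigenvalue `-q⁻¹`. -/
def projA (m : ℕ) (q : ℝ) : Matrix (Fin m × Fin m) (Fin m × Fin m) ℂ :=
  (((-q⁻¹ - q) * (-q⁻¹ - q ^ (1 - (m : ℤ))) : ℝ) : ℂ)⁻¹ •
    ((Rhat m q - (q : ℂ) • (1 : Matrix (Fin m × Fin m) (Fin m × Fin m) ℂ)) *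
      (Rhat m q - ((q ^ (1 - (m : ℤ)) : ℝ) : ℂ) • (1 : Matrix (Fin m × Fin m) (Fin m × Fin m) ℂ)))

/-- The constant `μ = 1 + q ^ (2 - m)`. -/
def muConst (m : ℕ) (q : ℝ) : ℝ := 1 + q ^ (2 - (m : ℤ))

/-! ### Polynomials on quantum Euclidean space -/

/-- The commutation relations `(P_A) ^ {ab} _ {jk} x^j x^k = 0`. -/
inductive CommRel (m : ℕ) (q : ℝ) : FreeAlgebra ℂ (Fin m) → FreeAlgebra ℂ (Fin m) → Prop
  | rel (ab : Fin m × Fin m) :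
      CommRel m q (∑ j, ∑ k, projA m q ab (j, k) • (FreeAlgebra.ι ℂ j * FreeAlgebra.ι ℂ k)) 0

/-- The algebra `𝒫` of polynomials on `ℝ^m_q`: generators `x^1, …, x^m` and the relations
`P_A x ⊗ x = 0`. -/
abbrev QPoly (m : ℕ) (q : ℝ) : Type := RingQuot (CommRel m q)

variable (m : ℕ) (q : ℝ)

/-- The class in `𝒫` of a polynomial in free variables. -/
def mk : FreeAlgebra ℂ (Fin m) →ₐ[ℂ] QPoly m q := RingQuot.mkAlgHom ℂ (CommRel m q)

/-- The coordinate `x^i`. -/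
def coord (i : Fin m) : QPoly m q := mk m q (FreeAlgebra.ι ℂ i)

/-- The norm squared `𝐱² = x^i C_{ij} x^j`. -/
def normSq : QPoly m q := ∑ i, ∑ j, metric m q i j • (coord m q i * coord m q j)

/-- The space `𝒫_k` of homogeneous polynomials of degree `k`, spanned by the words of length `k`
in the coordinates. -/
def homog (k : ℕ) : Submodule ℂ (QPoly m q) :=
  (Submodule.span ℂ (Set.range (coord m q))) ^ k

theorem mk_rel (ab : Fin m × Fin m) :
    ∑ j, ∑ k, projA m q ab (j, k) • (coord m q j * coord m q k) = 0 := by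
  have h := RingQuot.mkAlgHom_rel ℂ (CommRel.rel (m := m) (q := q) ab)
  simpa [coord, mk, map_sum, map_smul] using h

/-- Evaluation `R ↦ R(0)` of a polynomial at the origin: the constant term. -/
def evalZero : QPoly m q →ₐ[ℂ] ℂ :=
  RingQuot.liftAlgHom ℂ ⟨FreeAlgebra.lift ℂ (fun _ : Fin m => (0 : ℂ)), by
    rintro _ _ ⟨ab⟩
    simp [map_sum]⟩

/-! ### The two differential calculi

For a number `s` and a matrix `T`, the partial derivatives with
`∂^i x^j = C^{ij} + s T^{ij}_{kl} x^k ∂^l` and `∂^i (1) = 0` are first defined on polynomials in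
free variables. They are linear in the polynomial, and the two lemmas below determine them.
The ideal of the commutation relations is stable under them in the two cases in use
(`s = q`, `T = R̂⁻¹` and `s = q⁻¹`, `T = R̂`), so that they act on `𝒫`. -/

variable {m}

/-- The action of the generator `x^j` on a pair consisting of a polynomial and its partial
derivatives: `(a, d) ↦ (x^j a, C^{ij} a + s T^{ij}_{kl} x^k d^l)`. -/
def leibnizStep (s : ℂ) (T : Matrix (Fin m × Fin m) (Fin m × Fin m) ℂ) (j : Fin m) :
    Module.End ℂ (FreeAlgebra ℂ (Fin m) × (Fin m → FreeAlgebra ℂ (Fin m))) where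
  toFun v := (FreeAlgebra.ι ℂ j * v.1, fun i => metric m q i j • v.1 +
    s • ∑ k, ∑ l, T (i, j) (k, l) • (FreeAlgebra.ι ℂ k * v.2 l))
  map_add' v w := by
    ext i
    · simp [mul_add]
    · simp only [Prod.fst_add, Prod.snd_add, Pi.add_apply, smul_add, mul_add,
        Finset.sum_add_distrib]
      abel
  map_smul' c v := by
    ext i
    · simp
    · simp only [Prod.smul_fst, Prod.smul_snd, Pi.smul_apply, RingHom.id_apply, mul_smul_comm,
        smul_add, Finset.smul_sum]
      simp only [smul_smul, mul_comm, mul_left_comm]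

/-- The partial derivative `∂^i` on polynomials in free variables. -/
def freePartial (s : ℂ) (T : Matrix (Fin m × Fin m) (Fin m × Fin m) ℂ) (i : Fin m) :
    FreeAlgebra ℂ (Fin m) →ₗ[ℂ] FreeAlgebra ℂ (Fin m) where
  toFun a := (FreeAlgebra.lift ℂ (leibnizStep q s T) a (1, 0)).2 i
  map_add' a b := by simp
  map_smul' c a := by simp

theorem freePartial_one (s : ℂ) (T : Matrix (Fin m × Fin m) (Fin m × Fin m) ℂ) (i : Fin m) :
    freePartial q s T i 1 = 0 := by
  simp [freePartial]

theorem freePartial_coord_mul (s : ℂ) (T : Matrix (Fin m × Fin m) (Fin m × Fin m) ℂ)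
    (i j : Fin m) (a : FreeAlgebra ℂ (Fin m)) :
    freePartial q s T i (FreeAlgebra.ι ℂ j * a) = metric m q i j • a +
      s • ∑ k, ∑ l, T (i, j) (k, l) • (FreeAlgebra.ι ℂ k * freePartial q s T l a) := by
  have h1 : ∀ b : FreeAlgebra ℂ (Fin m),
      (FreeAlgebra.lift ℂ (leibnizStep q s T) b (1, 0)).1 = b := by
    have key : ∀ (b : FreeAlgebra ℂ (Fin m))
        (v : FreeAlgebra ℂ (Fin m) × (Fin m → FreeAlgebra ℂ (Fin m))),
        (FreeAlgebra.lift ℂ (leibnizStep q s T) b v).1 = b * v.1 := by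
      intro b
      induction b using FreeAlgebra.induction with
      | grade0 r => intro v; simp [Algebra.smul_def]
      | grade1 x => intro v; simp [leibnizStep]
      | mul a b ha hb => intro v; simp [ha, hb, mul_assoc]
      | add a b ha hb => intro v; simp [ha, hb, add_mul]
    intro b
    simp [key]
  simp only [freePartial, LinearMap.coe_mk, AddHom.coe_mk, map_mul, FreeAlgebra.lift_ι_apply,
    Module.End.mul_apply]
  simp only [leibnizStep, LinearMap.coe_mk, AddHom.coe_mk]
  rw [h1]

theorem exists_lift :
    ∃ g : QPoly m q →ₗ[ℂ] FreeAlgebra ℂ (Fin m), (mk m q).toLinearMap ∘ₗ g = LinearMap.id :=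
  LinearMap.exists_rightInverse_of_surjective _
    (LinearMap.range_eq_top.2 (RingQuot.mkAlgHom_surjective ℂ (CommRel m q)))

/-- A linear choice of representatives in free variables of the elements of `𝒫`. -/
def lift : QPoly m q →ₗ[ℂ] FreeAlgebra ℂ (Fin m) := (exists_lift (m := m) q).choose

/-- The derivation rules on `𝒫`: differentiate a representative and take its class (which does
not depend on the representative when the ideal of relations is stable). -/
def polyPartial (s : ℂ) (T : Matrix (Fin m × Fin m) (Fin m × Fin m) ℂ) (i : Fin m) :
    QPoly m q →ₗ[ℂ] QPoly m q :=
  (mk m q).toLinearMap ∘ₗ freePartial q s T i ∘ₗ lift q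

/-- The partial derivative `∂^i` on `𝒫`: `∂^i x^j = C^{ij} + q (R̂⁻¹)^{ij}_{kl} x^k ∂^l`. -/
def pd (i : Fin m) : QPoly m q →ₗ[ℂ] QPoly m q :=
  polyPartial q (q : ℂ) (Rhat m q)⁻¹ i

/-- The barred partial derivative on `𝒫`, obtained by replacing `q` and `R̂` by `q⁻¹` and `R̂⁻¹`:
`∂̄^i x^j = C^{ij} + q⁻¹ R̂^{ij}_{kl} x^k ∂̄^l`. -/
def pdBar (i : Fin m) : QPoly m q →ₗ[ℂ] QPoly m q :=
  polyPartial q ((q⁻¹ : ℝ) : ℂ) (Rhat m q) i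

variable (m)

/-- The Laplace operator `Δ = ∂^i C_{ij} ∂^j`. -/
def laplace : QPoly m q →ₗ[ℂ] QPoly m q :=
  ∑ i, ∑ j, metric m q i j • (pd q i ∘ₗ pd q j)

/-- Integration over the quantum sphere,
`∫ R = ∑_k 2 Γ(1/2)^m / (μ^{2k} [k]! Γ(k + m/2)) (Δ^k R)(0)` in base `q²`
(only finitely many terms are non-zero). -/
def sphereInt (R : QPoly m q) : ℂ :=
  ∑ᶠ k : ℕ, ((2 * qGamma (q ^ 2) (1 / 2) ^ m /
      (muConst m q ^ (2 * k) * qFactorial (q ^ 2) k *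
        qGamma (q ^ 2) ((k : ℝ) + (m : ℝ) / 2)) : ℝ) : ℂ) *
    evalZero m q ((laplace m q ^ k) R)

/-! ### Formal power series on quantum Euclidean space

A formal power series `∑_n F_n` in the coordinates, with `F_n` the homogeneous part of degree `n`,
is written as the series `∑_n F_n h^n` over `𝒫` in a central bookkeeping variable `h`. The product
of formal power series becomes the product of such series, and `x^i` becomes `x^i h`. -/

/-- The embedding of polynomials in formal power series; `x^i ↦ x^i h`. -/
def toSeries : QPoly m q →ₐ[ℂ] PowerSeries (QPoly m q) :=
  RingQuot.liftAlgHom ℂ ⟨FreeAlgebra.lift ℂ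
      (fun i : Fin m => PowerSeries.monomial 1 (coord m q i)), by
    rintro _ _ ⟨ab⟩
    have h := mk_rel m q ab
    simp only [map_sum, map_smul, map_mul, FreeAlgebra.lift_ι_apply, map_zero,
      PowerSeries.monomial_mul_monomial]
    have h2 : ∀ (c : ℂ) (a : QPoly m q), c • PowerSeries.monomial (1 + 1) a =
        PowerSeries.monomial (1 + 1) (c • a) := by
      intro c a
      ext n
      simp [PowerSeries.coeff_monomial]
    simp only [h2, ← map_sum, h, map_zero]⟩

/-- The formal power series `f(𝐱²) = ∑_l f^{(l)}(0) / l! (𝐱²)^l` of a function `f` that is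
analytic at the origin. -/
def radial (f : ℝ → ℂ) : PowerSeries (QPoly m q) :=
  PowerSeries.mk fun n =>
    if Even n then (iteratedDeriv (n / 2) f 0 / ((n / 2).factorial : ℂ)) • normSq m q ^ (n / 2)
    else 0

/-- The space `𝒫 ⊗ f(𝐱²)` of polynomials weighted with `f(𝐱²)`. -/
def weighted (f : ℝ → ℂ) : Submodule ℂ (PowerSeries (QPoly m q)) :=
  LinearMap.range (LinearMap.mulRight ℂ (radial m q f) ∘ₗ (toSeries m q).toLinearMap)

variable {m}

/-- Termwise extension of an operator of degree `-1` from polynomials to formal power series. -/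
def seriesPartial (D : QPoly m q →ₗ[ℂ] QPoly m q) (F : PowerSeries (QPoly m q)) :
    PowerSeries (QPoly m q) :=
  PowerSeries.mk fun n => D (PowerSeries.coeff (n + 1) F)

/-- The partial derivative `∂^j` of a formal power series. -/
def spd (j : Fin m) (F : PowerSeries (QPoly m q)) : PowerSeries (QPoly m q) :=
  seriesPartial q (pd q j) F

/-- The barred partial derivative of a formal power series. -/
def spdBar (j : Fin m) (F : PowerSeries (QPoly m q)) : PowerSeries (QPoly m q) :=
  seriesPartial q (pdBar q j) F

/-! ### Integration -/

/-- `v` is a value of `∫_{γ·ℝ^m_q} F`: the series `F` is a finite sum of terms `R(𝐱) f(𝐱²)` with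
`R` homogeneous of degree `k` and `f` analytic on `[0, ∞)`, the integral of such a term being
`∫_0^{γ·∞} r^{m+k-1} f(r²) d_q r * ∫_{sphere} R`; all these integrals converge and their sum
is `v`. -/
def HasSpaceIntegral (γ : ℝ) (F : PowerSeries (QPoly m q)) (v : ℂ) : Prop :=
  ∃ (n : ℕ) (k : Fin n → ℕ) (R : Fin n → QPoly m q) (f : Fin n → ℝ → ℂ),
    (∀ i, R i ∈ homog m q (k i)) ∧
    (∀ i, AnalyticOnNhd ℝ (f i) (Set.Ici 0)) ∧
    (∀ i, JacksonInfSummable q γ fun r => (r : ℂ) ^ (m + k i - 1) * f i (r ^ 2)) ∧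
    F = ∑ i, toSeries m q (R i) * radial m q (f i) ∧
    v = ∑ i, jacksonInf q γ (fun r => (r : ℂ) ^ (m + k i - 1) * f i (r ^ 2)) *
      sphereInt m q (R i)

/-- `v` is a value of `∫_{𝔹^m_q(lam)} F`: the series `F` is a finite sum of terms `R(𝐱) f(𝐱²)`
with `R` homogeneous of degree `k` and `f` analytic on `[0, lam²]`, the integral of such a term
being `∫_0^lam r^{m+k-1} f(r²) d_q r * ∫_{sphere} R`; all these integrals converge and their sum
is `v`. -/
def HasBallIntegral (lam : ℝ) (F : PowerSeries (QPoly m q)) (v : ℂ) : Prop :=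
  ∃ (n : ℕ) (k : Fin n → ℕ) (R : Fin n → QPoly m q) (f : Fin n → ℝ → ℂ),
    (∀ i, R i ∈ homog m q (k i)) ∧
    (∀ i, AnalyticOnNhd ℝ (f i) (Set.Icc 0 (lam ^ 2))) ∧
    (∀ i, JacksonSummable q lam fun r => (r : ℂ) ^ (m + k i - 1) * f i (r ^ 2)) ∧
    F = ∑ i, toSeries m q (R i) * radial m q (f i) ∧
    v = ∑ i, jackson q lam (fun r => (r : ℂ) ^ (m + k i - 1) * f i (r ^ 2)) *
      sphereInt m q (R i)

end QEuclid

end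

noncomputable section

namespace QEuclid

open Finset

/-! ### The braid matrix and its inverse -/

/-! The theorem is a `q`-divergence theorem in which each Gaussian reproduces itself under
differentiation. Let `D` be `∂^j` or its barred version. Contracting the derivation rule twice with
the metric gives `D (𝐱² a) = κ x^j a + s 𝐱² D a`, with `s = q²`, `κ = μ` without the bar and `s =
q⁻²`, `κ = q^(m-2) μ` with it. Iterating, `D (a f(𝐱²))` is `κ x^j a` times the difference quotient
of `f` between `𝐱²` and `s 𝐱²`, plus `(D a) f(s 𝐱²)`. Both Gaussians satisfy `f (s t) = (1 + b t) f
t`, so `D (a f(𝐱²))` is again a polynomial times the same `f`, namely `(κ b / (s - 1)) x^j a + D a +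
b 𝐱² D a` (`seriesPartial_weighted`).

Two facts make the integrals of these three terms cancel (`hasTermIntegral_seriesPartial`).
Radially, the moments `I_a` of `f` satisfy `I_a + b I_(a+2) = σ^(a+1) I_a`, by a shift of the
lattice on which the Jackson sum lives; `σ = q⁻¹` on the space and `σ = q` on the ball, where the
boundary term drops because `f (λ²) = 0`. On the sphere, `∫ 𝐱² a = ∫ a`, and for `a` of degree `2 l
+ 1` one has `∫ ∂^j a = μ [l + m/2] ∫ x^j a` (`sphereInt_pd`), with a further factor `q^(-2l)` for
the barred derivative (`sphereInt_pdBar`). For `a` of even degree all sphere integrals vanish by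
parity.

The value does not depend on the representation (`HasTermIntegral.unique`): the function `∑ r^(k_i)
f_i(r²) ∫ R_i` has as Taylor coefficients at `0` the sphere integrals of the homogeneous parts of
the series, so the identity theorem determines it on the whole interval of integration.

Most of the work is algebra: the derivatives must be shown to act on `𝒫`, and their identities with
`𝐱²` and `Δ` must be derived. Everything comes from four properties of the braid matrix: an explicit
inverse, the skein relation `RhatInv_eq`, the crossing symmetry that rotates `R̂` into `R̂⁻¹` by
means of the metric, and the braid relation. Written with cups and caps on triple tensor products,
they give the stability of the ideal of relations (`polyStep_rel`), the centrality of `𝐱²`, the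
formulas for `Δ x^j` and `Δ 𝐱²`, and the comparison `pdBar_homog` of the two calculi. -/

/-- The weight `q ^ ρ_i`. -/
def wt (m : ℕ) (q : ℝ) (i : Fin m) : ℂ := ((q ^ rho m i : ℝ) : ℂ)

theorem rho_rev (m : ℕ) (i : Fin m) : rho m (Fin.rev i) = -rho m i := by
  have hi := i.isLt
  have h1 : ((m - ((i : ℕ) + 1) : ℕ) : ℝ) = (m : ℝ) - ((i : ℝ) + 1) := by
    rw [Nat.cast_sub (by omega)]; push_cast; ring
  unfold rho
  simp only [Fin.val_rev, h1]
  split_ifs <;> first | omega | ring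

theorem wt_mul_rev {m : ℕ} {q : ℝ} (hq : 0 < q) (i : Fin m) :
    wt m q i * wt m q (Fin.rev i) = 1 := by
  rw [wt, wt, ← Complex.ofReal_mul, ← Real.rpow_add hq, rho_rev]
  simp

theorem metric_apply {m : ℕ} (q : ℝ) (i j : Fin m) :
    metric m q i j = if j = Fin.rev i then wt m q j else 0 := by
  unfold metric wt
  simp only [Matrix.of_apply]
  split_ifs with h
  · rw [h, rho_rev]
  · rfl

theorem wt_rev_sq {m : ℕ} {q : ℝ} (hq : 0 < q) (i : Fin m) :
    wt m q (Fin.rev i) ^ 2 = (q : ℂ) ^ (if 2 * (i : ℕ) + 1 < m then 2 * (i : ℤ) + 2 - m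
      else if 2 * (i : ℕ) + 1 = m then 0 else 2 * (i : ℤ) - m : ℤ) := by
  rw [wt, ← Complex.ofReal_pow, ← Complex.ofReal_zpow, rho_rev, ← Real.rpow_natCast,
    ← Real.rpow_mul hq.le, ← Real.rpow_intCast]
  congr 2
  unfold rho
  split_ifs <;> push_cast <;> ring

/-- The weights `q ^ (-2 ρ_i)` form a geometric progression of ratio `q²` except at the middle,
where the exponents read `-1, 0, 1` or `0, 0`. The sum therefore telescopes, and the two conditional
terms record the defect in the middle. The eigenvalue `q ^ (1 - m)` of the metric and the inverse of
the braid matrix both rest on this sum. -/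
theorem sum_wt_lt {m : ℕ} {q : ℝ} (hq : 0 < q) (b : Fin m) :
    ((q : ℂ) - (q : ℂ)⁻¹) * ∑ i, (if i < b then wt m q (Fin.rev i) ^ 2 else 0) =
      (if b = Fin.rev b then 1 else (q : ℂ)⁻¹) * wt m q (Fin.rev b) ^ 2 +
        (if Fin.rev b < b then (q : ℂ) - (q : ℂ)⁻¹ else 0) - (q : ℂ) ^ (1 - (m : ℤ)) := by
  have hq0 : (q : ℂ) ≠ 0 := by exact_mod_cast hq.ne'
  obtain ⟨b, hb⟩ := b
  induction b with
  | zero =>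
    simp only [wt_rev_sq hq]
    have h0 : ∀ i : Fin m, ¬ i < ⟨0, hb⟩ := fun i => by simp [Fin.lt_def]
    simp only [h0, if_false, Fin.ext_iff, Fin.val_rev, Fin.lt_def]
    by_cases h1 : m = 1
    · subst h1; simp
    · have h2 : 1 < m := by omega
      have e : (1 - (m : ℤ)) = (2 - m) - 1 := by ring
      have h3 : ¬ (0 = m - 1) := by omega
      simp [h2, h3, e, zpow_sub₀ hq0]
      ring
  | succ b ih =>
    have hb' : b < m := by omega
    have ih := ih hb'
    have h1 : ∀ i : Fin m, (if i < (⟨b + 1, hb⟩ : Fin m) then wt m q (Fin.rev i) ^ 2 else 0) =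
        (if i < (⟨b, hb'⟩ : Fin m) then wt m q (Fin.rev i) ^ 2 else 0) +
          if i = ⟨b, hb'⟩ then wt m q (Fin.rev i) ^ 2 else 0 := by
      intro i
      simp only [Fin.lt_def, Fin.ext_iff]
      split_ifs <;> first | omega | simp
    simp only [h1, Finset.sum_add_distrib, mul_add, ih]
    simp only [Finset.sum_ite_eq', Finset.mem_univ, if_true, wt_rev_sq hq]
    simp only [Fin.ext_iff, Fin.val_rev, Fin.lt_def]
    -- Position of the middle, in the order of the cases: `b` and `b + 1` both in the first half; `b
    -- + 1` the middle index of an odd `m`; `b`, `b + 1` the central pair of an even `m`; both in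
    -- the second half; `b` the middle index.
    rcases lt_trichotomy (2 * b + 3) m with h | h | h
    · have a1 : ¬ b = m - (b + 1) := by omega
      have a2 : ¬ m - (b + 1) < b := by omega
      have a3 : ¬ (b + 1 = m - (b + 1 + 1)) := by omega
      have a4 : ¬ (m - (b + 1 + 1) < b + 1) := by omega
      have a5 : 2 * b + 1 < m := by omega
      have a6 : 2 * (b + 1) + 1 < m := by omega
      simp only [a1, a2, a3, a4, a5, a6, if_true, if_false]
      have e : (2 * ((b + 1 : ℕ) : ℤ) + 2 - m) = (2 * (b : ℤ) + 2 - m) + 2 := by push_cast; ring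
      rw [e, zpow_add₀ hq0]
      norm_cast
      push_cast
      field_simp
      ring
    · have a1 : ¬ b = m - (b + 1) := by omega
      have a2 : ¬ m - (b + 1) < b := by omega
      have a3 : (b + 1 = m - (b + 1 + 1)) := by omega
      have a4 : ¬ (m - (b + 1 + 1) < b + 1) := by omega
      have a5 : 2 * b + 1 < m := by omega
      have a6 : ¬ 2 * (b + 1) + 1 < m := by omega
      have a7 : 2 * (b + 1) + 1 = m := by omega
      have a8 : (2 * (b : ℤ) + 2 - m) = -1 := by omega
      simp only [a1, a2, a4, a5, a6, a7, a8, if_true, if_false, ← a3]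
      simp
      field_simp
      ring
    · rcases Nat.lt_or_ge (2 * b + 1) m with g | g
      · have a1 : ¬ b = m - (b + 1) := by omega
        have a2 : ¬ m - (b + 1) < b := by omega
        have a3 : ¬ (b + 1 = m - (b + 1 + 1)) := by omega
        have a4 : (m - (b + 1 + 1) < b + 1) := by omega
        have a6 : ¬ 2 * (b + 1) + 1 < m := by omega
        have a7 : ¬ 2 * (b + 1) + 1 = m := by omega
        have a8 : (2 * (b : ℤ) + 2 - m) = 0 := by omega
        have a9 : (2 * ((b + 1 : ℕ) : ℤ) - m) = 0 := by push_cast; omega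
        simp only [a1, a2, a3, a4, g, a6, a7, a8, a9, if_true, if_false]
        simp
      · rcases Nat.lt_or_ge m (2 * b + 1) with g' | g'
        · have a1 : ¬ b = m - (b + 1) := by omega
          have a2 : m - (b + 1) < b := by omega
          have a3 : ¬ (b + 1 = m - (b + 1 + 1)) := by omega
          have a4 : (m - (b + 1 + 1) < b + 1) := by omega
          have a5 : ¬ 2 * b + 1 < m := by omega
          have a5' : ¬ 2 * b + 1 = m := by omega
          have a6 : ¬ 2 * (b + 1) + 1 < m := by omega
          have a7 : ¬ 2 * (b + 1) + 1 = m := by omega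
          simp only [a1, a2, a3, a4, a5, a5', a6, a7, if_true, if_false]
          have e : (2 * ((b + 1 : ℕ) : ℤ) - m) = (2 * (b : ℤ) - m) + 2 := by push_cast; ring
          rw [e, zpow_add₀ hq0]
          norm_cast
          push_cast
          field_simp
          ring
        · have a1 : b = m - (b + 1) := by omega
          have a2 : ¬ m - (b + 1) < b := by omega
          have a3 : ¬ (b + 1 = m - (b + 1 + 1)) := by omega
          have a4 : (m - (b + 1 + 1) < b + 1) := by omega
          have a5 : ¬ 2 * b + 1 < m := by omega
          have a5' : 2 * b + 1 = m := by omega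
          have a6 : ¬ 2 * (b + 1) + 1 < m := by omega
          have a7 : ¬ 2 * (b + 1) + 1 = m := by omega
          have a9 : (2 * ((b + 1 : ℕ) : ℤ) - m) = 1 := by push_cast; omega
          simp only [a2, a3, a4, a5, a5', a6, a7, a9, if_true, if_false, ← a1]
          simp
          field_simp
          ring

/-- The coefficient `q ^ (δ_{ij} - δ_{ij'})`. -/
def diagCoef (m : ℕ) (q : ℝ) (i j : Fin m) : ℂ :=
  if i = j then (if j = Fin.rev i then 1 else (q : ℂ))
  else (if j = Fin.rev i then (q : ℂ)⁻¹ else 1)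

theorem eq_rev_comm {m : ℕ} {i j : Fin m} : i = Fin.rev j ↔ j = Fin.rev i :=
  ⟨fun h => by rw [h, Fin.rev_rev], fun h => by rw [h, Fin.rev_rev]⟩

theorem diagCoef_comm {m : ℕ} (q : ℝ) (i j : Fin m) : diagCoef m q i j = diagCoef m q j i := by
  unfold diagCoef
  simp only [eq_rev_comm (i := i) (j := j), eq_comm (a := i) (b := j)]

theorem diagCoef_rev {m : ℕ} {q : ℝ} (i j : Fin m) :
    diagCoef m q i (Fin.rev j) = (diagCoef m q i j)⁻¹ := by
  unfold diagCoef
  have h1 : (i = Fin.rev j) ↔ (j = Fin.rev i) := eq_rev_comm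
  have h2 : (Fin.rev j = Fin.rev i) ↔ (i = j) := by rw [Fin.rev_inj, eq_comm]
  simp only [h1, h2]
  split_ifs <;> simp

theorem diagCoef_rev_left {m : ℕ} {q : ℝ} (i j : Fin m) :
    diagCoef m q (Fin.rev i) j = (diagCoef m q i j)⁻¹ := by
  rw [diagCoef_comm, diagCoef_rev, diagCoef_comm]

theorem diagCoef_ne_zero {m : ℕ} {q : ℝ} (hq : 0 < q) (i j : Fin m) : diagCoef m q i j ≠ 0 := by
  have hq0 : (q : ℂ) ≠ 0 := by exact_mod_cast hq.ne'
  unfold diagCoef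
  split_ifs <;> simp [hq0]

theorem Rhat_apply {m : ℕ} {q : ℝ} (hq : 0 < q) (a b i j : Fin m) :
    Rhat m q (a, b) (i, j) =
      (if a = j ∧ b = i then diagCoef m q i j else 0)
      + (if a = i ∧ b = j ∧ i < j then (q : ℂ) - (q : ℂ)⁻¹ else 0)
      - (if a = Fin.rev b ∧ j = Fin.rev i ∧ i < b then
        ((q : ℂ) - (q : ℂ)⁻¹) * (wt m q b * wt m q (Fin.rev i)) else 0) := by
  unfold Rhat diagCoef wt
  simp only [Matrix.of_apply, Prod.mk.injEq, and_assoc]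
  congr 1
  · congr 1
    · congr 1
      split_ifs <;> simp
    · push_cast; rfl
  · congr 1
    rw [rho_rev, ← Complex.ofReal_mul, ← Real.rpow_add hq]
    push_cast
    rfl

/-- The explicit inverse of the braid matrix. -/
def RhatInv (m : ℕ) (q : ℝ) : Matrix (Fin m × Fin m) (Fin m × Fin m) ℂ :=
  Matrix.of fun ab ij =>
    (if ab.1 = ij.2 ∧ ab.2 = ij.1 then (diagCoef m q ij.1 ij.2)⁻¹ else 0)
    - (if ab.1 = ij.1 ∧ ab.2 = ij.2 ∧ ij.2 < ij.1 then (q : ℂ) - (q : ℂ)⁻¹ else 0)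
    + (if ab.1 = Fin.rev ab.2 ∧ ij.2 = Fin.rev ij.1 ∧ ab.2 < ij.1 then
      ((q : ℂ) - (q : ℂ)⁻¹) * (wt m q ab.2 * wt m q (Fin.rev ij.1)) else 0)

theorem RhatInv_apply {m : ℕ} {q : ℝ} (a b i j : Fin m) :
    RhatInv m q (a, b) (i, j) =
      (if a = j ∧ b = i then (diagCoef m q i j)⁻¹ else 0)
      - (if a = i ∧ b = j ∧ j < i then (q : ℂ) - (q : ℂ)⁻¹ else 0)
      + (if a = Fin.rev b ∧ j = Fin.rev i ∧ b < i then
        ((q : ℂ) - (q : ℂ)⁻¹) * (wt m q b * wt m q (Fin.rev i)) else 0) := rfl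

/-- The crossing symmetry of the braid matrix. -/
theorem RhatInv_crossing {m : ℕ} {q : ℝ} (hq : 0 < q) (i j a k : Fin m) :
    wt m q (Fin.rev k) * RhatInv m q (i, j) (a, k) =
      wt m q (Fin.rev i) * Rhat m q (j, Fin.rev k) (Fin.rev i, a) := by
  rw [Rhat_apply hq, RhatInv_apply]
  have hr := wt_mul_rev hq k
  have hr' := wt_mul_rev hq i
  -- The rotation preserves the flip term and exchanges the ordered diagonal term with the trace
  -- term; `t1`, `t2`, `t3` then compare the weights.
  have e1 : (i = k ∧ j = a) ↔ (j = a ∧ Fin.rev k = Fin.rev i) := by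
    rw [Fin.rev_inj]; tauto
  have e2 : (i = a ∧ j = k ∧ k < a) ↔
      (j = Fin.rev (Fin.rev k) ∧ a = Fin.rev (Fin.rev i) ∧ Fin.rev i < Fin.rev k) := by
    rw [Fin.rev_rev, Fin.rev_rev, Fin.rev_lt_rev]
    constructor <;> (rintro ⟨rfl, rfl, h⟩; exact ⟨rfl, rfl, h⟩)
  have e3 : (i = Fin.rev j ∧ k = Fin.rev a ∧ j < a) ↔
      (j = Fin.rev i ∧ Fin.rev k = a ∧ Fin.rev i < a) := by
    constructor
    · rintro ⟨rfl, rfl, h⟩; simpa using h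
    · rintro ⟨rfl, rfl, h⟩; simpa using h
  simp only [e1, e2, e3, mul_add, mul_sub, mul_ite, mul_zero]
  have t1 : (if j = a ∧ Fin.rev k = Fin.rev i then
        wt m q (Fin.rev k) * (diagCoef m q a k)⁻¹ else 0) =
      if j = a ∧ Fin.rev k = Fin.rev i then
        wt m q (Fin.rev i) * diagCoef m q (Fin.rev i) a else 0 := by
    split_ifs with h
    · rw [← h.2, diagCoef_rev_left, diagCoef_comm]
    · rfl
  have t2 : (if j = Fin.rev i ∧ Fin.rev k = a ∧ Fin.rev i < a then
        wt m q (Fin.rev k) * (((q : ℂ) - (q : ℂ)⁻¹) * (wt m q j * wt m q (Fin.rev a))) else 0) =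
      if j = Fin.rev i ∧ Fin.rev k = a ∧ Fin.rev i < a then
        wt m q (Fin.rev i) * ((q : ℂ) - (q : ℂ)⁻¹) else 0 := by
    split_ifs with h
    · obtain ⟨rfl, rfl, -⟩ := h
      rw [Fin.rev_rev]
      linear_combination (wt m q (Fin.rev i) * ((q : ℂ) - (q : ℂ)⁻¹)) * hr
    · rfl
  have t3 : (if j = Fin.rev (Fin.rev k) ∧ a = Fin.rev (Fin.rev i) ∧ Fin.rev i < Fin.rev k then
        wt m q (Fin.rev i) * (((q : ℂ) - (q : ℂ)⁻¹) *
          (wt m q (Fin.rev k) * wt m q (Fin.rev (Fin.rev i)))) else 0) =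
      if j = Fin.rev (Fin.rev k) ∧ a = Fin.rev (Fin.rev i) ∧ Fin.rev i < Fin.rev k then
        wt m q (Fin.rev k) * ((q : ℂ) - (q : ℂ)⁻¹) else 0 := by
    split_ifs with h
    · rw [Fin.rev_rev]
      linear_combination (wt m q (Fin.rev k) * ((q : ℂ) - (q : ℂ)⁻¹)) * hr'
    · rfl
  rw [t1, t2, t3]
  ring

/-- A quarter turn made with the metric interchanges a crossing and the inverse crossing, so the
computation is that of `RhatInv_crossing` with the two matrices exchanged. -/
theorem Rhat_crossing {m : ℕ} {q : ℝ} (hq : 0 < q) (i j a k : Fin m) :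
    wt m q (Fin.rev k) * Rhat m q (i, j) (a, k) =
      wt m q (Fin.rev i) * RhatInv m q (j, Fin.rev k) (Fin.rev i, a) := by
  rw [Rhat_apply hq, RhatInv_apply]
  have hr := wt_mul_rev hq k
  have hr' := wt_mul_rev hq i
  have e1 : (i = k ∧ j = a) ↔ (j = a ∧ Fin.rev k = Fin.rev i) := by
    rw [Fin.rev_inj]; tauto
  have e2 : (i = a ∧ j = k ∧ a < k) ↔
      (j = Fin.rev (Fin.rev k) ∧ a = Fin.rev (Fin.rev i) ∧ Fin.rev k < Fin.rev i) := by
    rw [Fin.rev_rev, Fin.rev_rev, Fin.rev_lt_rev]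
    constructor <;> (rintro ⟨rfl, rfl, h⟩; exact ⟨rfl, rfl, h⟩)
  have e3 : (i = Fin.rev j ∧ k = Fin.rev a ∧ a < j) ↔
      (j = Fin.rev i ∧ Fin.rev k = a ∧ a < Fin.rev i) := by
    constructor
    · rintro ⟨rfl, rfl, h⟩; simpa using h
    · rintro ⟨rfl, rfl, h⟩; simpa using h
  simp only [e1, e2, e3, mul_add, mul_sub, mul_ite, mul_zero]
  have t1 : (if j = a ∧ Fin.rev k = Fin.rev i then
        wt m q (Fin.rev k) * diagCoef m q a k else 0) =
      if j = a ∧ Fin.rev k = Fin.rev i then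
        wt m q (Fin.rev i) * (diagCoef m q (Fin.rev i) a)⁻¹ else 0 := by
    split_ifs with h
    · rw [← h.2, diagCoef_rev_left, diagCoef_comm, inv_inv]
    · rfl
  have t2 : (if j = Fin.rev i ∧ Fin.rev k = a ∧ a < Fin.rev i then
        wt m q (Fin.rev k) * (((q : ℂ) - (q : ℂ)⁻¹) * (wt m q j * wt m q (Fin.rev a))) else 0) =
      if j = Fin.rev i ∧ Fin.rev k = a ∧ a < Fin.rev i then
        wt m q (Fin.rev i) * ((q : ℂ) - (q : ℂ)⁻¹) else 0 := by
    split_ifs with h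
    · obtain ⟨rfl, rfl, -⟩ := h
      rw [Fin.rev_rev]
      linear_combination (wt m q (Fin.rev i) * ((q : ℂ) - (q : ℂ)⁻¹)) * hr
    · rfl
  have t3 : (if j = Fin.rev (Fin.rev k) ∧ a = Fin.rev (Fin.rev i) ∧ Fin.rev k < Fin.rev i then
        wt m q (Fin.rev i) * (((q : ℂ) - (q : ℂ)⁻¹) *
          (wt m q (Fin.rev k) * wt m q (Fin.rev (Fin.rev i)))) else 0) =
      if j = Fin.rev (Fin.rev k) ∧ a = Fin.rev (Fin.rev i) ∧ Fin.rev k < Fin.rev i then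
        wt m q (Fin.rev k) * ((q : ℂ) - (q : ℂ)⁻¹) else 0 := by
    split_ifs with h
    · rw [Fin.rev_rev]
      linear_combination (wt m q (Fin.rev k) * ((q : ℂ) - (q : ℂ)⁻¹)) * hr'
    · rfl
  rw [t1, t2, t3]
  ring

theorem Rhat_symm {m : ℕ} {q : ℝ} (hq : 0 < q) : (Rhat m q).transpose = Rhat m q := by
  ext ⟨a, b⟩ ⟨i, j⟩
  rw [Matrix.transpose_apply, Rhat_apply hq, Rhat_apply hq]
  have e1 : (i = b ∧ j = a) ↔ (a = j ∧ b = i) := by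
    constructor <;> (rintro ⟨rfl, rfl⟩; exact ⟨rfl, rfl⟩)
  have e2 : (i = a ∧ j = b ∧ a < b) ↔ (a = i ∧ b = j ∧ i < j) := by
    constructor <;> (rintro ⟨rfl, rfl, h⟩; exact ⟨rfl, rfl, h⟩)
  have e3 : (i = Fin.rev j ∧ b = Fin.rev a ∧ a < j) ↔ (a = Fin.rev b ∧ j = Fin.rev i ∧ i < b) := by
    constructor
    · rintro ⟨rfl, rfl, h⟩
      refine ⟨by simp, by simp, ?_⟩
      rw [← Fin.rev_lt_rev]; simpa using h
    · rintro ⟨rfl, rfl, h⟩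
      refine ⟨by simp, by simp, ?_⟩
      rw [← Fin.rev_lt_rev]; simpa using h
  simp only [e1, e2, e3]
  congr 1
  · congr 1
    split_ifs with h
    · rw [h.1, h.2, diagCoef_comm]
    · rfl
  · split_ifs with h
    · obtain ⟨rfl, rfl, -⟩ := h
      rw [Fin.rev_rev, mul_comm (wt m q b)]
    · rfl

/-! ### Matrices acting on families of vectors -/

/-- Application of a matrix to a family of vectors of a module. -/
def act {ι κ M : Type*} [Fintype κ] [AddCommMonoid M] [Module ℂ M] (T : Matrix ι κ ℂ)
    (u : κ → M) (i : ι) : M := ∑ j, T i j • u j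

section act

variable {ι κ l M : Type*} [Fintype κ] [Fintype l] [AddCommGroup M] [Module ℂ M]

theorem act_mul (S : Matrix ι κ ℂ) (T : Matrix κ l ℂ) (u : l → M) :
    act (S * T) u = act S (act T u) := by
  funext i
  simp only [act, Matrix.mul_apply, Finset.sum_smul, Finset.smul_sum, smul_smul]
  exact Finset.sum_comm

theorem act_one [DecidableEq κ] (u : κ → M) : act (1 : Matrix κ κ ℂ) u = u := by
  funext i
  simp [act, Matrix.one_apply]

theorem act_add (S T : Matrix ι κ ℂ) (u : κ → M) : act (S + T) u = act S u + act T u := by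
  funext i
  simp [act, add_smul, Finset.sum_add_distrib]

theorem act_sub (S T : Matrix ι κ ℂ) (u : κ → M) : act (S - T) u = act S u - act T u := by
  funext i
  simp [act, sub_smul, Finset.sum_sub_distrib]

theorem act_smul (c : ℂ) (T : Matrix ι κ ℂ) (u : κ → M) : act (c • T) u = c • act T u := by
  funext i
  simp [act, Finset.smul_sum, smul_smul]

theorem act_zero_mat (u : κ → M) : act (0 : Matrix ι κ ℂ) u = 0 := by
  funext i
  simp [act]

theorem act_zero (T : Matrix ι κ ℂ) : act T (0 : κ → M) = 0 := by
  funext i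
  simp [act]

theorem act_vec_add (T : Matrix ι κ ℂ) (u v : κ → M) : act T (u + v) = act T u + act T v := by
  funext i
  simp [act, Finset.sum_add_distrib]

theorem act_vec_smul (c : ℂ) (T : Matrix ι κ ℂ) (u : κ → M) : act T (c • u) = c • act T u := by
  funext i
  simp [act, Finset.smul_sum, smul_smul, mul_comm]

theorem act_map {N : Type*} [AddCommGroup N] [Module ℂ N] (g : M →ₗ[ℂ] N) (T : Matrix ι κ ℂ)
    (u : κ → M) (i : ι) : g (act T u i) = act T (fun j => g (u j)) i := by
  simp [act]

/-- Matrix identities can thus be checked on vectors, where each term of the braid matrix is a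
substitution of indices instead of a sum of Kronecker deltas. -/
theorem matrix_ext_act {S T : Matrix ι κ ℂ} (h : ∀ u : κ → ℂ, act S u = act T u) : S = T := by
  classical
  ext i j
  have := congrFun (h (Pi.single j 1)) i
  simpa [act, Pi.single_apply] using this

end act

section legs

variable {m : ℕ} {q : ℝ} {M : Type*} [AddCommGroup M] [Module ℂ M]

theorem act_Rhat (hq : 0 < q) (u : Fin m × Fin m → M) (a b : Fin m) :
    act (Rhat m q) u (a, b) = diagCoef m q a b • u (b, a)
      + (if a < b then ((q : ℂ) - (q : ℂ)⁻¹) • u (a, b) else 0)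
      - (if a = Fin.rev b then ∑ i, (if i < b then
          (((q : ℂ) - (q : ℂ)⁻¹) * (wt m q b * wt m q (Fin.rev i))) • u (i, Fin.rev i) else 0)
        else 0) := by
  simp only [act, Rhat_apply hq, sub_smul, add_smul, Finset.sum_add_distrib,
    Finset.sum_sub_distrib, Fintype.sum_prod_type, ite_smul, zero_smul, ite_and]
  congr 1
  · congr 1
    · simp [diagCoef_comm]
    · simp
  · split_ifs <;> simp

theorem act_RhatInv (u : Fin m × Fin m → M) (a b : Fin m) :
    act (RhatInv m q) u (a, b) = (diagCoef m q a b)⁻¹ • u (b, a)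
      - (if b < a then ((q : ℂ) - (q : ℂ)⁻¹) • u (a, b) else 0)
      + (if a = Fin.rev b then ∑ i, (if b < i then
          (((q : ℂ) - (q : ℂ)⁻¹) * (wt m q b * wt m q (Fin.rev i))) • u (i, Fin.rev i) else 0)
        else 0) := by
  simp only [act, RhatInv_apply, sub_smul, add_smul, Finset.sum_add_distrib,
    Finset.sum_sub_distrib, Fintype.sum_prod_type, ite_smul, zero_smul, ite_and]
  congr 1
  · congr 1
    · simp [diagCoef_comm]
    · simp
  · split_ifs <;> simp

end legs

end QEuclid
end

noncomputable section

namespace QEuclid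

open Finset

/-! ### The inverse of the braid matrix and the skein relation -/

section inverse

variable {m : ℕ} {q : ℝ}

/-- The trace projector `K^{ab}_{ij} = C^{ab} C_{ij}`. -/
def traceProj (m : ℕ) (q : ℝ) : Matrix (Fin m × Fin m) (Fin m × Fin m) ℂ :=
  Matrix.of fun ab ij => metric m q ab.1 ab.2 * metric m q ij.1 ij.2

theorem metric_apply' (i j : Fin m) :
    metric m q i j = if i = Fin.rev j then wt m q j else 0 := by
  rw [metric_apply]
  simp only [eq_rev_comm (i := i) (j := j)]

theorem wt_ne_zero (hq : 0 < q) (i : Fin m) : wt m q i ≠ 0 :=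
  left_ne_zero_of_mul_eq_one (wt_mul_rev hq i)

theorem diagCoef_self_inv (b : Fin m) :
    (diagCoef m q b b)⁻¹ = if b = Fin.rev b then 1 else (q : ℂ)⁻¹ := by
  unfold diagCoef
  by_cases hb : b = Fin.rev b
  · rw [if_pos rfl, if_pos hb, if_pos hb, inv_one]
  · rw [if_pos rfl, if_neg hb, if_neg hb]

/-- On a pair `(b', b)` the trace term is `sum_wt_lt`; its first two summands cancel the flip term
and the ordered diagonal term, and only `q ^ (1 - m)` survives. -/
theorem act_Rhat_metric (hq : 0 < q) (a b : Fin m) :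
    act (Rhat m q) (fun p => metric m q p.1 p.2) (a, b) =
      (q : ℂ) ^ (1 - (m : ℤ)) * metric m q a b := by
  rw [act_Rhat hq]
  simp only [metric_apply', Fin.rev_rev, smul_eq_mul]
  by_cases hab : a = Fin.rev b
  · subst hab
    have hs := sum_wt_lt hq b
    have hw := wt_mul_rev hq b
    simp only [if_true, Fin.rev_rev]
    have e : ∀ i : Fin m, (if i < b then ((q : ℂ) - (q : ℂ)⁻¹) * (wt m q b * wt m q (Fin.rev i)) *
        wt m q (Fin.rev i) else 0) =
        wt m q b * (((q : ℂ) - (q : ℂ)⁻¹) * (if i < b then wt m q (Fin.rev i) ^ 2 else 0)) := by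
      intro i; split_ifs <;> ring
    simp only [e, ← Finset.mul_sum, hs, diagCoef_rev_left, diagCoef_self_inv]
    generalize (if b = Fin.rev b then (1 : ℂ) else (q : ℂ)⁻¹) = d
    split_ifs <;> linear_combination (-d * wt m q (Fin.rev b)) * hw
  · have : ¬ b = Fin.rev a := fun h => hab (eq_rev_comm.1 h)
    simp [hab, this]

/-- `RhatInv` is `Rhat` with `q` replaced by `q⁻¹` and all indices reversed. If `a ≠ b'`, the
component `(a, b)` involves only `u (a, b)` and `u (b, a)` and the check is immediate. The pairs
`(i', i)` form one remaining block, where the product of the two trace terms is evaluated by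
`sum_wt_lt`. -/
theorem Rhat_mul_RhatInv (hq : 0 < q) : Rhat m q * RhatInv m q = 1 := by
  refine matrix_ext_act fun u => ?_
  rw [act_mul, act_one]
  funext ⟨a, b⟩
  rw [act_Rhat hq]
  simp only [act_RhatInv, smul_eq_mul]
  by_cases hab : a = Fin.rev b
  swap
  · have hba : ¬ b = Fin.rev a := fun h => hab (eq_rev_comm.1 h)
    have hd := diagCoef_ne_zero hq a b
    have hab' : a = b → diagCoef m q a b = q := by
      rintro rfl; unfold diagCoef; rw [if_pos rfl, if_neg hab]
    have hab'' : a ≠ b → diagCoef m q a b = 1 := by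
      intro h; unfold diagCoef; rw [if_neg h, if_neg hba]
    simp only [hab, hba, if_false, add_zero, sub_zero, diagCoef_comm q b a]
    rcases lt_trichotomy a b with h | h | h
    · simp only [h, h.not_gt, if_true, if_false, hab'' h.ne]; simp
    · subst h; simp [hd]
    · simp only [h, h.not_gt, if_true, if_false, hab'' h.ne']; simp
  subst hab
  simp only [Fin.rev_rev, if_true, diagCoef_rev, diagCoef_rev_left, inv_inv]
  set h := (q : ℂ) - (q : ℂ)⁻¹ with hh
  -- The left side is the coefficient of `u (l', l)` in the component `(b', b)` of the product.
  have key : ∀ l, (diagCoef m q b b)⁻¹ * ((if l = b then diagCoef m q b b else 0) -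
        (if l = Fin.rev b ∧ Fin.rev b < b then h else 0) +
        (if l < b then h * (wt m q (Fin.rev b) * wt m q l) else 0)) +
      (if Fin.rev b < b then h * ((if l = Fin.rev b then diagCoef m q b b else 0) -
        (if l = b ∧ b < Fin.rev b then h else 0) +
        (if l < Fin.rev b then h * (wt m q b * wt m q l) else 0)) else 0) -
      ((if l < b then h * (wt m q b * wt m q (Fin.rev l)) * diagCoef m q l l else 0) -
        (if Fin.rev l < b ∧ l < Fin.rev l then h * (wt m q b * wt m q l) * h else 0) +
        ∑ i, (if i < b ∧ l < i then h * (wt m q b * wt m q (Fin.rev i)) *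
          (h * (wt m q (Fin.rev i) * wt m q l)) else 0)) = if l = b then 1 else 0 := by
    intro l
    have hd := diagCoef_ne_zero hq b b
    have hdl := diagCoef_ne_zero hq l l
    -- The sum over `l < i < b` is the difference of the initial sums up to `b` and up to `l`, less
    -- the term `i = l`.
    have hs : ∑ i, (if i < b ∧ l < i then h * (wt m q b * wt m q (Fin.rev i)) *
          (h * (wt m q (Fin.rev i) * wt m q l)) else 0) =
        if l < b then h * wt m q b * wt m q l *
          ((diagCoef m q b b)⁻¹ * wt m q (Fin.rev b) ^ 2 + (if Fin.rev b < b then h else 0)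
          - (diagCoef m q l l)⁻¹ * wt m q (Fin.rev l) ^ 2 - (if Fin.rev l < l then h else 0)
          - h * wt m q (Fin.rev l) ^ 2) else 0 := by
      by_cases hlb : l < b
      · rw [if_pos hlb]
        have e : ∀ i : Fin m, (if i < b ∧ l < i then h * (wt m q b * wt m q (Fin.rev i)) *
            (h * (wt m q (Fin.rev i) * wt m q l)) else 0) = h * wt m q b * wt m q l *
            (h * (if i < b then wt m q (Fin.rev i) ^ 2 else 0)
              - h * (if i < l then wt m q (Fin.rev i) ^ 2 else 0)
              - h * (if i = l then wt m q (Fin.rev i) ^ 2 else 0)) := by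
          intro i
          rcases lt_trichotomy i l with g | g | g
          · have := g.trans hlb
            simp [g, this, g.not_gt, g.ne]
          · subst g; simp [hlb]
          · simp only [g, g.not_gt, g.ne', and_true, if_false]; split_ifs <;> ring
        rw [Finset.sum_congr rfl fun i _ => e i, ← Finset.mul_sum, Finset.sum_sub_distrib,
          Finset.sum_sub_distrib, ← Finset.mul_sum, ← Finset.mul_sum, ← Finset.mul_sum,
          sum_wt_lt hq b, sum_wt_lt hq l, diagCoef_self_inv, diagCoef_self_inv]
        simp only [Finset.sum_ite_eq', Finset.mem_univ, if_true]
        ring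
      · rw [if_neg hlb]
        refine Finset.sum_eq_zero fun i _ => if_neg fun hi => hlb (hi.2.trans hi.1)
    rw [hs]
    have hw := wt_mul_rev hq b
    have hwl := wt_mul_rev hq l
    have c1 : l < b ↔ Fin.rev b < Fin.rev l := Fin.rev_lt_rev.symm
    have hbd : b ≠ Fin.rev b → diagCoef m q b b = q := by
      intro hb; unfold diagCoef; rw [if_pos rfl, if_neg hb]
    have hbd1 : b = Fin.rev b → diagCoef m q b b = 1 := by
      intro hb; unfold diagCoef; rw [if_pos rfl, if_pos hb]
    have hld : l ≠ Fin.rev l → diagCoef m q l l = q := by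
      intro hb; unfold diagCoef; rw [if_pos rfl, if_neg hb]
    have hld1 : l = Fin.rev l → diagCoef m q l l = 1 := by
      intro hb; unfold diagCoef; rw [if_pos rfl, if_pos hb]
    rcases lt_trichotomy l b with g | g | g
    -- What remains for `l < b` after cancelling products of inverse weights. It depends only on the
    -- relative order of `l`, `b` and their mirror images.
    · have main : (diagCoef m q b b)⁻¹ * (- (if l = Fin.rev b ∧ Fin.rev b < b then h else 0)) +
          (if Fin.rev b < b then h * ((if l = Fin.rev b then diagCoef m q b b else 0) +
            (if l < Fin.rev b then h * (wt m q b * wt m q l) else 0)) else 0)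
          + (if Fin.rev l < b ∧ l < Fin.rev l then h * (wt m q b * wt m q l) * h else 0)
          - (if Fin.rev b < b then h else 0) * h * wt m q b * wt m q l
          + (if Fin.rev l < l then h else 0) * h * wt m q b * wt m q l
          - h * wt m q b * wt m q (Fin.rev l) *
            (diagCoef m q l l - (diagCoef m q l l)⁻¹ - h) = 0 := by
        have x : (diagCoef m q l l - (diagCoef m q l l)⁻¹ - h) =
            if l = Fin.rev l then -h else 0 := by
          split_ifs with hl
          · rw [hld1 hl]; simp
          · rw [hld hl]; ring
        rw [x]
        by_cases e1 : l = Fin.rev b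
        · have e2 : Fin.rev l = b := by rw [e1, Fin.rev_rev]
          have e3 : Fin.rev b < b := by rwa [← e1]
          have e4 : ¬ l = b := g.ne
          have e5 : b ≠ Fin.rev b := e3.ne'
          rw [e2, ← e1, hbd e5]
          have e6 : wt m q b * wt m q l = 1 := by rw [e1]; exact hw
          simp only [g, g.not_gt, e4, lt_irrefl, and_true, if_true, if_false, false_and]
          linear_combination (-h * h) * e6
        · have e1' : ¬ Fin.rev l = b := fun h => e1 (by rw [← h, Fin.rev_rev])
          rcases lt_trichotomy (Fin.rev b) b with f | f | f
          · rcases lt_trichotomy l (Fin.rev b) with k | k | k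
            · have k1 : b < Fin.rev l := by rw [← Fin.rev_lt_rev, Fin.rev_rev]; exact k
              have k2 : l < Fin.rev l := g.trans k1
              simp [e1, f, k, k1.not_gt, k2.ne, k2.not_gt]; ring
            · exact absurd k e1
            · have k1 : Fin.rev l < b := by rw [← Fin.rev_lt_rev, Fin.rev_rev]; exact k
              rcases lt_trichotomy l (Fin.rev l) with o | o | o
              · simp [e1, f, k.not_gt, k1, o, o.not_gt, o.ne]; ring
              · rw [← o]; simp [e1, f, k.not_gt, g]; ring
              · simp [e1, f, k.not_gt, k1, o, o.not_gt, o.ne']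
          · have k1 : b < Fin.rev l := by rw [← f]; exact c1.1 g
            have k2 : l < Fin.rev l := g.trans k1
            simp [f, k1.not_gt, k2.ne, k2.not_gt]
          · have k1 : b < Fin.rev l := f.trans (c1.1 g)
            have k2 : l < Fin.rev l := g.trans k1
            simp [f.not_gt, k1.not_gt, k2.ne, k2.not_gt]
      simp only [g, g.ne, if_true, if_false, false_and, sub_zero]
      linear_combination main - (diagCoef m q b b)⁻¹ * h * wt m q (Fin.rev b) * wt m q l * hw
        + (h * wt m q b * wt m q (Fin.rev l)) * ((diagCoef m q l l)⁻¹ + h) * hwl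
    · subst g
      rcases lt_trichotomy (Fin.rev l) l with f | f | f
      · simp [f, f.ne', f.not_gt, hd]
      · simp [f, hd]
      · simp [f.not_gt, hd]
    · have k0 : Fin.rev l < Fin.rev b := Fin.rev_lt_rev.2 g
      have z1 : ¬ (l = Fin.rev b ∧ Fin.rev b < b) := fun k => by
        rw [← k.1] at k; exact g.not_gt k.2
      have z2 : ¬ (Fin.rev l < b ∧ l < Fin.rev l) := fun k => g.not_gt (k.2.trans k.1)
      rcases lt_trichotomy (Fin.rev b) b with f | f | f
      · have z3 : ¬ l = Fin.rev b := fun k => (f.trans g).ne' k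
        have z4 : ¬ l < Fin.rev b := (f.trans g).not_gt
        simp only [g.ne', g.not_gt, z1, z2, z3, z4, f, if_true, if_false, false_and]; simp
      · have z3 : ¬ l = b := g.ne'
        simp only [g.ne', g.not_gt, z1, z2, f, lt_irrefl, if_false, false_and]; simp
      · simp only [g.ne', g.not_gt, z1, z2, f.not_gt, if_false, false_and]; simp
  -- It remains to collect the whole expression as a linear form in the `u (l', l)`, reindexing by
  -- `Fin.rev` where a sum runs over pairs `(i, i')`.
  refine Eq.trans ?_ ((Finset.sum_congr (rfl : (Finset.univ : Finset (Fin m)) = _) fun l _ =>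
    congrArg (· * u (Fin.rev l, l)) (key l)).trans (by simp))
  have hsub : ∀ f : Fin m → ℂ, ∑ l, f l = ∑ l, f (Fin.rev l) := fun f =>
    (Equiv.sum_comp Fin.revPerm f).symm
  have r2 : ∀ l : Fin m, b < Fin.rev l ↔ l < Fin.rev b := fun l => by
    rw [← Fin.rev_lt_rev, Fin.rev_rev]
  have r3 : ∀ i l : Fin m, Fin.rev i < Fin.rev l ↔ l < i := fun i l => Fin.rev_lt_rev
  have s2 : ∑ i, (if b < i then h * (wt m q b * wt m q (Fin.rev i)) *
      u (i, Fin.rev i) else 0) = ∑ l, (if l < Fin.rev b then h * (wt m q b * wt m q l) else 0) *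
        u (Fin.rev l, l) := by
    rw [hsub]; simp only [r2, Fin.rev_rev, ite_mul, zero_mul]
  have s3 : ∀ i : Fin m, ∑ l, (if Fin.rev i < l then h * (wt m q (Fin.rev i) * wt m q (Fin.rev l)) *
      u (l, Fin.rev l) else 0) = ∑ l, (if l < i then h * (wt m q (Fin.rev i) * wt m q l) else 0) *
        u (Fin.rev l, l) := by
    intro i
    rw [hsub]; simp only [r3, Fin.rev_rev, ite_mul, zero_mul]
  have s4 : ∑ i, (if i < b then h * (wt m q b * wt m q (Fin.rev i)) *
      (diagCoef m q i i * u (Fin.rev i, i) - (if Fin.rev i < i then h * u (i, Fin.rev i) else 0)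
        + ∑ l, (if l < i then h * (wt m q (Fin.rev i) * wt m q l) else 0) * u (Fin.rev l, l))
        else 0) = ∑ l, ((if l < b then h * (wt m q b * wt m q (Fin.rev l)) * diagCoef m q l l else 0) -
        (if Fin.rev l < b ∧ l < Fin.rev l then h * (wt m q b * wt m q l) * h else 0) +
        ∑ i, (if i < b ∧ l < i then h * (wt m q b * wt m q (Fin.rev i)) *
          (h * (wt m q (Fin.rev i) * wt m q l)) else 0)) * u (Fin.rev l, l) := by
    have t1 : ∑ l, (if Fin.rev l < b ∧ l < Fin.rev l then h * (wt m q b * wt m q l) * h else 0) *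
        u (Fin.rev l, l) = ∑ i, (if i < b then h * (wt m q b * wt m q (Fin.rev i)) *
          (if Fin.rev i < i then h * u (i, Fin.rev i) else 0) else 0) := by
      rw [hsub]
      refine Finset.sum_congr rfl fun i _ => ?_
      simp only [Fin.rev_rev, ite_and]
      split_ifs <;> ring
    have t2 : ∑ l, (∑ i, (if i < b ∧ l < i then h * (wt m q b * wt m q (Fin.rev i)) *
          (h * (wt m q (Fin.rev i) * wt m q l)) else 0)) * u (Fin.rev l, l) =
        ∑ i, (if i < b then h * (wt m q b * wt m q (Fin.rev i)) *
          ∑ l, (if l < i then h * (wt m q (Fin.rev i) * wt m q l) else 0) * u (Fin.rev l, l)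
          else 0) := by
      simp only [Finset.sum_mul]
      rw [Finset.sum_comm]
      refine Finset.sum_congr rfl fun i _ => ?_
      split_ifs with hi
      · rw [Finset.mul_sum]
        refine Finset.sum_congr rfl fun l _ => ?_
        simp only [hi, true_and]
        split_ifs <;> ring
      · simp [hi]
    simp only [add_mul, sub_mul, Finset.sum_add_distrib, Finset.sum_sub_distrib, t1, t2]
    rw [← Finset.sum_sub_distrib, ← Finset.sum_add_distrib]
    refine Finset.sum_congr rfl fun i _ => ?_
    split_ifs <;> ring
  simp only [s3]
  rw [s2, s4]
  have p1 : ∑ l, (if l = b then diagCoef m q b b else 0) * u (Fin.rev l, l) =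
      diagCoef m q b b * u (Fin.rev b, b) := by simp
  have p2 : ∑ l, (if l = Fin.rev b ∧ Fin.rev b < b then h else 0) * u (Fin.rev l, l) =
      if Fin.rev b < b then h * u (b, Fin.rev b) else 0 := by
    split_ifs with hb <;> simp [hb]
  have p3 : ∑ l, (if l = Fin.rev b then diagCoef m q b b else 0) * u (Fin.rev l, l) =
      diagCoef m q b b * u (b, Fin.rev b) := by simp
  have p4 : ∑ l, (if l = b ∧ b < Fin.rev b then h else 0) * u (Fin.rev l, l) =
      if b < Fin.rev b then h * u (Fin.rev b, b) else 0 := by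
    split_ifs with hb <;> simp [hb]
  rw [← p1, ← p2, ← p3, ← p4]
  split_ifs with hb
  · simp only [Finset.mul_sum, ← Finset.sum_sub_distrib, ← Finset.sum_add_distrib]
    exact Finset.sum_congr rfl fun l _ => by ring
  · simp only [add_zero, Finset.mul_sum, ← Finset.sum_sub_distrib, ← Finset.sum_add_distrib]
    exact Finset.sum_congr rfl fun l _ => by ring

theorem RhatInv_mul_Rhat (hq : 0 < q) : RhatInv m q * Rhat m q = 1 :=
  mul_eq_one_comm.1 (Rhat_mul_RhatInv hq)

theorem Rhat_inv (hq : 0 < q) : (Rhat m q)⁻¹ = RhatInv m q :=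
  Matrix.inv_eq_right_inv (Rhat_mul_RhatInv hq)

theorem RhatInv_symm (hq : 0 < q) : (RhatInv m q).transpose = RhatInv m q := by
  rw [← Rhat_inv hq, Matrix.transpose_nonsing_inv, Rhat_symm hq]

/-- The skein relation. -/
theorem RhatInv_eq (hq : 0 < q) : RhatInv m q =
    Rhat m q - ((q : ℂ) - (q : ℂ)⁻¹) • (1 - traceProj m q) := by
  ext ⟨a, b⟩ ⟨i, j⟩
  simp only [Matrix.sub_apply, Matrix.smul_apply, smul_eq_mul, Rhat_apply hq, RhatInv_apply,
    traceProj, Matrix.of_apply, Matrix.one_apply, Prod.mk.injEq]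
  have hw := wt_mul_rev hq b
  have e : metric m q a b * metric m q i j = if a = Fin.rev b ∧ j = Fin.rev i then
      wt m q b * wt m q (Fin.rev i) else 0 := by
    rw [metric_apply', metric_apply]
    by_cases h1 : a = Fin.rev b <;> by_cases h2 : j = Fin.rev i <;> simp [h1, h2]
  rw [e]
  -- The trace projector lives on these entries only. Off `b = i` it completes the strict inequality
  -- `i < b` to the opposite one; at `b = i` it accounts for the difference of the flip coefficients
  -- `q` and `q⁻¹`, or cancels the identity when `b` is the middle index.
  by_cases h1 : a = Fin.rev b ∧ j = Fin.rev i
  · obtain ⟨rfl, rfl⟩ := h1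
    have hd := diagCoef_self_inv (m := m) (q := q) i
    have hd' : diagCoef m q i i = if i = Fin.rev i then 1 else (q : ℂ) := by
      unfold diagCoef; rw [if_pos rfl]
    rcases lt_trichotomy b i with h | h | h
    · have h' : Fin.rev i < Fin.rev b := Fin.rev_lt_rev.2 h
      simp only [h, h.ne, h.not_gt, h'.ne', and_false, true_and, if_true, if_false, ]
      by_cases h3 : Fin.rev b = i
      · have h4 : b = Fin.rev i := by rw [← h3, Fin.rev_rev]
        rcases lt_trichotomy i (Fin.rev i) with f | f | f
        · exact absurd (h4 ▸ h) f.not_gt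
        · exact absurd (h4.trans f.symm) h.ne
        · simp [h4, f, f.not_gt]; ring
      · simp [h3]
    · subst h
      rcases lt_trichotomy b (Fin.rev b) with f | f | f
      · simp [f.ne', f.not_gt, diagCoef_rev, hd', f.ne]; linear_combination (-((q : ℂ) - (q : ℂ)⁻¹)) * hw
      · simp [← f]
        have : wt m q b * wt m q b = 1 := by rw [← f] at hw; exact hw
        simp [this]; unfold diagCoef; simp [← f]
      · simp [f.ne, f.not_gt, diagCoef_rev, hd', f.ne']; linear_combination (-((q : ℂ) - (q : ℂ)⁻¹)) * hw
    · have h' : Fin.rev b < Fin.rev i := Fin.rev_lt_rev.2 h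
      simp only [h, h.ne', h.not_gt, h'.ne, and_false, true_and, if_true, if_false, ]
      by_cases h3 : Fin.rev b = i
      · have h4 : b = Fin.rev i := by rw [← h3, Fin.rev_rev]
        rcases lt_trichotomy i (Fin.rev i) with f | f | f
        · simp [h4, f, f.not_gt]; ring
        · exact absurd (h4.trans f.symm) h.ne'
        · exact absurd (h4 ▸ h) f.not_gt
      · simp [h3]
  · have z1 : ¬ (a = Fin.rev b ∧ j = Fin.rev i ∧ b < i) := fun k => h1 ⟨k.1, k.2.1⟩
    have z2 : ¬ (a = Fin.rev b ∧ j = Fin.rev i ∧ i < b) := fun k => h1 ⟨k.1, k.2.1⟩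
    simp only [h1, z1, z2, if_false]
    by_cases h3 : a = i ∧ b = j
    · obtain ⟨rfl, rfl⟩ := h3
      have h5 : ¬ b = Fin.rev a := fun k => h1 ⟨eq_rev_comm.1 k, k⟩
      have h6 : ¬ a = Fin.rev b := fun k => h1 ⟨k, eq_rev_comm.1 k⟩
      rcases lt_trichotomy a b with f | f | f
      · simp [f, f.not_gt, f.ne]
      · subst f; simp [diagCoef, h5]
      · simp [f, f.not_gt, f.ne']
    · have z3 : ¬ (a = i ∧ b = j ∧ j < i) := fun k => h3 ⟨k.1, k.2.1⟩
      have z4 : ¬ (a = i ∧ b = j ∧ i < j) := fun k => h3 ⟨k.1, k.2.1⟩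
      simp only [h3, z3, z4, if_false]
      by_cases h4 : a = j ∧ b = i
      · obtain ⟨rfl, rfl⟩ := h4
        have h5 : ¬ a = Fin.rev b := fun k => h1 ⟨k, k⟩
        have h6 : ¬ b = a := fun k => h3 ⟨k.symm, k⟩
        simp [diagCoef, h5, h6]
      · simp [h4]

end inverse
end QEuclid
end

noncomputable section

namespace QEuclid

open Finset

/-! ### Operators on triple tensor products -/

section triple

variable {m : ℕ} {q : ℝ} {M : Type*} [AddCommGroup M] [Module ℂ M]

/-- A matrix on pairs acting on the first two of three indices. -/
def leg1 (T : Matrix (Fin m × Fin m) (Fin m × Fin m) ℂ) :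
    Matrix (Fin m × Fin m × Fin m) (Fin m × Fin m × Fin m) ℂ :=
  Matrix.of fun x y => if x.2.2 = y.2.2 then T (x.1, x.2.1) (y.1, y.2.1) else 0

/-- A matrix on pairs acting on the last two of three indices. -/
def leg2 (T : Matrix (Fin m × Fin m) (Fin m × Fin m) ℂ) :
    Matrix (Fin m × Fin m × Fin m) (Fin m × Fin m × Fin m) ℂ :=
  Matrix.of fun x y => if x.1 = y.1 then T x.2 y.2 else 0

variable (m q) in
/-- Insertion of the metric in the first two places. -/
def cup12 : Matrix (Fin m × Fin m × Fin m) (Fin m) ℂ :=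
  Matrix.of fun x d => if x.2.2 = d then metric m q x.1 x.2.1 else 0

variable (m q) in
/-- Insertion of the metric in the last two places. -/
def cup23 : Matrix (Fin m × Fin m × Fin m) (Fin m) ℂ :=
  Matrix.of fun x d => if x.1 = d then metric m q x.2.1 x.2.2 else 0

theorem act_leg1 (T : Matrix (Fin m × Fin m) (Fin m × Fin m) ℂ)
    (u : Fin m × Fin m × Fin m → M) (a b c : Fin m) :
    act (leg1 T) u (a, b, c) = act T (fun p => u (p.1, p.2, c)) (a, b) := by
  simp [act, leg1, Fintype.sum_prod_type, ite_smul]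

theorem act_leg2 (T : Matrix (Fin m × Fin m) (Fin m × Fin m) ℂ)
    (u : Fin m × Fin m × Fin m → M) (a b c : Fin m) :
    act (leg2 T) u (a, b, c) = act T (fun p => u (a, p.1, p.2)) (b, c) := by
  have : ∀ x : Fin m × Fin m × Fin m, leg2 T (a, b, c) x • u x =
      if a = x.1 then T (b, c) x.2 • u x else 0 := by
    intro x; simp [leg2, ite_smul]
  simp only [act, this, Fintype.sum_prod_type]
  rw [Finset.sum_eq_single a]
  · simp
  · intro x _ hx; simp [hx.symm]
  · simp

theorem act_cup12 (v : Fin m → M) (a b c : Fin m) :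
    act (cup12 m q) v (a, b, c) = metric m q a b • v c := by
  simp [act, cup12, ite_smul]

theorem act_cup23 (v : Fin m → M) (a b c : Fin m) :
    act (cup23 m q) v (a, b, c) = metric m q b c • v a := by
  simp [act, cup23, ite_smul]

theorem act_cap12 (u : Fin m × Fin m × Fin m → M) (d : Fin m) :
    act (cup12 m q).transpose u d = ∑ a, ∑ b, metric m q a b • u (a, b, d) := by
  simp [act, cup12, ite_smul, Fintype.sum_prod_type]

theorem act_cap23 (u : Fin m × Fin m × Fin m → M) (d : Fin m) :
    act (cup23 m q).transpose u d = ∑ b, ∑ c, metric m q b c • u (d, b, c) := by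
  have : ∀ x : Fin m × Fin m × Fin m, (cup23 m q).transpose d x • u x =
      if x.1 = d then metric m q x.2.1 x.2.2 • u x else 0 := by
    intro x; simp [cup23, ite_smul]
  simp only [act, this, Fintype.sum_prod_type]
  rw [Finset.sum_eq_single d]
  · simp
  · intro x _ hx; simp [hx]
  · simp

theorem leg1_mul (S T : Matrix (Fin m × Fin m) (Fin m × Fin m) ℂ) :
    leg1 (S * T) = leg1 S * leg1 T := by
  refine matrix_ext_act fun u => ?_
  funext ⟨a, b, c⟩
  simp only [act_mul, act_leg1]

theorem leg2_mul (S T : Matrix (Fin m × Fin m) (Fin m × Fin m) ℂ) :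
    leg2 (S * T) = leg2 S * leg2 T := by
  refine matrix_ext_act fun u => ?_
  funext ⟨a, b, c⟩
  simp only [act_mul, act_leg2]

theorem leg1_one : leg1 (1 : Matrix (Fin m × Fin m) (Fin m × Fin m) ℂ) = 1 := by
  refine matrix_ext_act fun u => ?_
  funext ⟨a, b, c⟩
  simp only [act_one, act_leg1]

theorem leg2_one : leg2 (1 : Matrix (Fin m × Fin m) (Fin m × Fin m) ℂ) = 1 := by
  refine matrix_ext_act fun u => ?_
  funext ⟨a, b, c⟩
  simp only [act_one, act_leg2]

theorem leg1_add (S T : Matrix (Fin m × Fin m) (Fin m × Fin m) ℂ) :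
    leg1 (S + T) = leg1 S + leg1 T := by
  ext x y; simp only [leg1, Matrix.of_apply, Matrix.add_apply]; split_ifs <;> simp

theorem leg2_add (S T : Matrix (Fin m × Fin m) (Fin m × Fin m) ℂ) :
    leg2 (S + T) = leg2 S + leg2 T := by
  ext x y; simp only [leg2, Matrix.of_apply, Matrix.add_apply]; split_ifs <;> simp

theorem leg1_smul (c : ℂ) (T : Matrix (Fin m × Fin m) (Fin m × Fin m) ℂ) :
    leg1 (c • T) = c • leg1 T := by
  ext x y; simp [leg1]

theorem leg2_smul (c : ℂ) (T : Matrix (Fin m × Fin m) (Fin m × Fin m) ℂ) :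
    leg2 (c • T) = c • leg2 T := by
  ext x y; simp [leg2]

theorem leg1_sub (S T : Matrix (Fin m × Fin m) (Fin m × Fin m) ℂ) :
    leg1 (S - T) = leg1 S - leg1 T := by
  ext x y; simp only [leg1, Matrix.of_apply, Matrix.sub_apply]; split_ifs <;> simp

theorem leg2_sub (S T : Matrix (Fin m × Fin m) (Fin m × Fin m) ℂ) :
    leg2 (S - T) = leg2 S - leg2 T := by
  ext x y; simp only [leg2, Matrix.of_apply, Matrix.sub_apply]; split_ifs <;> simp

theorem leg1_transpose (T : Matrix (Fin m × Fin m) (Fin m × Fin m) ℂ) :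
    (leg1 T).transpose = leg1 T.transpose := by
  ext x y; simp [leg1, eq_comm]

theorem leg2_transpose (T : Matrix (Fin m × Fin m) (Fin m × Fin m) ℂ) :
    (leg2 T).transpose = leg2 T.transpose := by
  ext x y; simp [leg2, eq_comm]

theorem leg1_traceProj : leg1 (traceProj m q) = cup12 m q * (cup12 m q).transpose := by
  refine matrix_ext_act fun u => ?_
  funext ⟨a, b, c⟩
  simp only [act_mul, act_leg1, act_cup12, act_cap12]
  simp [act, traceProj, Fintype.sum_prod_type, Finset.mul_sum, mul_assoc]

theorem leg2_traceProj : leg2 (traceProj m q) = cup23 m q * (cup23 m q).transpose := by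
  refine matrix_ext_act fun u => ?_
  funext ⟨a, b, c⟩
  simp only [act_mul, act_leg2, act_cup23, act_cap23]
  simp [act, traceProj, Fintype.sum_prod_type, Finset.mul_sum, mul_assoc]

theorem sum_metric_smul (b : Fin m) (v : Fin m → M) :
    ∑ a, metric m q b a • v a = wt m q (Fin.rev b) • v (Fin.rev b) := by
  simp [metric_apply, ite_smul]

/-- The snake identity, which holds because the metric is its own inverse. -/
theorem cap12_mul_cup23 (hq : 0 < q) : (cup12 m q).transpose * cup23 m q = 1 := by
  refine matrix_ext_act fun u => ?_
  funext d
  simp only [act_mul, act_one, act_cup23, act_cap12]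
  have : ∀ x : Fin m, ∑ b, metric m q x b • metric m q b d • u x = if x = d then u x else 0 := by
    intro x
    rw [sum_metric_smul x (fun b => metric m q b d • u x), metric_apply, Fin.rev_rev, smul_smul]
    by_cases h : d = x
    · subst h; rw [if_pos rfl, if_pos rfl, mul_comm, wt_mul_rev hq, one_smul]
    · rw [if_neg h, if_neg (Ne.symm h)]; simp
  rw [Finset.sum_congr rfl fun x _ => this x]
  simp

theorem cap23_mul_cup12 (hq : 0 < q) : (cup23 m q).transpose * cup12 m q = 1 := by
  have := congrArg Matrix.transpose (cap12_mul_cup23 (m := m) hq)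
  simpa using this

/-- The crossing symmetry in graphical form: a crossing on one end of a cup can be moved to the
other end, where it becomes the inverse crossing. -/
theorem RhatInv_zigzag (hq : 0 < q) :
    leg1 (RhatInv m q) * cup23 m q = leg2 (Rhat m q) * cup12 m q := by
  refine matrix_ext_act fun u => ?_
  funext ⟨i, j, k⟩
  simp only [act_mul, act_leg1, act_leg2, act_cup23, act_cup12]
  simp only [act, Fintype.sum_prod_type, smul_smul]
  rw [Finset.sum_comm (s := Finset.univ (α := Fin m)) (t := Finset.univ (α := Fin m))
    (f := fun x y => (Rhat m q (j, k) (x, y) * metric m q i x) • u y)]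
  refine Finset.sum_congr rfl fun a _ => ?_
  simp only [← Finset.sum_smul]
  congr 1
  have h := RhatInv_crossing hq i j a (Fin.rev k)
  rw [Fin.rev_rev] at h
  simp only [metric_apply', mul_ite, mul_zero, Finset.sum_ite_eq', Finset.mem_univ, if_true]
  simp only [eq_rev_comm (i := i), Finset.sum_ite_eq', Finset.mem_univ, if_true]
  rw [mul_comm, h, mul_comm]

theorem Rhat_zigzag (hq : 0 < q) :
    leg1 (Rhat m q) * cup23 m q = leg2 (RhatInv m q) * cup12 m q := by
  refine matrix_ext_act fun u => ?_
  funext ⟨i, j, k⟩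
  simp only [act_mul, act_leg1, act_leg2, act_cup23, act_cup12]
  simp only [act, Fintype.sum_prod_type, smul_smul]
  rw [Finset.sum_comm (s := Finset.univ (α := Fin m)) (t := Finset.univ (α := Fin m))
    (f := fun x y => (RhatInv m q (j, k) (x, y) * metric m q i x) • u y)]
  refine Finset.sum_congr rfl fun a _ => ?_
  simp only [← Finset.sum_smul]
  congr 1
  have h := Rhat_crossing hq i j a (Fin.rev k)
  rw [Fin.rev_rev] at h
  simp only [metric_apply', mul_ite, mul_zero, Finset.sum_ite_eq', Finset.mem_univ, if_true]
  simp only [eq_rev_comm (i := i), Finset.sum_ite_eq', Finset.mem_univ, if_true]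
  rw [mul_comm, h, mul_comm]

/-- A pair `T`, `T'` of inverse symmetric matrices compatible with the metric, such as the braid
matrix and its inverse; `c` is the eigenvalue of `T` on the metric. -/
structure Braiding (q : ℝ) (T T' : Matrix (Fin m × Fin m) (Fin m × Fin m) ℂ) (c : ℂ) : Prop where
  mul_inv : T * T' = 1
  inv_mul : T' * T = 1
  symm : T.transpose = T
  symm' : T'.transpose = T'
  zigzag : leg1 T * cup23 m q = leg2 T' * cup12 m q
  zigzag' : leg1 T' * cup23 m q = leg2 T * cup12 m q
  metric_eigen : leg1 T * cup12 m q = c • cup12 m q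
  metric_eigen' : leg1 T' * cup12 m q = c⁻¹ • cup12 m q

theorem leg1_Rhat_cup12 (hq : 0 < q) :
    leg1 (Rhat m q) * cup12 m q = (q : ℂ) ^ (1 - (m : ℤ)) • cup12 m q := by
  refine matrix_ext_act fun u => ?_
  funext ⟨i, j, k⟩
  simp only [act_mul, act_leg1, act_cup12, act_smul, Pi.smul_apply]
  have := act_Rhat_metric hq i j
  simp only [act, smul_eq_mul] at this ⊢
  simp only [← mul_assoc, ← Finset.sum_mul, this]

theorem braiding_Rhat (hq : 0 < q) :
    Braiding q (Rhat m q) (RhatInv m q) ((q : ℂ) ^ (1 - (m : ℤ))) where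
  mul_inv := Rhat_mul_RhatInv hq
  inv_mul := RhatInv_mul_Rhat hq
  symm := Rhat_symm hq
  symm' := RhatInv_symm hq
  zigzag := Rhat_zigzag hq
  zigzag' := RhatInv_zigzag hq
  metric_eigen := leg1_Rhat_cup12 hq
  metric_eigen' := by
    have h := congrArg (leg1 (RhatInv m q) * ·) (leg1_Rhat_cup12 (m := m) hq)
    simp only [← Matrix.mul_assoc, ← leg1_mul, RhatInv_mul_Rhat hq, leg1_one, Matrix.one_mul,
      Matrix.mul_smul] at h
    have hq0 : (q : ℂ) ^ (1 - (m : ℤ)) ≠ 0 := zpow_ne_zero _ (by exact_mod_cast hq.ne')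
    nth_rewrite 2 [h]
    rw [smul_smul, inv_mul_cancel₀ hq0, one_smul]

/-! ### Cups, caps and crossings -/

section Braiding

variable {T T' : Matrix (Fin m × Fin m) (Fin m × Fin m) ℂ} {c : ℂ} (h : Braiding q T T' c)

include h

theorem Braiding.inverse : Braiding q T' T c⁻¹ where
  mul_inv := h.inv_mul
  inv_mul := h.mul_inv
  symm := h.symm'
  symm' := h.symm
  zigzag := h.zigzag'
  zigzag' := h.zigzag
  metric_eigen := h.metric_eigen'
  metric_eigen' := by rw [inv_inv]; exact h.metric_eigen

theorem Braiding.cap_zigzag : (cup23 m q).transpose * leg1 T = (cup12 m q).transpose * leg2 T' := by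
  have := congrArg Matrix.transpose h.zigzag
  simpa [Matrix.transpose_mul, leg1_transpose, leg2_transpose, h.symm, h.symm'] using this

theorem Braiding.cap_eigen : (cup12 m q).transpose * leg1 T = c • (cup12 m q).transpose := by
  have := congrArg Matrix.transpose h.metric_eigen
  simpa [Matrix.transpose_mul, leg1_transpose, h.symm] using this

/-- A cup is pulled through a strand at the cost of two crossings. This and its variants move the
metric past a coordinate or a derivative. -/
theorem Braiding.leg1_leg2_cup12 : leg1 T * (leg2 T * cup12 m q) = cup23 m q := by
  rw [← h.zigzag', ← Matrix.mul_assoc, ← leg1_mul, h.mul_inv, leg1_one, Matrix.one_mul]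

theorem Braiding.leg2_leg1_cup23 : leg2 T * (leg1 T * cup23 m q) = cup12 m q := by
  rw [h.zigzag, ← Matrix.mul_assoc, ← leg2_mul, h.mul_inv, leg2_one, Matrix.one_mul]

theorem Braiding.cap23_leg1_leg2 :
    (cup23 m q).transpose * leg1 T * leg2 T = (cup12 m q).transpose := by
  rw [h.cap_zigzag, Matrix.mul_assoc, ← leg2_mul, h.inv_mul, leg2_one, Matrix.mul_one]

theorem Braiding.cap12_leg2_leg1 :
    (cup12 m q).transpose * leg2 T * leg1 T = (cup23 m q).transpose := by
  rw [← h.inverse.cap_zigzag, Matrix.mul_assoc, ← leg1_mul, h.inv_mul, leg1_one, Matrix.mul_one]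

/-- The partial trace of `T` over the second place. -/
theorem Braiding.cap23_leg1_cup23 (hq : 0 < q) :
    (cup23 m q).transpose * (leg1 T * cup23 m q) = c⁻¹ • 1 := by
  rw [← Matrix.mul_assoc, h.cap_zigzag, Matrix.mul_assoc]
  -- The eigenvector property is carried from the first two places to the last two by a cyclic
  -- relabelling.
  have e : leg2 T' * cup23 m q = c⁻¹ • cup23 m q := by
    refine matrix_ext_act fun u => ?_
    funext ⟨i, j, k⟩
    have := congrFun (congrArg (fun S => act S u) h.metric_eigen') (j, k, i)
    simpa only [act_mul, act_leg1, act_leg2, act_cup12, act_cup23, act_smul, Pi.smul_apply] using this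
  rw [e, Matrix.mul_smul, cap12_mul_cup23 hq]

/-- The partial trace of `T` over the first place. -/
theorem Braiding.cap12_leg2_cup12 (hq : 0 < q) :
    (cup12 m q).transpose * (leg2 T * cup12 m q) = c⁻¹ • 1 := by
  rw [← h.zigzag', ← Matrix.mul_assoc, h.inverse.cap_eigen, Matrix.smul_mul, cap12_mul_cup23 hq]

end Braiding

theorem Rhat_mul_traceProj (hq : 0 < q) :
    Rhat m q * traceProj m q = (q : ℂ) ^ (1 - (m : ℤ)) • traceProj m q := by
  ext ⟨a, b⟩ ⟨i, j⟩
  have h := act_Rhat_metric hq a b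
  simp only [act, smul_eq_mul] at h
  simp only [Matrix.mul_apply, traceProj, Matrix.of_apply, Matrix.smul_apply, ← mul_assoc,
    ← Finset.sum_mul, h, smul_eq_mul]

/-- The quadratic relation of the braid matrix up to the trace projector. -/
theorem Rhat_sq (hq : 0 < q) : Rhat m q * Rhat m q = 1 + ((q : ℂ) - (q : ℂ)⁻¹) • Rhat m q -
    (((q : ℂ) - (q : ℂ)⁻¹) * (q : ℂ) ^ (1 - (m : ℤ))) • traceProj m q := by
  have h := Rhat_mul_RhatInv (m := m) hq
  rw [RhatInv_eq hq, mul_sub, mul_smul_comm, mul_sub, mul_one, Rhat_mul_traceProj hq] at h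
  rw [← h, mul_smul, smul_sub]
  abel

/-! ### The braid relation -/

variable (m q) in
/-- The braid matrix in the first two places as a linear map. -/
def braid1 : (Fin m × Fin m × Fin m → ℂ) →ₗ[ℂ] (Fin m × Fin m × Fin m → ℂ) where
  toFun := act (leg1 (Rhat m q))
  map_add' := act_vec_add _
  map_smul' c u := act_vec_smul c _ u

variable (m q) in
/-- The braid matrix in the last two places as a linear map. -/
def braid2 : (Fin m × Fin m × Fin m → ℂ) →ₗ[ℂ] (Fin m × Fin m × Fin m → ℂ) where
  toFun := act (leg2 (Rhat m q))
  map_add' := act_vec_add _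
  map_smul' c u := act_vec_smul c _ u

variable (m q) in
/-- The vectors on which the braid relation holds. -/
def braidKer : Submodule ℂ (Fin m × Fin m × Fin m → ℂ) :=
  LinearMap.ker (braid1 m q ∘ₗ braid2 m q ∘ₗ braid1 m q - braid2 m q ∘ₗ braid1 m q ∘ₗ braid2 m q)

theorem mem_braidKer {v : Fin m × Fin m × Fin m → ℂ} : v ∈ braidKer m q ↔
    braid1 m q (braid2 m q (braid1 m q v)) = braid2 m q (braid1 m q (braid2 m q v)) := by
  simp [braidKer, sub_eq_zero]

theorem braid1_braid1 (hq : 0 < q) (v : Fin m × Fin m × Fin m → ℂ) :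
    braid1 m q (braid1 m q v) = v + ((q : ℂ) - (q : ℂ)⁻¹) • braid1 m q v -
      (((q : ℂ) - (q : ℂ)⁻¹) * (q : ℂ) ^ (1 - (m : ℤ))) • act (leg1 (traceProj m q)) v := by
  simp only [braid1, LinearMap.coe_mk, AddHom.coe_mk, ← act_mul, ← leg1_mul, Rhat_sq hq, leg1_sub,
    leg1_add, leg1_smul, leg1_one, act_sub, act_add, act_smul, act_one]

theorem braid2_braid2 (hq : 0 < q) (v : Fin m × Fin m × Fin m → ℂ) :
    braid2 m q (braid2 m q v) = v + ((q : ℂ) - (q : ℂ)⁻¹) • braid2 m q v -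
      (((q : ℂ) - (q : ℂ)⁻¹) * (q : ℂ) ^ (1 - (m : ℤ))) • act (leg2 (traceProj m q)) v := by
  simp only [braid2, LinearMap.coe_mk, AddHom.coe_mk, ← act_mul, ← leg2_mul, Rhat_sq hq, leg2_sub,
    leg2_add, leg2_smul, leg2_one, act_sub, act_add, act_smul, act_one]

/-- The trace projector is a cup after a cap, and both can be pulled through the strand. This is the
part of the braid relation available without any computation on basis vectors. -/
theorem braid1_braid2_trace (hq : 0 < q) (v : Fin m × Fin m × Fin m → ℂ) :
    braid1 m q (braid2 m q (act (leg1 (traceProj m q)) v)) =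
      act (leg2 (traceProj m q)) (braid1 m q (braid2 m q v)) := by
  have h := braiding_Rhat (m := m) hq
  simp only [braid1, braid2, LinearMap.coe_mk, AddHom.coe_mk, ← act_mul]
  congr 1
  rw [leg1_traceProj, leg2_traceProj, ← Matrix.mul_assoc (leg2 _), ← Matrix.mul_assoc (leg1 _),
    h.leg1_leg2_cup12, Matrix.mul_assoc (cup23 m q), ← Matrix.mul_assoc (cup23 m q).transpose,
    h.cap23_leg1_leg2]

theorem braid2_braid1_trace (hq : 0 < q) (v : Fin m × Fin m × Fin m → ℂ) :
    braid2 m q (braid1 m q (act (leg2 (traceProj m q)) v)) =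
      act (leg1 (traceProj m q)) (braid2 m q (braid1 m q v)) := by
  have h := braiding_Rhat (m := m) hq
  simp only [braid1, braid2, LinearMap.coe_mk, AddHom.coe_mk, ← act_mul]
  congr 1
  rw [leg1_traceProj, leg2_traceProj, ← Matrix.mul_assoc (leg1 _), ← Matrix.mul_assoc (leg2 _),
    h.leg2_leg1_cup23, Matrix.mul_assoc (cup12 m q), ← Matrix.mul_assoc (cup12 m q).transpose,
    h.cap12_leg2_leg1]

/-- One more application of the braiding produces a square on each side. The quadratic relation
rewrites both squares; the linear terms agree by hypothesis and the trace terms by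
`braid1_braid2_trace`. Hence the braid relation need only be checked on vectors that generate
everything under the two braidings. -/
theorem braid1_mem_braidKer (hq : 0 < q) {v : Fin m × Fin m × Fin m → ℂ} (hv : v ∈ braidKer m q) :
    braid1 m q v ∈ braidKer m q := by
  rw [mem_braidKer] at hv ⊢
  rw [hv, braid1_braid1 hq, braid2_braid2 hq]
  simp only [map_add, map_sub, map_smul, braid1_braid2_trace hq, hv]

theorem braid2_mem_braidKer (hq : 0 < q) {v : Fin m × Fin m × Fin m → ℂ} (hv : v ∈ braidKer m q) :
    braid2 m q v ∈ braidKer m q := by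
  rw [mem_braidKer] at hv ⊢
  rw [← hv, braid1_braid1 hq, braid2_braid2 hq]
  simp only [map_add, map_sub, map_smul, braid2_braid1_trace hq, hv]

/-- The basis vector `e_a ⊗ e_b ⊗ e_c`. -/
def tri (a b c : Fin m) : Fin m × Fin m × Fin m → ℂ := Pi.single (a, b, c) 1

variable (m q) in
/-- The coefficient `(q - q⁻¹) q ^ (ρ_b - ρ_i)`. -/
def trCoef (b i : Fin m) : ℂ := ((q : ℂ) - (q : ℂ)⁻¹) * (wt m q b * wt m q (Fin.rev i))

theorem braid1_tri (hq : 0 < q) (i j k : Fin m) : braid1 m q (tri i j k) =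
    diagCoef m q i j • tri j i k + (if i < j then ((q : ℂ) - (q : ℂ)⁻¹) • tri i j k else 0)
    - (if j = Fin.rev i then ∑ b, (if i < b then trCoef m q b i • tri (Fin.rev b) b k else 0)
      else 0) := by
  funext ⟨a, b, c⟩
  simp only [braid1, LinearMap.coe_mk, AddHom.coe_mk, act_leg1]
  rw [act, Finset.sum_eq_single (i, j)]
  · rw [Rhat_apply hq]
    have h1 : (if j = Fin.rev i then
        ∑ b, (if i < b then trCoef m q b i • tri (Fin.rev b) b k else 0) else 0) (a, b, c) =
        if k = c then (if a = Fin.rev b ∧ j = Fin.rev i ∧ i < b then trCoef m q b i else 0)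
          else 0 := by
      split_ifs with hj hc hk
      · rw [Finset.sum_apply, Finset.sum_eq_single b]
        · simp [hk.2.2, tri, hk.1, hc]
        · intro x _ hx
          split_ifs
          · simp [tri, Pi.single_apply, hx.symm]
          · rfl
        · simp
      · rw [Finset.sum_apply]
        refine Finset.sum_eq_zero fun x _ => ?_
        split_ifs with hx
        · simp only [Pi.smul_apply, tri, Pi.single_apply, Prod.mk.injEq, smul_eq_mul, mul_ite,
            mul_one, mul_zero]
          refine if_neg ?_
          rintro ⟨rfl, rfl, rfl⟩
          exact hk ⟨rfl, hj, hx⟩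
        · rfl
      · rw [Finset.sum_apply]
        refine Finset.sum_eq_zero fun x _ => ?_
        split_ifs with hx
        · simp [tri, Pi.single_apply, Ne.symm hc]
        · rfl
      · exact absurd ‹_ ∧ _ ∧ _›.2.1 hj
      · rfl
      · rfl
    have h2 : (if i < j then ((q : ℂ) - (q : ℂ)⁻¹) • tri i j k else 0) (a, b, c) =
        if k = c then (if a = i ∧ b = j ∧ i < j then (q : ℂ) - (q : ℂ)⁻¹ else 0) else 0 := by
      by_cases hij : i < j <;> by_cases hc : k = c <;>
        simp [hij, hc, tri, Pi.single_apply, Ne.symm, eq_comm]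
    have h3 : (diagCoef m q i j • tri j i k) (a, b, c) =
        if k = c then (if a = j ∧ b = i then diagCoef m q i j else 0) else 0 := by
      by_cases hc : k = c
      · simp [hc, tri, Pi.single_apply]
      · simp [hc, tri, Pi.single_apply, Ne.symm hc]
    rw [Pi.sub_apply, Pi.add_apply, h1, h2, h3]
    by_cases hc : k = c
    · simp [hc, tri, trCoef]
    · simp [hc, tri, Pi.single_apply, Ne.symm hc]
  · rintro ⟨x, y⟩ _ hxy
    have : ¬ ((x, y, c) = (i, j, k)) := by
      rintro h
      simp only [Prod.mk.injEq] at h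
      exact hxy (by rw [h.1, h.2.1])
    simp [tri, Pi.single_apply, this]
  · simp

theorem braid2_tri (hq : 0 < q) (k i j : Fin m) : braid2 m q (tri k i j) =
    diagCoef m q i j • tri k j i + (if i < j then ((q : ℂ) - (q : ℂ)⁻¹) • tri k i j else 0)
    - (if j = Fin.rev i then ∑ b, (if i < b then trCoef m q b i • tri k (Fin.rev b) b else 0)
      else 0) := by
  -- A cyclic relabelling of the three places reduces the claim to `braid1_tri`.
  have e : ∀ (x y z a b c : Fin m), tri x y z (a, b, c) = tri y z x (b, c, a) := by
    intro x y z a b c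
    simp only [tri, Pi.single_apply, Prod.mk.injEq]
    congr 1
    exact propext ⟨fun h => ⟨h.2.1, h.2.2, h.1⟩, fun h => ⟨h.2.2, h.1, h.2.1⟩⟩
  funext ⟨a, b, c⟩
  have h := congrFun (braid1_tri hq i j k) (b, c, a)
  have h1 : braid2 m q (tri k i j) (a, b, c) = braid1 m q (tri i j k) (b, c, a) := by
    simp only [braid1, braid2, LinearMap.coe_mk, AddHom.coe_mk, act_leg1, act_leg2]
    congr 1
    funext p
    exact e _ _ _ _ _ _
  rw [h1, h]
  simp only [Pi.sub_apply, Pi.add_apply, Pi.smul_apply, ite_apply, Finset.sum_apply, Pi.zero_apply,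
    ← e]

end triple
end QEuclid
end

noncomputable section

namespace QEuclid

open Finset

/-! ### The braid relation on basis vectors -/

section braid

variable {m : ℕ} {q : ℝ}

variable (m q) in
/-- `∑_{b > i} (q - q⁻¹) q ^ (ρ_b - ρ_i) e_{b'} ⊗ e_k ⊗ e_b`. -/
def triOuter (i k : Fin m) : Fin m × Fin m × Fin m → ℂ :=
  ∑ b, if i < b then trCoef m q b i • tri (Fin.rev b) k b else 0

variable (m q) in
/-- `∑_{b > i} (q - q⁻¹) q ^ (ρ_b - ρ_i) e_{b'} ⊗ e_b ⊗ e_k`. -/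
def triLeft (i k : Fin m) : Fin m × Fin m × Fin m → ℂ :=
  ∑ b, if i < b then trCoef m q b i • tri (Fin.rev b) b k else 0

variable (m q) in
/-- `∑_{b > i} (q - q⁻¹) q ^ (ρ_b - ρ_i) e_k ⊗ e_{b'} ⊗ e_b`. -/
def triRight (i k : Fin m) : Fin m × Fin m × Fin m → ℂ :=
  ∑ b, if i < b then trCoef m q b i • tri k (Fin.rev b) b else 0

/-- On descending pairs the ordered diagonal term is absent, so descending words are the convenient
test vectors. -/
theorem braid1_tri_of_ge (hq : 0 < q) {i j : Fin m} (h : j ≤ i) (k : Fin m) :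
    braid1 m q (tri i j k) = diagCoef m q i j • tri j i k -
      (if j = Fin.rev i then triLeft m q i k else 0) := by
  rw [braid1_tri hq, if_neg h.not_gt, add_zero]; rfl

theorem braid2_tri_of_ge (hq : 0 < q) {i j : Fin m} (h : j ≤ i) (k : Fin m) :
    braid2 m q (tri k i j) = diagCoef m q i j • tri k j i -
      (if j = Fin.rev i then triRight m q i k else 0) := by
  rw [braid2_tri hq, if_neg h.not_gt, add_zero]; rfl

theorem diagCoef_of_ne {i j : Fin m} (h1 : i ≠ j) (h2 : j ≠ Fin.rev i) : diagCoef m q i j = 1 := by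
  unfold diagCoef; rw [if_neg h1, if_neg h2]

theorem braid1_tri_of_gt (hq : 0 < q) {i j : Fin m} (h : j < i) (h2 : j ≠ Fin.rev i) (k : Fin m) :
    braid1 m q (tri i j k) = tri j i k := by
  rw [braid1_tri_of_ge hq h.le, if_neg h2, diagCoef_of_ne h.ne' h2, one_smul, sub_zero]

theorem braid2_tri_of_gt (hq : 0 < q) {i j : Fin m} (h : j < i) (h2 : j ≠ Fin.rev i) (k : Fin m) :
    braid2 m q (tri k i j) = tri k j i := by
  rw [braid2_tri_of_ge hq h.le, if_neg h2, diagCoef_of_ne h.ne' h2, one_smul, sub_zero]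

/-- The intermediate weights `q ^ ρ_b` and `q ^ (-ρ_b)` cancel, so an iterated trace term is again a
trace term. -/
theorem trCoef_mul (hq : 0 < q) (a b c : Fin m) :
    trCoef m q b a * trCoef m q c b = ((q : ℂ) - (q : ℂ)⁻¹) * trCoef m q c a := by
  unfold trCoef
  linear_combination ((q : ℂ) - (q : ℂ)⁻¹) ^ 2 * wt m q (Fin.rev a) * wt m q c * wt_mul_rev hq b

theorem rev_lt_of {i b : Fin m} (h : i < b) : Fin.rev b < Fin.rev i := Fin.rev_lt_rev.2 h

theorem braid1_triRight (hq : 0 < q) {i j : Fin m} (h1 : Fin.rev i ≤ j) (h2 : j ≤ i) :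
    braid1 m q (triRight m q i j) = triOuter m q i j := by
  simp only [triRight, triOuter, map_sum]
  refine Finset.sum_congr rfl fun b _ => ?_
  split_ifs with hb
  · rw [map_smul, braid1_tri_of_gt hq ((rev_lt_of hb).trans_le h1)]
    rw [Ne, Fin.rev_inj]
    exact (h2.trans_lt hb).ne'
  · simp

theorem braid2_triLeft (hq : 0 < q) {i j : Fin m} (h1 : Fin.rev i ≤ j) (h2 : j ≤ i) :
    braid2 m q (triLeft m q i j) = triOuter m q i j := by
  simp only [triLeft, triOuter, map_sum]
  refine Finset.sum_congr rfl fun b _ => ?_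
  split_ifs with hb
  · rw [map_smul, braid2_tri_of_gt hq (h2.trans_lt hb)]
    exact ((rev_lt_of hb).trans_le h1).ne'
  · simp

theorem triOuter_comp (hq : 0 < q) {i j : Fin m} (k : Fin m) :
    trCoef m q j i • triOuter m q j k =
      ((q : ℂ) - (q : ℂ)⁻¹) • ∑ b, if j < b then trCoef m q b i • tri (Fin.rev b) k b else 0 := by
  simp only [triOuter, Finset.smul_sum]
  refine Finset.sum_congr rfl fun b _ => ?_
  split_ifs
  · rw [smul_smul, smul_smul, trCoef_mul hq]
  · simp

/-- The summand `(b', b, k)` is carried to `(k, b', b)` with two corrections: an ordered diagonal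
term for `b > k'` and a second trace at `b = k'`. They cancel by `triOuter_comp` when `i < k'`; when
`k = i'` only the first one is present. -/
theorem braid1_braid2_triLeft (hq : 0 < q) {i k : Fin m} (h1 : Fin.rev i ≤ i) (h2 : k ≤ Fin.rev i) :
    braid1 m q (braid2 m q (triLeft m q i k)) = triRight m q i k +
      if k = Fin.rev i then ((q : ℂ) - (q : ℂ)⁻¹) • triOuter m q i k else 0 := by
  have hki : k ≤ i := h2.trans h1
  have hik : i ≤ Fin.rev k := by rw [← Fin.rev_le_rev, Fin.rev_rev]; exact h2
  have key : ∀ b : Fin m, braid1 m q (braid2 m q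
      (if i < b then trCoef m q b i • tri (Fin.rev b) b k else 0)) =
      (if i < b then trCoef m q b i • tri k (Fin.rev b) b else 0)
      + ((q : ℂ) - (q : ℂ)⁻¹) • (if Fin.rev k < b then trCoef m q b i • tri (Fin.rev b) k b else 0)
      - (if b = Fin.rev k then (if i < Fin.rev k then trCoef m q (Fin.rev k) i •
        triOuter m q (Fin.rev k) k else 0) else 0) := by
    intro b
    by_cases hb : i < b
    swap
    · have h3 : ¬ Fin.rev k < b := fun h => hb (hik.trans_lt h)
      have h4 : (if b = Fin.rev k then (if i < Fin.rev k then trCoef m q (Fin.rev k) i •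
        triOuter m q (Fin.rev k) k else 0) else 0) = 0 := by
        split_ifs with h5 h6
        · rw [← h5] at h6; exact absurd h6 hb
        · rfl
        · rfl
      simp only [if_neg hb, if_neg h3, h4, map_zero, smul_zero, add_zero, sub_zero]
    have hkb : k < b := hki.trans_lt hb
    rw [if_pos hb, map_smul, map_smul, braid2_tri_of_ge hq hkb.le, map_sub, map_smul, braid1_tri hq,
      Fin.rev_rev, if_neg hkb.ne, sub_zero, if_pos hb]
    have hd : diagCoef m q b k * diagCoef m q (Fin.rev b) k = 1 := by
      rw [diagCoef_rev_left, mul_inv_cancel₀ (diagCoef_ne_zero hq b k)]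
    have hlt : Fin.rev b < k ↔ Fin.rev k < b := by rw [← Fin.rev_lt_rev, Fin.rev_rev]
    simp only [hlt]
    rw [smul_add, smul_smul, hd, one_smul, smul_sub, smul_add]
    congr 1
    · congr 1
      split_ifs with h3
      · rw [diagCoef_of_ne hkb.ne', one_smul, smul_comm]
        rintro rfl
        simp at h3
      · simp
    · by_cases h3 : b = Fin.rev k
      · subst h3
        rw [if_pos (by simp), if_pos rfl, if_pos hb]
        congr 1
        simp only [triRight, triOuter, map_sum]
        refine Finset.sum_congr rfl fun c _ => ?_
        split_ifs with hc
        · rw [map_smul, Fin.rev_rev, braid1_tri_of_gt hq (by rw [← Fin.rev_lt_rev, Fin.rev_rev]; exact hc)]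
          rw [Ne, Fin.rev_inj]
          exact (hkb.trans hc).ne'
        · simp
      · rw [if_neg h3, if_neg fun h => h3 (eq_rev_comm.2 h), map_zero, smul_zero]
  rw [triLeft, map_sum, map_sum, Finset.sum_congr rfl fun b _ => key b, Finset.sum_sub_distrib,
    Finset.sum_add_distrib, ← Finset.smul_sum, Finset.sum_ite_eq', if_pos (Finset.mem_univ _),
    add_sub_assoc]
  congr 1
  by_cases hk : k = Fin.rev i
  · subst hk
    simp [triOuter]
  · have : i < Fin.rev k := lt_of_le_of_ne hik fun h => hk (eq_rev_comm.1 h)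
    rw [if_neg hk, if_pos this, triOuter_comp hq, sub_self]

/-- The mirror image of `braid1_braid2_triLeft`, with the second trace now occurring at `b = i`. -/
theorem braid2_braid1_triRight (hq : 0 < q) {i j : Fin m} (h1 : Fin.rev j ≤ j) (h2 : j ≤ i) :
    braid2 m q (braid1 m q (triRight m q j i)) = triLeft m q j i +
      if i = j then ((q : ℂ) - (q : ℂ)⁻¹) • triOuter m q j i else 0 := by
  have hij : Fin.rev i ≤ Fin.rev j := Fin.rev_le_rev.2 h2
  have key : ∀ b : Fin m, braid2 m q (braid1 m q
      (if j < b then trCoef m q b j • tri i (Fin.rev b) b else 0)) =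
      (if j < b then trCoef m q b j • tri (Fin.rev b) b i else 0)
      + ((q : ℂ) - (q : ℂ)⁻¹) • (if i < b then trCoef m q b j • tri (Fin.rev b) i b else 0)
      - (if b = i then (if j < i then trCoef m q i j • triOuter m q i i else 0) else 0) := by
    intro b
    by_cases hb : j < b
    swap
    · have h3 : ¬ i < b := fun h => hb (h2.trans_lt h)
      have h4 : (if b = i then (if j < i then trCoef m q i j • triOuter m q i i else 0) else 0)
          = 0 := by
        split_ifs with h5 h6
        · rw [← h5] at h6; exact absurd h6 hb
        · rfl
        · rfl
      simp only [if_neg hb, if_neg h3, h4, map_zero, smul_zero, add_zero, sub_zero]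
    have hbi : Fin.rev b < i := (rev_lt_of hb).trans_le (h1.trans h2)
    have hbi' : b ≠ Fin.rev i := ((hij.trans h1).trans_lt hb).ne'
    rw [if_pos hb, map_smul, map_smul, braid1_tri_of_ge hq hbi.le, map_sub, map_smul, braid2_tri hq,
      if_neg hbi', sub_zero, if_pos hb]
    have hd : diagCoef m q i (Fin.rev b) * diagCoef m q i b = 1 := by
      rw [diagCoef_rev, inv_mul_cancel₀ (diagCoef_ne_zero hq i b)]
    rw [smul_add, smul_smul, hd, one_smul, smul_sub, smul_add]
    congr 1
    · congr 1
      split_ifs with h3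
      · rw [diagCoef_of_ne hbi.ne', one_smul, smul_comm]
        rw [Ne, Fin.rev_inj]
        exact h3.ne'
      · simp
    · simp only [Fin.rev_inj]
      by_cases h3 : b = i
      · subst h3
        rw [if_pos rfl, if_pos rfl, if_pos hb]
        congr 1
        exact braid2_triLeft hq (((rev_lt_of hb).le.trans h1).trans hb.le) le_rfl
      · rw [if_neg h3, if_neg h3, map_zero, smul_zero]
  rw [triRight, map_sum, map_sum, Finset.sum_congr rfl fun b _ => key b, Finset.sum_sub_distrib,
    Finset.sum_add_distrib, ← Finset.smul_sum, Finset.sum_ite_eq', if_pos (Finset.mem_univ _),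
    add_sub_assoc]
  congr 1
  by_cases hk : i = j
  · subst hk
    simp [triOuter]
  · have : j < i := lt_of_le_of_ne h2 (Ne.symm hk)
    rw [if_neg hk, if_pos this, triOuter_comp hq, sub_self]

/-- On a descending word both sides are combinations of the reversed word and of the sums `triLeft`,
`triRight`, `triOuter`. The coefficients are compared according to which of `k = i'`, `j = i'`, `k =
j'` and `i = j` hold. -/
theorem tri_mem_braidKer_of_ge (hq : 0 < q) {i j k : Fin m} (hij : j ≤ i) (hjk : k ≤ j) :
    tri i j k ∈ braidKer m q := by
  have hik : k ≤ i := hjk.trans hij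
  have hq0 : (q : ℂ) ≠ 0 := by exact_mod_cast hq.ne'
  rw [mem_braidKer]
  have L : braid1 m q (braid2 m q (braid1 m q (tri i j k))) =
      diagCoef m q i j • (diagCoef m q i k • (diagCoef m q j k • tri k j i -
        (if k = Fin.rev j then triLeft m q j i else 0)) -
        (if k = Fin.rev i then triOuter m q i j else 0)) -
      (if j = Fin.rev i then triRight m q i k +
        (if k = Fin.rev i then ((q : ℂ) - (q : ℂ)⁻¹) • triOuter m q i k else 0) else 0) := by
    rw [braid1_tri_of_ge hq hij, map_sub, map_sub, map_smul, map_smul, braid2_tri_of_ge hq hik,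
      map_sub, map_smul, braid1_tri_of_ge hq hjk]
    congr 2
    · congr 1
      split_ifs with h
      · exact braid1_triRight hq (h ▸ hjk) hij
      · simp
    · split_ifs with h
      · rw [braid1_braid2_triLeft hq (h ▸ hij) (h ▸ hjk), if_pos]; assumption
      · rw [braid1_braid2_triLeft hq (h ▸ hij) (h ▸ hjk), if_neg]; assumption
      · simp
  have R : braid2 m q (braid1 m q (braid2 m q (tri i j k))) =
      diagCoef m q j k • (diagCoef m q i k • (diagCoef m q i j • tri k j i -
        (if j = Fin.rev i then triRight m q i k else 0)) -
        (if k = Fin.rev i then triOuter m q i j else 0)) -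
      (if k = Fin.rev j then triLeft m q j i +
        (if i = j then ((q : ℂ) - (q : ℂ)⁻¹) • triOuter m q j i else 0) else 0) := by
    rw [braid2_tri_of_ge hq hjk, map_sub, map_sub, map_smul, map_smul, braid1_tri_of_ge hq hik,
      map_sub, map_smul, braid2_tri_of_ge hq hij]
    congr 2
    · congr 1
      split_ifs with h
      · exact braid2_triLeft hq (h ▸ hjk) hij
      · simp
    · split_ifs with h h'
      · rw [braid2_braid1_triRight hq (h ▸ hjk) hij, if_pos h']
      · rw [braid2_braid1_triRight hq (h ▸ hjk) hij, if_neg h']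
      · simp
  rw [L, R]
  by_cases c1 : k = Fin.rev i
  · have hki : i = Fin.rev k := eq_rev_comm.1 c1
    by_cases c2 : j = Fin.rev i
    · by_cases c3 : i = j
      · subst c3
        rw [← c2] at c1
        subst c1
        have d : diagCoef m q k k = 1 := by
          unfold diagCoef; rw [if_pos rfl, if_pos c2]
        simp only [d, if_pos c2, if_true, one_smul]
        abel
      · have c4 : k = j := c1.trans c2.symm
        subst c4
        have c5 : ¬ k = Fin.rev k := fun h => c3 (by rw [hki, ← h])
        have d1 : diagCoef m q i k = (q : ℂ)⁻¹ := by
          unfold diagCoef; rw [if_neg c3, if_pos c2]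
        have d2 : diagCoef m q k k = q := by
          unfold diagCoef; rw [if_pos rfl, if_neg c5]
        simp only [c3, c5, if_true, if_false, d1, d2, ← c2]
        match_scalars <;> field_simp <;> ring
    · by_cases c3 : i = j
      · subst c3
        have d1 : diagCoef m q i k = (q : ℂ)⁻¹ := by
          unfold diagCoef; rw [if_neg fun h => c2 (h.trans c1), if_pos c1]
        have d2 : diagCoef m q i i = q := by
          unfold diagCoef; rw [if_pos rfl, if_neg c2]
        simp only [if_neg c2, if_pos c1, if_true, d1, d2]
        match_scalars <;> field_simp <;> ring
      · have c4 : k ≠ Fin.rev j := fun h => by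
          rw [c1, Fin.rev_inj] at h; exact c3 h
        have d1 : diagCoef m q i j = 1 := diagCoef_of_ne c3 c2
        have d2 : diagCoef m q j k = 1 := diagCoef_of_ne (fun h => c2 (h.trans c1)) c4
        simp only [if_neg c2, if_neg c4, if_pos c1, d1, d2]
  · by_cases c2 : j = Fin.rev i
    · have c3 : k ≠ Fin.rev j := fun h => by
        rw [c2, Fin.rev_rev] at h
        subst h
        exact c1 ((le_antisymm hjk hij).trans c2)
      have d : diagCoef m q j k = (diagCoef m q i k)⁻¹ := by rw [c2, diagCoef_rev_left]
      have d' := diagCoef_ne_zero hq i k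
      simp only [if_neg c1, if_neg c3, if_pos c2, d]
      match_scalars <;> field_simp
    · by_cases c3 : k = Fin.rev j
      · have c4 : i ≠ j := fun h => c1 (by rw [h]; exact c3)
        have d : diagCoef m q i k = (diagCoef m q i j)⁻¹ := by rw [c3, diagCoef_rev]
        have d' := diagCoef_ne_zero hq i j
        simp only [if_neg c1, if_neg c2, if_neg c4, if_pos c3, d]
        match_scalars <;> field_simp
      · simp only [c1, c2, c3, if_false]
        module

/-- The distance of an index from the middle. -/
def spread (a : Fin m) : ℕ := (2 * (a : ℤ) + 1 - m).natAbs

theorem spread_le (a : Fin m) : spread a ≤ m := by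
  have := a.isLt; unfold spread; omega

/-- The trace term of a pair of opposite indices consists of opposite pairs strictly further from
the middle; this makes the induction below terminate. -/
theorem spread_lt {a b c : Fin m} (hab : a < b) (h : b = Fin.rev a) (hc : b < c) :
    spread a < spread c ∧ spread b < spread (Fin.rev c) := by
  have h1 : (b : ℕ) = m - (a + 1) := by rw [h, Fin.val_rev]
  have h2 : ((Fin.rev c : Fin m) : ℕ) = m - (c + 1) := Fin.val_rev c
  have := a.isLt
  have := c.isLt
  rw [Fin.lt_def] at hab hc
  unfold spread
  omega

/-- The word is sorted. For `a < b` the braiding sends `e_b ⊗ e_a` to a nonzero multiple of `e_a ⊗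
e_b` up to trace terms of larger spread, so the invariance of `braidKer` passes membership from the
sorted word to the unsorted one. The total spread is at most `3 m`, whence the induction on the
difference. -/
theorem tri_mem_braidKer (hq : 0 < q) (a b c : Fin m) : tri a b c ∈ braidKer m q := by
  obtain ⟨n, hn⟩ : ∃ n, 3 * m - (spread a + spread b + spread c) = n := ⟨_, rfl⟩
  induction n using Nat.strong_induction_on generalizing a b c with
  | _ n ih =>
  have swap1 : ∀ a b c : Fin m, 3 * m - (spread a + spread b + spread c) = n → a < b →
      tri b a c ∈ braidKer m q → tri a b c ∈ braidKer m q := by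
    intro a b c hn hab hm
    have h1 := braid1_mem_braidKer hq hm
    rw [braid1_tri_of_ge hq hab.le] at h1
    have h2 : (if a = Fin.rev b then triLeft m q b c else 0) ∈ braidKer m q := by
      split_ifs with hr
      · refine Submodule.sum_mem _ fun l _ => ?_
        split_ifs with hl
        · refine Submodule.smul_mem _ _ (ih _ ?_ _ _ _ rfl)
          have := spread_lt hab (eq_rev_comm.1 hr) hl
          have := spread_le a
          have := spread_le b
          have := spread_le c
          have := spread_le l
          have := spread_le (Fin.rev l)
          omega
        · exact Submodule.zero_mem _
      · exact Submodule.zero_mem _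
    have h3 := Submodule.add_mem _ h1 h2
    rw [sub_add_cancel] at h3
    exact (Submodule.smul_mem_iff _ (diagCoef_ne_zero hq b a)).1 h3
  have swap2 : ∀ c a b : Fin m, 3 * m - (spread c + spread a + spread b) = n → a < b →
      tri c b a ∈ braidKer m q → tri c a b ∈ braidKer m q := by
    intro c a b hn hab hm
    have h1 := braid2_mem_braidKer hq hm
    rw [braid2_tri_of_ge hq hab.le] at h1
    have h2 : (if a = Fin.rev b then triRight m q b c else 0) ∈ braidKer m q := by
      split_ifs with hr
      · refine Submodule.sum_mem _ fun l _ => ?_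
        split_ifs with hl
        · refine Submodule.smul_mem _ _ (ih _ ?_ _ _ _ rfl)
          have := spread_lt hab (eq_rev_comm.1 hr) hl
          have := spread_le a
          have := spread_le b
          have := spread_le c
          have := spread_le l
          have := spread_le (Fin.rev l)
          omega
        · exact Submodule.zero_mem _
      · exact Submodule.zero_mem _
    have h3 := Submodule.add_mem _ h1 h2
    rw [sub_add_cancel] at h3
    exact (Submodule.smul_mem_iff _ (diagCoef_ne_zero hq b a)).1 h3
  have sorted : ∀ a b c : Fin m, 3 * m - (spread a + spread b + spread c) = n → b ≤ a →
      tri a b c ∈ braidKer m q := by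
    intro a b c hn hab
    rcases le_or_gt c b with h | h
    · exact tri_mem_braidKer_of_ge hq hab h
    · refine swap2 a b c hn h ?_
      rcases le_or_gt c a with h' | h'
      · exact tri_mem_braidKer_of_ge hq h' h.le
      · exact swap1 a c b (by rw [← hn]; ring_nf) h' (tri_mem_braidKer_of_ge hq h'.le hab)
  rcases le_or_gt b a with h | h
  · exact sorted a b c hn h
  · exact swap1 a b c hn h (sorted b a c (by rw [← hn]; ring_nf) h.le)

/-- The braid relation. -/
theorem braid_relation (hq : 0 < q) : leg1 (Rhat m q) * leg2 (Rhat m q) * leg1 (Rhat m q) =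
    leg2 (Rhat m q) * leg1 (Rhat m q) * leg2 (Rhat m q) := by
  refine matrix_ext_act fun u => ?_
  have : u ∈ braidKer m q := by
    have h : u = ∑ x : Fin m × Fin m × Fin m, u x • tri x.1 x.2.1 x.2.2 := by
      funext y
      rw [Finset.sum_apply, Finset.sum_eq_single y]
      · simp [tri]
      · intro x _ hx
        have : y ≠ x := hx.symm
        simp [tri, Pi.single_apply, this]
      · simp
    rw [h]
    exact Submodule.sum_mem _ fun x _ => Submodule.smul_mem _ _ (tri_mem_braidKer hq _ _ _)
  rw [mem_braidKer] at this
  simpa [act_mul, braid1, braid2] using this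

end braid
end QEuclid
end

noncomputable section

namespace QEuclid

open Finset

/-! ### The differential calculi on the algebra of polynomials -/

section calculus

variable {m : ℕ} {q : ℝ}

/-- `P_A` is a multiple of `(R̂ - q) (R̂ - q ^ (1 - m))`. By the quadratic relation `(R̂ + q⁻¹) (R̂
- q)` is a multiple of the trace projector, which `R̂ - q ^ (1 - m)` kills. -/
theorem projA_mul_Rhat_add (hq : 0 < q) : projA m q * (Rhat m q + (q : ℂ)⁻¹ • 1) = 0 := by
  have hq0 : (q : ℂ) ≠ 0 := by exact_mod_cast hq.ne'
  have h2 : (Rhat m q + (q : ℂ)⁻¹ • 1) * (Rhat m q - (q : ℂ) • 1) =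
      -((((q : ℂ) - (q : ℂ)⁻¹) * (q : ℂ) ^ (1 - (m : ℤ))) • traceProj m q) := by
    simp only [mul_sub, add_mul, Rhat_sq hq, mul_smul_comm, mul_one, smul_mul_assoc, one_mul,
      smul_smul, mul_inv_cancel₀ hq0, one_smul, sub_smul]
    match_scalars <;> field_simp <;> ring
  have c1 : (Rhat m q - (q : ℂ) • 1) * (Rhat m q + (q : ℂ)⁻¹ • 1) =
      (Rhat m q + (q : ℂ)⁻¹ • 1) * (Rhat m q - (q : ℂ) • 1) := by
    simp only [mul_sub, sub_mul, mul_add, add_mul, mul_smul_comm, mul_one, smul_mul_assoc, one_mul,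
      smul_smul, mul_inv_cancel₀ hq0, inv_mul_cancel₀ hq0]
    module
  have c2 : ∀ a b : ℂ, (Rhat m q - a • 1) * (Rhat m q - b • 1) =
      (Rhat m q - b • 1) * (Rhat m q - a • 1) := by
    intro a b
    simp only [mul_sub, sub_mul, mul_smul_comm, mul_one, smul_mul_assoc, one_mul, smul_smul,
      mul_comm a b]
    module
  have h3 : (Rhat m q - ((q ^ (1 - (m : ℤ)) : ℝ) : ℂ) • 1) * traceProj m q = 0 := by
    rw [sub_mul, Rhat_mul_traceProj hq, smul_mul_assoc, one_mul]
    push_cast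
    exact sub_self _
  rw [projA, smul_mul_assoc, c2, mul_assoc, c1, h2, mul_neg, mul_smul_comm, h3, smul_zero, neg_zero,
    smul_zero]

/-- Differentiating one factor of `x^k x^l` produces, after a zigzag, the matrix `1 + q R̂` in the
calculus with `s = q`; its annihilation by `P_A` is what compatibility with the relations demands.
-/
theorem projA_mul_one_add_Rhat (hq : 0 < q) : projA m q * (1 + (q : ℂ) • Rhat m q) = 0 := by
  have hq0 : (q : ℂ) ≠ 0 := by exact_mod_cast hq.ne'
  have h := congrArg ((q : ℂ) • ·) (projA_mul_Rhat_add (m := m) hq)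
  simp only [smul_zero, ← mul_smul_comm, smul_add, smul_smul, mul_inv_cancel₀ hq0, one_smul] at h
  rwa [add_comm] at h

theorem projA_mul_one_add_RhatInv (hq : 0 < q) :
    projA m q * (1 + (q : ℂ)⁻¹ • RhatInv m q) = 0 := by
  have h := congrArg (· * RhatInv m q) (projA_mul_Rhat_add (m := m) hq)
  simpa only [zero_mul, mul_assoc, add_mul, Rhat_mul_RhatInv hq, smul_mul_assoc, one_mul] using h

/-- Intertwining with the braiding passes to the projection `P_A`. -/
theorem projA_intertwine {A : Matrix (Fin m × Fin m × Fin m) (Fin m × Fin m × Fin m) ℂ}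
    (f g : Matrix (Fin m × Fin m) (Fin m × Fin m) ℂ →
      Matrix (Fin m × Fin m × Fin m) (Fin m × Fin m × Fin m) ℂ)
    (hf : (∀ S T, f (S * T) = f S * f T) ∧ (∀ (c : ℂ) T, f (c • T) = c • f T) ∧
      (∀ S T, f (S - T) = f S - f T) ∧ f 1 = 1)
    (hg : (∀ S T, g (S * T) = g S * g T) ∧ (∀ (c : ℂ) T, g (c • T) = c • g T) ∧
      (∀ S T, g (S - T) = g S - g T) ∧ g 1 = 1)
    (h : f (Rhat m q) * A = A * g (Rhat m q)) : f (projA m q) * A = A * g (projA m q) := by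
  have key : ∀ c : ℂ, f (Rhat m q - c • 1) * A = A * g (Rhat m q - c • 1) := by
    intro c
    simp only [hf.2.2.1, hg.2.2.1, hf.2.1, hg.2.1, hf.2.2.2, hg.2.2.2, sub_mul, mul_sub, h,
      smul_mul_assoc, mul_smul_comm, one_mul, mul_one]
  simp only [projA, hf.2.1, hg.2.1, smul_mul_assoc, mul_smul_comm, hf.1, hg.1]
  congr 1
  rw [mul_assoc, key, ← mul_assoc, key, mul_assoc]

theorem leg1_hom : (∀ S T : Matrix (Fin m × Fin m) (Fin m × Fin m) ℂ, leg1 (S * T) = leg1 S * leg1 T)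
    ∧ (∀ (c : ℂ) (T : Matrix (Fin m × Fin m) (Fin m × Fin m) ℂ), leg1 (c • T) = c • leg1 T) ∧
    (∀ S T : Matrix (Fin m × Fin m) (Fin m × Fin m) ℂ, leg1 (S - T) = leg1 S - leg1 T) ∧
    leg1 (1 : Matrix (Fin m × Fin m) (Fin m × Fin m) ℂ) = 1 :=
  ⟨leg1_mul, leg1_smul, leg1_sub, leg1_one⟩

theorem leg2_hom : (∀ S T : Matrix (Fin m × Fin m) (Fin m × Fin m) ℂ, leg2 (S * T) = leg2 S * leg2 T)
    ∧ (∀ (c : ℂ) (T : Matrix (Fin m × Fin m) (Fin m × Fin m) ℂ), leg2 (c • T) = c • leg2 T) ∧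
    (∀ S T : Matrix (Fin m × Fin m) (Fin m × Fin m) ℂ, leg2 (S - T) = leg2 S - leg2 T) ∧
    leg2 (1 : Matrix (Fin m × Fin m) (Fin m × Fin m) ℂ) = 1 :=
  ⟨leg2_mul, leg2_smul, leg2_sub, leg2_one⟩

theorem leg_inv (hq : 0 < q) :
    leg1 (RhatInv m q) * leg1 (Rhat m q) = 1 ∧ leg1 (Rhat m q) * leg1 (RhatInv m q) = 1 ∧
    leg2 (RhatInv m q) * leg2 (Rhat m q) = 1 ∧ leg2 (Rhat m q) * leg2 (RhatInv m q) = 1 := by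
  simp only [← leg1_mul, ← leg2_mul, RhatInv_mul_Rhat hq, Rhat_mul_RhatInv hq, leg1_one, leg2_one,
    and_self]

theorem projA_braid (hq : 0 < q) : leg2 (projA m q) * (leg1 (Rhat m q) * leg2 (Rhat m q)) =
    leg1 (Rhat m q) * leg2 (Rhat m q) * leg1 (projA m q) :=
  projA_intertwine leg2 leg1 leg2_hom leg1_hom (by rw [← mul_assoc, braid_relation hq])

theorem projA_braid_inv (hq : 0 < q) :
    leg2 (projA m q) * (leg1 (RhatInv m q) * leg2 (RhatInv m q)) =
      leg1 (RhatInv m q) * leg2 (RhatInv m q) * leg1 (projA m q) := by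
  obtain ⟨h1, h2, h3, h4⟩ := leg_inv (m := m) hq
  refine projA_intertwine leg2 leg1 leg2_hom leg1_hom ?_
  -- The product `R₁⁻¹ R₂⁻¹ R₂ R₁ = 1` is inserted on the left, so that the braid relation applies
  -- in the middle.
  calc leg2 (Rhat m q) * (leg1 (RhatInv m q) * leg2 (RhatInv m q))
      = leg1 (RhatInv m q) * leg2 (RhatInv m q) * (leg2 (Rhat m q) * leg1 (Rhat m q) *
        leg2 (Rhat m q)) * (leg1 (RhatInv m q) * leg2 (RhatInv m q)) := by
        simp only [mul_assoc]
        rw [← mul_assoc (leg2 (RhatInv m q)) (leg2 (Rhat m q)), h3, one_mul,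
          ← mul_assoc (leg1 (RhatInv m q)) (leg1 (Rhat m q)), h1, one_mul]
    _ = leg1 (RhatInv m q) * leg2 (RhatInv m q) * leg1 (Rhat m q) := by
        rw [← braid_relation hq]
        simp only [mul_assoc]
        rw [← mul_assoc (leg1 (Rhat m q)) (leg1 (RhatInv m q)), h2, one_mul, h4, mul_one]

theorem projA_braid_inv' (hq : 0 < q) :
    leg1 (projA m q) * (leg2 (RhatInv m q) * leg1 (RhatInv m q)) =
      leg2 (RhatInv m q) * leg1 (RhatInv m q) * leg2 (projA m q) := by
  obtain ⟨h1, h2, h3, h4⟩ := leg_inv (m := m) hq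
  refine projA_intertwine leg1 leg2 leg1_hom leg2_hom ?_
  calc leg1 (Rhat m q) * (leg2 (RhatInv m q) * leg1 (RhatInv m q))
      = leg2 (RhatInv m q) * leg1 (RhatInv m q) * (leg1 (Rhat m q) * leg2 (Rhat m q) *
        leg1 (Rhat m q)) * (leg2 (RhatInv m q) * leg1 (RhatInv m q)) := by
        simp only [mul_assoc]
        rw [← mul_assoc (leg1 (RhatInv m q)) (leg1 (Rhat m q)), h1, one_mul,
          ← mul_assoc (leg2 (RhatInv m q)) (leg2 (Rhat m q)), h3, one_mul]
    _ = leg2 (RhatInv m q) * leg1 (RhatInv m q) * leg2 (Rhat m q) := by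
        rw [braid_relation hq]
        simp only [mul_assoc]
        rw [← mul_assoc (leg2 (Rhat m q)) (leg2 (RhatInv m q)), h4, one_mul, h2, mul_one]

/-- The constant `μ` as a complex number. -/
theorem muConst_cast : ((muConst m q : ℝ) : ℂ) = 1 + (q : ℂ) ^ (2 - (m : ℤ)) := by
  unfold muConst; push_cast; rfl

theorem muConst_pos (hq : 0 < q) : 0 < muConst m q := by
  unfold muConst; positivity

variable (m q) in
/-- The coefficient of the metric in the commutation relations solved for the braid matrix. -/
def relCoef : ℂ := (1 - (q : ℂ) ^ 2) * (q : ℂ) ^ (1 - (m : ℤ)) / (muConst m q : ℝ)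

section

variable {M : Type*} [AddCommGroup M] [Module ℂ M]

theorem act_traceProj (u : Fin m × Fin m → M) (p : Fin m × Fin m) :
    act (traceProj m q) u p = metric m q p.1 p.2 • ∑ i, ∑ j, metric m q i j • u (i, j) := by
  simp [act, traceProj, Fintype.sum_prod_type, Finset.smul_sum, smul_smul]

/-- Vectors killed by `P_A` are eigenvectors of the braid matrix up to a multiple of the metric. -/
theorem act_Rhat_of_act_projA (hq : 0 < q) {u : Fin m × Fin m → M} (hu : act (projA m q) u = 0)
    (p : Fin m × Fin m) : act (Rhat m q) u p = (q : ℂ) • u p +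
      (relCoef m q * metric m q p.1 p.2) • ∑ i, ∑ j, metric m q i j • u (i, j) := by
  have hq0 : (q : ℂ) ≠ 0 := by exact_mod_cast hq.ne'
  have hmu : ((muConst m q : ℝ) : ℂ) ≠ 0 := by exact_mod_cast (muConst_pos hq).ne'
  have hc : (((-q⁻¹ - q) * (-q⁻¹ - q ^ (1 - (m : ℤ))) : ℝ) : ℂ)⁻¹ ≠ 0 := by
    have h1 : (0 : ℝ) < q⁻¹ + q := by positivity
    have h2 : (0 : ℝ) < q⁻¹ + q ^ (1 - (m : ℤ)) := by positivity
    have h3 : (0 : ℝ) < (-q⁻¹ - q) * (-q⁻¹ - q ^ (1 - (m : ℤ))) := by nlinarith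
    exact inv_ne_zero (by exact_mod_cast h3.ne')
  rw [projA, act_smul] at hu
  have hu := (smul_eq_zero.1 hu).resolve_left hc
  -- By the quadratic relation `P_A` is a combination of `R̂`, the identity and the trace projector,
  -- so `P_A u = 0` can be solved for `R̂ u`.
  have e : (Rhat m q - (q : ℂ) • (1 : Matrix (Fin m × Fin m) (Fin m × Fin m) ℂ)) *
      (Rhat m q - ((q ^ (1 - (m : ℤ)) : ℝ) : ℂ) • (1 : Matrix (Fin m × Fin m) (Fin m × Fin m) ℂ)) =
      -((q : ℂ)⁻¹ + (q : ℂ) ^ (1 - (m : ℤ))) • Rhat m q +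
      (1 + (q : ℂ) * (q : ℂ) ^ (1 - (m : ℤ))) • 1 -
      (((q : ℂ) - (q : ℂ)⁻¹) * (q : ℂ) ^ (1 - (m : ℤ))) • traceProj m q := by
    simp only [mul_sub, sub_mul, mul_smul_comm, mul_one, smul_mul_assoc, one_mul, smul_smul,
      Rhat_sq hq]
    push_cast
    module
  rw [e, act_sub, act_add, act_smul, act_smul, act_smul, act_one] at hu
  have hu := congrFun hu p
  simp only [Pi.add_apply, Pi.sub_apply, Pi.smul_apply, Pi.zero_apply, act_traceProj] at hu
  set S := ∑ i, ∑ j, metric m q i j • u (i, j)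
  have hb : (q : ℂ)⁻¹ + (q : ℂ) ^ (1 - (m : ℤ)) = (q : ℂ)⁻¹ * (muConst m q : ℝ) := by
    rw [muConst_cast, mul_add, mul_one, show (2 - (m : ℤ)) = 1 + (1 - m) by ring,
      zpow_add₀ hq0, zpow_one, ← mul_assoc, inv_mul_cancel₀ hq0, one_mul]
  have hb' : 1 + (q : ℂ) * (q : ℂ) ^ (1 - (m : ℤ)) = (muConst m q : ℝ) := by
    rw [muConst_cast, show (2 - (m : ℤ)) = 1 + (1 - m) by ring, zpow_add₀ hq0, zpow_one]
  rw [hb, hb'] at hu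
  have h2 : act (Rhat m q) u p = ((q : ℂ) / (muConst m q : ℝ)) •
      (((q : ℂ)⁻¹ * (muConst m q : ℝ)) • act (Rhat m q) u p) := by
    rw [smul_smul]
    have : (q : ℂ) / (muConst m q : ℝ) * ((q : ℂ)⁻¹ * (muConst m q : ℝ)) = 1 := by field_simp
    rw [this, one_smul]
  have h3 : (((q : ℂ)⁻¹ * (muConst m q : ℝ)) • act (Rhat m q) u p) =
      ((muConst m q : ℝ) : ℂ) • u p -
      (((q : ℂ) - (q : ℂ)⁻¹) * (q : ℂ) ^ (1 - (m : ℤ))) • metric m q p.1 p.2 • S := by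
    rw [← sub_eq_zero, ← neg_eq_zero, ← hu]
    module
  rw [h2, h3, relCoef]
  match_scalars <;> field_simp
  ring

end

/-- The action of the generator `x^j` on an element of the algebra of polynomials together with its
partial derivatives. -/
def polyStep (s : ℂ) (T : Matrix (Fin m × Fin m) (Fin m × Fin m) ℂ) (j : Fin m) :
    Module.End ℂ (QPoly m q × (Fin m → QPoly m q)) where
  toFun v := (coord m q j * v.1, fun i => metric m q i j • v.1 +
    s • act T (fun p => coord m q p.1 * v.2 p.2) (i, j))
  map_add' v w := by
    ext i
    · simp [mul_add]
    · simp only [Prod.fst_add, Prod.snd_add, Pi.add_apply, smul_add, mul_add, act,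
        Finset.sum_add_distrib]
      abel
  map_smul' c v := by
    ext i
    · simp
    · simp only [Prod.smul_fst, Prod.smul_snd, Pi.smul_apply, RingHom.id_apply, mul_smul_comm,
        smul_add, Finset.smul_sum, act]
      simp only [smul_smul, mul_comm, mul_left_comm]

/-- This separates the terms in which one of the two coordinates is differentiated from those in
which the derivative passes both, the form in which `P_A` can be applied to `(j, k)`. -/
theorem polyStep_polyStep (s : ℂ) (T : Matrix (Fin m × Fin m) (Fin m × Fin m) ℂ) (i j k : Fin m)
    (v : QPoly m q × (Fin m → QPoly m q)) :
    (polyStep s T j (polyStep s T k v)).2 i =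
      act (cup12 m q + s • (leg1 T * cup23 m q)) (fun d => coord m q d * v.1) (i, j, k) +
      s ^ 2 • act (leg1 T * leg2 T)
        (fun y => coord m q y.1 * (coord m q y.2.1 * v.2 y.2.2)) (i, j, k) := by
  simp only [polyStep, LinearMap.coe_mk, AddHom.coe_mk, act_add, act_smul, act_mul, Pi.add_apply,
    Pi.smul_apply, act_cup12, act_leg1]
  have h1 : (fun p : Fin m × Fin m => coord m q p.1 * (metric m q p.2 k • v.1 +
      s • act T (fun p' => coord m q p'.1 * v.2 p'.2) (p.2, k))) =
      (fun p : Fin m × Fin m => act (cup23 m q) (fun d => coord m q d * v.1) (p.1, p.2, k)) +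
      s • (fun p : Fin m × Fin m => act (leg2 T)
        (fun y => coord m q y.1 * (coord m q y.2.1 * v.2 y.2.2)) (p.1, p.2, k)) := by
    funext p
    simp only [Pi.add_apply, Pi.smul_apply, act_cup23, act_leg2, mul_add, mul_smul_comm]
    congr 2
    simp [act, Finset.mul_sum]
  rw [h1, act_vec_add, act_vec_smul, Pi.add_apply, Pi.smul_apply, smul_add, smul_smul, sq, add_assoc]

theorem act_projA_coord :
    act (projA m q) (fun p => coord m q p.1 * coord m q p.2) = 0 := by
  funext ab
  simpa [act, Fintype.sum_prod_type] using mk_rel m q ab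

/-- The data of one of the two differential calculi. -/
structure CalculusData (q : ℝ) (s : ℂ) (T T' : Matrix (Fin m × Fin m) (Fin m × Fin m) ℂ) (c : ℂ) :
    Prop extends Braiding q T T' c where
  projA_first : projA m q * (1 + s • T') = 0
  projA_second : leg2 (projA m q) * (leg1 T * leg2 T) = leg1 T * leg2 T * leg1 (projA m q)

theorem calculusData_pd (hq : 0 < q) :
    CalculusData q q (RhatInv m q) (Rhat m q) ((q : ℂ) ^ (1 - (m : ℤ)))⁻¹ :=
  { (braiding_Rhat (m := m) hq).inverse with
    projA_first := projA_mul_one_add_Rhat hq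
    projA_second := projA_braid_inv hq }

theorem calculusData_pdBar (hq : 0 < q) :
    CalculusData q ((q⁻¹ : ℝ) : ℂ) (Rhat m q) (RhatInv m q) ((q : ℂ) ^ (1 - (m : ℤ))) :=
  { braiding_Rhat (m := m) hq with
    projA_first := by
      have := projA_mul_one_add_RhatInv (m := m) hq
      push_cast
      exact this
    projA_second := projA_braid hq }

section

variable {s : ℂ} {T T' : Matrix (Fin m × Fin m) (Fin m × Fin m) ℂ} {c : ℂ}
  (h : CalculusData q s T T' c)

include h

/-- Stability of the ideal of relations. Where a coordinate is differentiated, the zigzag turns the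
coefficient into `1 + s T'` on the last two places, killed by `P_A`. Where the derivative passes
both, `T₁ T₂` carries `P_A` from the last two places to the first two, where it meets the relation
between the coordinates. -/
theorem polyStep_rel (ab : Fin m × Fin m) :
    ∑ j, ∑ k, projA m q ab (j, k) • (polyStep (q := q) s T j * polyStep s T k) = 0 := by
  refine LinearMap.ext fun v => ?_
  simp only [LinearMap.sum_apply, LinearMap.smul_apply, Module.End.mul_apply, LinearMap.zero_apply]
  refine Prod.ext ?_ ?_
  · have e := congrArg (· * v.1) (mk_rel m q ab)
    simpa [Prod.fst_sum, polyStep, Finset.sum_mul, mul_assoc] using e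
  · funext i
    simp only [Prod.snd_sum, Prod.smul_snd, Finset.sum_apply, Pi.smul_apply, polyStep_polyStep,
      Prod.snd_zero, Pi.zero_apply]
    set w : Fin m → QPoly m q := fun d => coord m q d * v.1
    set u : Fin m × Fin m × Fin m → QPoly m q :=
      fun y => coord m q y.1 * (coord m q y.2.1 * v.2 y.2.2) with hu
    have e1 : act (leg2 (projA m q)) (act (cup12 m q + s • (leg1 T * cup23 m q)) w) = 0 := by
      rw [← act_mul, h.zigzag]
      have : cup12 m q + s • (leg2 T' * cup12 m q) = leg2 (1 + s • T') * cup12 m q := by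
        rw [leg2_add, leg2_one, leg2_smul, Matrix.add_mul, Matrix.one_mul, Matrix.smul_mul]
      rw [this, ← Matrix.mul_assoc, ← leg2_mul, h.projA_first]
      have z : leg2 (0 : Matrix (Fin m × Fin m) (Fin m × Fin m) ℂ) = 0 := by
        ext x y; simp [leg2]
      rw [z, Matrix.zero_mul, act_zero_mat]
    have e2 : act (leg2 (projA m q)) (act (leg1 T * leg2 T) u) = 0 := by
      rw [← act_mul, h.projA_second, act_mul]
      have z : act (leg1 (projA m q)) u = 0 := by
        funext ⟨a, b, d⟩
        rw [act_leg1]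
        have e := congrArg (· * v.2 d) (congrFun (act_projA_coord (m := m) (q := q)) (a, b))
        simpa [act, hu, Finset.sum_mul, mul_assoc] using e
      rw [z, act_zero]
    have e3 : act (leg2 (projA m q)) (act (cup12 m q + s • (leg1 T * cup23 m q)) w +
        s ^ 2 • act (leg1 T * leg2 T) u) = 0 := by
      rw [act_vec_add, act_vec_smul, e1, e2, smul_zero, add_zero]
    have e4 := congrFun e3 (i, ab.1, ab.2)
    rw [act_leg2, act, Fintype.sum_prod_type] at e4
    exact e4

/-- The action of the algebra of polynomials on its elements together with partial derivatives. -/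
def stepHom : QPoly m q →ₐ[ℂ] Module.End ℂ (QPoly m q × (Fin m → QPoly m q)) :=
  RingQuot.liftAlgHom ℂ ⟨FreeAlgebra.lift ℂ (polyStep (q := q) s T), by
    rintro _ _ ⟨ab⟩
    have := polyStep_rel h ab
    simpa [map_sum] using this⟩

theorem stepHom_mk (a : FreeAlgebra ℂ (Fin m)) (v : FreeAlgebra ℂ (Fin m) ×
    (Fin m → FreeAlgebra ℂ (Fin m))) :
    stepHom h (mk m q a) (mk m q v.1, fun i => mk m q (v.2 i)) =
      (mk m q (FreeAlgebra.lift ℂ (leibnizStep q s T) a v).1,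
        fun i => mk m q ((FreeAlgebra.lift ℂ (leibnizStep q s T) a v).2 i)) := by
  have e : ∀ a, stepHom h (mk m q a) = FreeAlgebra.lift ℂ (polyStep (q := q) s T) a := by
    intro a
    simp [stepHom, mk]
  rw [e]
  induction a using FreeAlgebra.induction generalizing v with
  | grade0 r => simp [Algebra.algebraMap_eq_smul_one]; rfl
  | grade1 j =>
    simp only [FreeAlgebra.lift_ι_apply, polyStep, leibnizStep, LinearMap.coe_mk, AddHom.coe_mk]
    refine Prod.ext ?_ ?_
    · simp [coord]
    · funext i
      simp [coord, act, Fintype.sum_prod_type, map_sum]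
  | mul a b ha hb => simp only [map_mul, Module.End.mul_apply, hb, ha]
  | add a b ha hb =>
    simp only [map_add, LinearMap.add_apply, ha, hb]
    exact Prod.ext (by simp) (funext fun i => by simp)

/-- The derivative can be read off from `stepHom`, which sees only the class of `a`; the
representative chosen by `lift` is therefore immaterial. -/
theorem polyPartial_mk (a : FreeAlgebra ℂ (Fin m)) (i : Fin m) :
    polyPartial q s T i (mk m q a) = mk m q (freePartial q s T i a) := by
  have key : ∀ a, mk m q (freePartial q s T i a) =
      (stepHom h (mk m q a) (1, 0)).2 i := by
    intro a
    have := congrArg (fun v => v.2 i) (stepHom_mk h a (1, 0))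
    simp only [map_one, Pi.zero_apply, map_zero] at this
    exact this.symm
  have hl : mk m q (lift q (mk m q a)) = mk m q a :=
    LinearMap.congr_fun (exists_lift (m := m) q).choose_spec (mk m q a)
  simp only [polyPartial, LinearMap.comp_apply, AlgHom.toLinearMap_apply]
  rw [key, key, hl]

theorem polyPartial_one (i : Fin m) : polyPartial q s T i (1 : QPoly m q) = 0 := by
  have := polyPartial_mk h 1 i
  rwa [map_one, freePartial_one, map_zero] at this

/-- The Leibniz rule. -/
theorem polyPartial_coord_mul (i j : Fin m) (a : QPoly m q) :
    polyPartial q s T i (coord m q j * a) = metric m q i j • a +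
      s • act T (fun p => coord m q p.1 * polyPartial q s T p.2 a) (i, j) := by
  obtain ⟨b, rfl⟩ : ∃ b, mk m q b = a := RingQuot.mkAlgHom_surjective ℂ (CommRel m q) a
  rw [coord, ← map_mul, polyPartial_mk h, freePartial_coord_mul]
  simp [act, Fintype.sum_prod_type, map_sum, polyPartial_mk h, coord]

theorem polyPartial_coord_coord_mul (i j k : Fin m) (a : QPoly m q) :
    polyPartial q s T i (coord m q j * (coord m q k * a)) =
      act (cup12 m q + s • (leg1 T * cup23 m q)) (fun d => coord m q d * a) (i, j, k) +
      s ^ 2 • act (leg1 T * leg2 T) (fun y => coord m q y.1 *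
        (coord m q y.2.1 * polyPartial q s T y.2.2 a)) (i, j, k) := by
  have e := polyStep_polyStep (q := q) s T i j k (a, fun i => polyPartial q s T i a)
  rw [← e]
  have e1 : ∀ (k : Fin m) (a : QPoly m q), polyStep s T k
      (a, fun i => polyPartial q s T i a) =
      (coord m q k * a, fun i => polyPartial q s T i (coord m q k * a)) := by
    intro k a
    simp only [polyStep, LinearMap.coe_mk, AddHom.coe_mk]
    refine Prod.ext rfl ?_
    funext i
    exact (polyPartial_coord_mul h i k a).symm
  rw [e1, e1]

end

/-- Induction on words in the coordinates. -/
theorem QPoly.induction_words {P : QPoly m q → Prop} (one : P 1)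
    (add : ∀ a b, P a → P b → P (a + b)) (smul : ∀ (c : ℂ) a, P a → P (c • a))
    (mul : ∀ j a, P a → P (coord m q j * a)) (a : QPoly m q) : P a := by
  obtain ⟨b, rfl⟩ := RingQuot.mkAlgHom_surjective ℂ (CommRel m q) a
  change P (mk m q b)
  have key : ∀ b : FreeAlgebra ℂ (Fin m), ∀ a, P a → P (mk m q b * a) := by
    intro b
    induction b using FreeAlgebra.induction with
    | grade0 r => intro a ha; simpa [Algebra.algebraMap_eq_smul_one] using smul r a ha
    | grade1 j => exact mul j
    | mul b c hb hc => intro a ha; rw [map_mul, mul_assoc]; exact hb _ (hc _ ha)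
    | add b c hb hc => intro a ha; rw [map_add, add_mul]; exact add _ _ (hb _ ha) (hc _ ha)
  simpa using key b 1 one

/-- Induction on homogeneous words in the coordinates. -/
theorem homog_induction {P : (k : ℕ) → (a : QPoly m q) → a ∈ homog m q k → Prop}
    (one : ∀ h, P 0 1 h) (zero : ∀ k h, P k 0 h)
    (add : ∀ k a b ha hb, P k a ha → P k b hb → P k (a + b) (Submodule.add_mem _ ha hb))
    (smul : ∀ k (c : ℂ) a ha, P k a ha → P k (c • a) (Submodule.smul_mem _ c ha))
    (mul : ∀ k j a ha h, P k a ha → P (k + 1) (coord m q j * a) h) {k : ℕ} {a : QPoly m q}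
    (ha : a ∈ homog m q k) : P k a ha := by
  suffices h : ∀ k, ∀ a ∈ homog m q k, ∃ ha, P k a ha by
    obtain ⟨_, h⟩ := h k a ha
    exact h
  intro k
  induction k with
  | zero =>
    intro a ha
    have ha' := ha
    rw [homog, pow_zero, Submodule.mem_one] at ha'
    obtain ⟨c, rfl⟩ := ha'
    have h1 : (1 : QPoly m q) ∈ homog m q 0 := by
      rw [homog, pow_zero]; exact Submodule.one_le.1 le_rfl
    refine ⟨ha, ?_⟩
    have := smul 0 c 1 h1 (one h1)
    simpa only [Algebra.algebraMap_eq_smul_one] using this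
  | succ k ih =>
    intro a ha
    rw [homog, pow_succ'] at ha
    refine Submodule.mul_induction_on ha ?_ ?_
    · intro x hx y hy
      induction hx using Submodule.span_induction with
      | mem x hx =>
        obtain ⟨j, rfl⟩ := hx
        obtain ⟨hy', h⟩ := ih y hy
        have hm : coord m q j * y ∈ homog m q (k + 1) := by
          rw [homog, pow_succ']
          exact Submodule.mul_mem_mul (Submodule.subset_span ⟨j, rfl⟩) hy
        exact ⟨hm, mul k j y hy' hm h⟩
      | zero => rw [zero_mul]; exact ⟨Submodule.zero_mem _, zero _ _⟩
      | add x z _ _ hx hz =>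
        rw [add_mul]
        obtain ⟨h1, h2⟩ := hx
        obtain ⟨h3, h4⟩ := hz
        exact ⟨_, add _ _ _ h1 h3 h2 h4⟩
      | smul c x _ hx =>
        rw [smul_mul_assoc]
        obtain ⟨h1, h2⟩ := hx
        exact ⟨_, smul _ _ _ h1 h2⟩
    · rintro x y ⟨h1, h2⟩ ⟨h3, h4⟩
      exact ⟨_, add _ _ _ h1 h3 h2 h4⟩

end calculus
end QEuclid
end

noncomputable section

namespace QEuclid

open Finset

/-! ### Operator identities -/

section operators

variable {m : ℕ} {q : ℝ}

section

variable {ι κ : Type*} [Fintype κ]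

theorem mul_act (T : Matrix ι κ ℂ) (u : κ → QPoly m q) (b : QPoly m q) (i : ι) :
    b * act T u i = act T (fun j => b * u j) i := by
  simp [act, Finset.mul_sum]

theorem act_mul_right (T : Matrix ι κ ℂ) (u : κ → QPoly m q) (b : QPoly m q) (i : ι) :
    act T u i * b = act T (fun j => u j * b) i := by
  simp [act, Finset.sum_mul]

end

theorem normSq_mul (a : QPoly m q) : normSq m q * a =
    ∑ j, ∑ k, metric m q j k • (coord m q j * (coord m q k * a)) := by
  simp [normSq, Finset.sum_mul, mul_assoc]

theorem mul_normSq (a : QPoly m q) : a * normSq m q =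
    ∑ j, ∑ k, metric m q j k • (a * (coord m q j * coord m q k)) := by
  simp [normSq, Finset.mul_sum]

/-- The commutation relations solved for the braid matrix. -/
theorem act_Rhat_coord (hq : 0 < q) (p : Fin m × Fin m) :
    act (Rhat m q) (fun p => coord m q p.1 * coord m q p.2) p =
      (q : ℂ) • (coord m q p.1 * coord m q p.2) +
      (relCoef m q * metric m q p.1 p.2) • normSq m q :=
  act_Rhat_of_act_projA hq act_projA_coord p

section generic

variable {s : ℂ} {T T' : Matrix (Fin m × Fin m) (Fin m × Fin m) ℂ} {c : ℂ}
  (h : CalculusData q s T T' c)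

include h

/-- The two coordinates of the twofold Leibniz rule are joined by a cap: the snake identity gives
`1`, the partial trace of `T` gives `c⁻¹`, and pulling the cap through `T₁ T₂` restores `𝐱²`. -/
theorem polyPartial_normSq_mul (hq : 0 < q) (i : Fin m) (a : QPoly m q) :
    polyPartial q s T i (normSq m q * a) = (1 + s * c⁻¹) • (coord m q i * a) +
      s ^ 2 • (normSq m q * polyPartial q s T i a) := by
  set w : Fin m → QPoly m q := fun d => coord m q d * a with hw
  set u : Fin m × Fin m × Fin m → QPoly m q :=
    fun y => coord m q y.1 * (coord m q y.2.1 * polyPartial q s T y.2.2 a) with hu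
  have e : polyPartial q s T i (normSq m q * a) = act (cup23 m q).transpose
      (act (cup12 m q + s • (leg1 T * cup23 m q)) w + s ^ 2 • act (leg1 T * leg2 T) u) i := by
    rw [act_cap23, normSq_mul]
    simp only [map_sum, map_smul, polyPartial_coord_coord_mul h]
    rfl
  rw [e, act_vec_add, act_vec_smul, ← act_mul, ← act_mul, Matrix.mul_add, cap23_mul_cup12 hq,
    Matrix.mul_smul, h.cap23_leg1_cup23 hq, ← Matrix.mul_assoc, h.cap23_leg1_leg2, smul_smul,
    Pi.add_apply, Pi.smul_apply, act_cap12, act_add, act_smul, act_one, normSq_mul, add_smul,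
    one_smul]
  rfl

theorem polyPartial_polyPartial_coord_mul (i j k : Fin m) (a : QPoly m q) :
    polyPartial q s T i (polyPartial q s T j (coord m q k * a)) =
      (act (cup23 m q + s • (leg2 T * cup12 m q)) (fun d => polyPartial q s T d a) +
      s ^ 2 • act (leg2 T * leg1 T) (fun y => coord m q y.1 *
        polyPartial q s T y.2.1 (polyPartial q s T y.2.2 a))) (i, j, k) := by
  have h1 : (fun p : Fin m × Fin m => polyPartial q s T i (coord m q p.1 * polyPartial q s T p.2 a)) =
      (fun p : Fin m × Fin m => act (cup12 m q) (fun d => polyPartial q s T d a) (i, p.1, p.2)) +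
      s • (fun p : Fin m × Fin m => act (leg1 T) (fun y => coord m q y.1 *
        polyPartial q s T y.2.1 (polyPartial q s T y.2.2 a)) (i, p.1, p.2)) := by
    funext p
    simp only [Pi.add_apply, Pi.smul_apply, act_cup12, act_leg1, polyPartial_coord_mul h]
  rw [polyPartial_coord_mul h, map_add, map_smul, map_smul, act_map, h1, act_vec_add, act_vec_smul,
    act_add, act_smul, act_mul, act_mul, sq, mul_smul]
  simp only [Pi.add_apply, Pi.smul_apply, act_cup23, act_leg2, smul_add, add_assoc]

/-- The contraction of `polyPartial_normSq_mul` from the other side: the cap joins the two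
derivatives instead of the two coordinates. -/
theorem polyPartial_laplace_coord_mul (hq : 0 < q) (k : Fin m) (a : QPoly m q) :
    ∑ i, ∑ j, metric m q i j • polyPartial q s T i (polyPartial q s T j (coord m q k * a)) =
      (1 + s * c⁻¹) • polyPartial q s T k a + s ^ 2 • (coord m q k * ∑ i, ∑ j, metric m q i j •
        polyPartial q s T i (polyPartial q s T j a)) := by
  simp only [polyPartial_polyPartial_coord_mul h]
  rw [← act_cap12 (act (cup23 m q + s • (leg2 T * cup12 m q)) (fun d => polyPartial q s T d a) +
      s ^ 2 • act (leg2 T * leg1 T) (fun y => coord m q y.1 *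
        polyPartial q s T y.2.1 (polyPartial q s T y.2.2 a))) k, act_vec_add, act_vec_smul, ← act_mul, ← act_mul, Matrix.mul_add,
    cap12_mul_cup23 hq, Matrix.mul_smul, h.cap12_leg2_cup12 hq, ← Matrix.mul_assoc,
    h.cap12_leg2_leg1, smul_smul, Pi.add_apply, Pi.smul_apply, act_cap23, act_add, act_smul,
    act_one, add_smul, one_smul]
  simp only [Finset.mul_sum, mul_smul_comm]
  rfl

end generic

/-! #### The calculus without bars -/

theorem pd_eq (hq : 0 < q) (i : Fin m) : pd q i = polyPartial q (q : ℂ) (RhatInv m q) i := by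
  rw [pd, Rhat_inv hq]

theorem pd_one (hq : 0 < q) (i : Fin m) : pd q i 1 = 0 := by
  rw [pd_eq hq]; exact polyPartial_one (calculusData_pd hq) i

theorem pdBar_one (hq : 0 < q) (i : Fin m) : pdBar q i 1 = 0 :=
  polyPartial_one (calculusData_pdBar hq) i

theorem pd_coord_mul (hq : 0 < q) (i j : Fin m) (a : QPoly m q) :
    pd q i (coord m q j * a) = metric m q i j • a +
      (q : ℂ) • act (RhatInv m q) (fun p => coord m q p.1 * pd q p.2 a) (i, j) := by
  simp only [pd_eq hq]; exact polyPartial_coord_mul (calculusData_pd hq) i j a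

theorem pdBar_coord_mul (hq : 0 < q) (i j : Fin m) (a : QPoly m q) :
    pdBar q i (coord m q j * a) = metric m q i j • a +
      (q : ℂ)⁻¹ • act (Rhat m q) (fun p => coord m q p.1 * pdBar q p.2 a) (i, j) := by
  have := polyPartial_coord_mul (calculusData_pdBar (m := m) hq) i j a
  rw [← Complex.ofReal_inv]
  exact this

theorem one_add_q_mul (hq : 0 < q) :
    1 + (q : ℂ) * (q : ℂ) ^ (1 - (m : ℤ)) = (muConst m q : ℝ) := by
  have hq0 : (q : ℂ) ≠ 0 := by exact_mod_cast hq.ne'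
  rw [muConst_cast, show (2 - (m : ℤ)) = 1 + (1 - m) by ring, zpow_add₀ hq0, zpow_one]

theorem pd_normSq_mul (hq : 0 < q) (i : Fin m) (a : QPoly m q) :
    pd q i (normSq m q * a) = ((muConst m q : ℝ) : ℂ) • (coord m q i * a) +
      (q : ℂ) ^ 2 • (normSq m q * pd q i a) := by
  rw [pd_eq hq, polyPartial_normSq_mul (calculusData_pd hq) hq, inv_inv, one_add_q_mul hq]

theorem pdBar_normSq_mul (hq : 0 < q) (i : Fin m) (a : QPoly m q) :
    pdBar q i (normSq m q * a) = ((q : ℂ) ^ ((m : ℤ) - 2) * (muConst m q : ℝ)) • (coord m q i * a) +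
      ((q : ℂ) ^ 2)⁻¹ • (normSq m q * pdBar q i a) := by
  have hq0 : (q : ℂ) ≠ 0 := by exact_mod_cast hq.ne'
  have e : 1 + ((q⁻¹ : ℝ) : ℂ) * ((q : ℂ) ^ (1 - (m : ℤ)))⁻¹ =
      (q : ℂ) ^ ((m : ℤ) - 2) * (muConst m q : ℝ) := by
    rw [muConst_cast, mul_add, mul_one, ← zpow_add₀ hq0, ← zpow_neg, Complex.ofReal_inv,
      ← zpow_neg_one, ← zpow_add₀ hq0, show -1 + -(1 - (m : ℤ)) = m - 2 by ring,
      show (m : ℤ) - 2 + (2 - m) = 0 by ring, zpow_zero, add_comm]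
  rw [pdBar, polyPartial_normSq_mul (calculusData_pdBar hq) hq, e, Complex.ofReal_inv, inv_pow]

theorem laplace_apply (a : QPoly m q) :
    laplace m q a = ∑ i, ∑ j, metric m q i j • pd q i (pd q j a) := by
  simp [laplace]

theorem laplace_coord_mul (hq : 0 < q) (k : Fin m) (a : QPoly m q) :
    laplace m q (coord m q k * a) = ((muConst m q : ℝ) : ℂ) • pd q k a +
      (q : ℂ) ^ 2 • (coord m q k * laplace m q a) := by
  simp only [laplace_apply, pd_eq hq]
  rw [polyPartial_laplace_coord_mul (calculusData_pd hq) hq, inv_inv, one_add_q_mul hq]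

/-- The partial derivatives satisfy the commutation relations of the coordinates. -/
theorem act_projA_pd (hq : 0 < q) (a : QPoly m q) :
    act (projA m q) (fun p => pd q p.1 (pd q p.2 a)) = 0 := by
  have h := calculusData_pd (m := m) hq
  induction a using QPoly.induction_words with
  | one => simp only [pd_one hq, map_zero]; exact act_zero _
  | add a b ha hb =>
    simp only [map_add]
    have := congrArg₂ (· + ·) ha hb
    simp only [← act_vec_add, add_zero] at this
    exact this
  | smul c a ha =>
    simp only [map_smul]
    have := congrArg (c • ·) ha
    simp only [← act_vec_smul, smul_zero] at this
    exact this
  | mul k a ha =>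
    -- The mechanism of `polyStep_rel` again: the terms with one derivative left carry `1 + q R̂` on
    -- the first two places, and in the others `P_A` moves to the last two places, where the
    -- induction hypothesis applies.
    have e : act (leg1 (projA m q)) (act (cup23 m q + (q : ℂ) • (leg2 (RhatInv m q) * cup12 m q))
        (fun d => pd q d a) + (q : ℂ) ^ 2 • act (leg2 (RhatInv m q) * leg1 (RhatInv m q))
        (fun y => coord m q y.1 * pd q y.2.1 (pd q y.2.2 a))) = 0 := by
      rw [act_vec_add, act_vec_smul, ← act_mul, ← act_mul, h.zigzag'.symm, projA_braid_inv' hq, act_mul]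
      have e1 : cup23 m q + (q : ℂ) • (leg1 (Rhat m q) * cup23 m q) =
          leg1 (1 + (q : ℂ) • Rhat m q) * cup23 m q := by
        rw [leg1_add, leg1_one, leg1_smul, Matrix.add_mul, Matrix.one_mul, Matrix.smul_mul]
      have z : leg1 (0 : Matrix (Fin m × Fin m) (Fin m × Fin m) ℂ) = 0 := by
        ext x y; simp [leg1]
      have e2 : act (leg2 (projA m q)) (fun y => coord m q y.1 * pd q y.2.1 (pd q y.2.2 a)) = 0 := by
        funext ⟨b, c, d⟩
        rw [act_leg2]
        change act (projA m q) (fun p => coord m q b * pd q p.1 (pd q p.2 a)) (c, d) = 0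
        rw [← mul_act (projA m q) (fun p => pd q p.1 (pd q p.2 a)), ha]
        simp
      rw [e1, ← act_mul, ← Matrix.mul_assoc, ← leg1_mul, projA_mul_one_add_Rhat hq, z, Matrix.zero_mul,
        act_zero_mat, act_mul, e2, act_zero, smul_zero, add_zero]
    funext p
    have e' := congrFun e (p.1, p.2, k)
    rw [act_leg1] at e'
    simp only [pd_eq hq, polyPartial_polyPartial_coord_mul h] at e' ⊢
    exact e'

theorem relCoef_mul (hq : 0 < q) :
    relCoef m q * ((q : ℂ) ^ (1 - (m : ℤ)))⁻¹ = (1 - (q : ℂ) ^ 2) / (muConst m q : ℝ) := by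
  have hq0 : (q : ℂ) ^ (1 - (m : ℤ)) ≠ 0 := zpow_ne_zero _ (by exact_mod_cast hq.ne')
  have hmu : ((muConst m q : ℝ) : ℂ) ≠ 0 := by exact_mod_cast (muConst_pos hq).ne'
  rw [relCoef]
  field_simp

theorem act_RhatInv_metric (hq : 0 < q) (p : Fin m × Fin m) :
    act (RhatInv m q) (fun p => metric m q p.1 p.2) p =
      ((q : ℂ) ^ (1 - (m : ℤ)))⁻¹ * metric m q p.1 p.2 := by
  have hq0 : (q : ℂ) ^ (1 - (m : ℤ)) ≠ 0 := zpow_ne_zero _ (by exact_mod_cast hq.ne')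
  have e : act (Rhat m q) (fun p => metric m q p.1 p.2) =
      (q : ℂ) ^ (1 - (m : ℤ)) • fun p => metric m q p.1 p.2 := by
    funext ⟨a, b⟩
    exact act_Rhat_metric hq a b
  have e2 := congrFun (congrArg (act (RhatInv m q)) e) p
  rw [← act_mul, RhatInv_mul_Rhat hq, act_one, act_vec_smul, Pi.smul_apply, smul_eq_mul] at e2
  rw [e2, inv_mul_cancel_left₀ hq0]

theorem act_RhatInv_pd (hq : 0 < q) (a : QPoly m q) (p : Fin m × Fin m) :
    (q : ℂ) • act (RhatInv m q) (fun p => pd q p.1 (pd q p.2 a)) p = pd q p.1 (pd q p.2 a) -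
      ((1 - (q : ℂ) ^ 2) / (muConst m q : ℝ) * metric m q p.1 p.2) • laplace m q a := by
  have e : act (Rhat m q) (fun p => pd q p.1 (pd q p.2 a)) =
      (q : ℂ) • (fun p => pd q p.1 (pd q p.2 a)) +
      relCoef m q • fun p => metric m q p.1 p.2 • laplace m q a := by
    funext p
    rw [act_Rhat_of_act_projA hq (act_projA_pd hq a), ← laplace_apply, mul_smul]
    rfl
  have e2 := congrFun (congrArg (act (RhatInv m q)) e) p
  rw [← act_mul, RhatInv_mul_Rhat hq, act_one, act_vec_add, act_vec_smul, act_vec_smul] at e2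
  have e3 : act (RhatInv m q) (fun p => metric m q p.1 p.2 • laplace m q a) p =
      (((q : ℂ) ^ (1 - (m : ℤ)))⁻¹ * metric m q p.1 p.2) • laplace m q a := by
    rw [← act_RhatInv_metric hq p]
    simp [act, Finset.sum_smul, smul_smul]
  rw [e2, Pi.add_apply, Pi.smul_apply, Pi.smul_apply, e3, smul_smul, ← mul_assoc, relCoef_mul hq,
    add_sub_cancel_right]

/-- The Laplace operator commutes with the partial derivatives. -/
theorem laplace_pd (hq : 0 < q) (a : QPoly m q) (j : Fin m) :
    laplace m q (pd q j a) = pd q j (laplace m q a) := by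
  have hmu : ((muConst m q : ℝ) : ℂ) ≠ 0 := by exact_mod_cast (muConst_pos hq).ne'
  have h1 : laplace m q 1 = 0 := by simp [laplace_apply, pd_one hq]
  induction a using QPoly.induction_words generalizing j with
  | one => rw [pd_one hq, h1, map_zero, map_zero]
  | add a b ha hb => simp only [map_add, ha, hb]
  | smul c a ha => simp only [map_smul, ha]
  | mul k a ha =>
    have e1 : act (RhatInv m q) (fun p => laplace m q (coord m q p.1 * pd q p.2 a)) (j, k) =
        ((muConst m q : ℝ) : ℂ) • act (RhatInv m q) (fun p => pd q p.1 (pd q p.2 a)) (j, k) +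
        (q : ℂ) ^ 2 • act (RhatInv m q) (fun p => coord m q p.1 * pd q p.2 (laplace m q a)) (j, k) := by
      have f : (fun p : Fin m × Fin m => laplace m q (coord m q p.1 * pd q p.2 a)) =
          ((muConst m q : ℝ) : ℂ) • (fun p : Fin m × Fin m => pd q p.1 (pd q p.2 a)) +
          (q : ℂ) ^ 2 • (fun p : Fin m × Fin m => coord m q p.1 * pd q p.2 (laplace m q a)) := by
        funext p
        simp only [laplace_coord_mul hq, ha, Pi.add_apply, Pi.smul_apply]
      rw [f, act_vec_add, act_vec_smul, act_vec_smul, Pi.add_apply, Pi.smul_apply, Pi.smul_apply]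
    -- The term `C^{jk} Δ a` occurs with coefficient `1` on one side and `q²` on the other;
    -- `act_RhatInv_pd` supplies the difference `1 - q²`.
    rw [pd_coord_mul hq, map_add, map_smul, map_smul, act_map, e1, laplace_coord_mul hq, map_add,
      map_smul, map_smul, pd_coord_mul hq, smul_add, smul_comm (q : ℂ), act_RhatInv_pd hq]
    match_scalars <;> field_simp
    ring

/-- `x^i C_{ij} ∂^j`. -/
def euler (a : QPoly m q) : QPoly m q :=
  ∑ i, ∑ j, metric m q i j • (coord m q i * pd q j a)

theorem sum_metric_metric_smul (hq : 0 < q) {M : Type*} [AddCommGroup M] [Module ℂ M] (i : Fin m)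
    (v : Fin m → M) : ∑ j, ∑ k, metric m q i j • metric m q j k • v k = v i := by
  have : ∀ j, ∑ k, metric m q i j • metric m q j k • v k =
      metric m q i j • wt m q (Fin.rev j) • v (Fin.rev j) := by
    intro j
    rw [← Finset.smul_sum, sum_metric_smul]
  simp only [this]
  rw [sum_metric_smul i (fun j => wt m q (Fin.rev j) • v (Fin.rev j)), Fin.rev_rev, smul_smul,
    mul_comm, wt_mul_rev hq, one_smul]

/-- The crossing symmetry in the form that trades `R̂⁻¹` between a derivative and a coordinate for
`R̂` between two coordinates. -/
theorem RhatInv_partial_transpose (hq : 0 < q) (i j a b : Fin m) :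
    ∑ l, metric m q i l * RhatInv m q (l, j) (a, b) =
      ∑ c, Rhat m q (j, c) (i, a) * metric m q c b := by
  have h := RhatInv_crossing hq (Fin.rev i) j a b
  rw [Fin.rev_rev] at h
  have hb := wt_mul_rev hq b
  have hi := wt_mul_rev hq i
  simp only [metric_apply (m := m) q i, metric_apply' (m := m) (q := q) _ b, ite_mul, mul_ite,
    zero_mul, mul_zero, Finset.sum_ite_eq', Finset.mem_univ, if_true]
  linear_combination (wt m q (Fin.rev i) * wt m q b) * h -
    wt m q (Fin.rev i) * RhatInv m q (Fin.rev i, j) (a, b) * hb +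
    wt m q b * Rhat m q (j, Fin.rev b) (i, a) * hi

/-- Once `R̂` acts on a product of two coordinates, the commutation relations evaluate it; their
metric term produces `𝐱² ∂^j`. -/
theorem euler_coord_mul (hq : 0 < q) (j : Fin m) (a : QPoly m q) :
    euler (coord m q j * a) = coord m q j * a + (q : ℂ) ^ 2 • (coord m q j * euler a) +
      ((q : ℂ) * relCoef m q) • (normSq m q * pd q j a) := by
  have e0 : euler (coord m q j * a) = ∑ i, ∑ l, metric m q i l • metric m q l j • (coord m q i * a) +
      (q : ℂ) • ∑ i, ∑ l, metric m q i l • act (RhatInv m q)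
        (fun p => coord m q i * (coord m q p.1 * pd q p.2 a)) (l, j) := by
    simp only [euler, pd_coord_mul hq, mul_add, mul_smul_comm, smul_add, Finset.sum_add_distrib,
      mul_act, Finset.smul_sum, smul_comm (q : ℂ)]
  have e1 : ∑ i, ∑ l, metric m q i l • metric m q l j • (coord m q i * a) = coord m q j * a := by
    have hs : ∀ i l, metric m q i l • metric m q l j • (coord m q i * a) =
        (metric m q i l * metric m q l j) • (coord m q i * a) := fun i l => smul_smul _ _ _
    have hc : ∀ i, ∑ l, metric m q i l * metric m q l j = if i = j then 1 else 0 := by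
      intro i
      have := sum_metric_metric_smul hq i (fun k => if k = j then (1 : ℂ) else 0)
      simpa using this
    simp only [hs, ← Finset.sum_smul, hc]
    simp
  have e2 : ∑ i, ∑ l, metric m q i l • act (RhatInv m q)
        (fun p => coord m q i * (coord m q p.1 * pd q p.2 a)) (l, j) =
      ∑ c, ∑ b, metric m q c b • (act (Rhat m q) (fun p => coord m q p.1 * coord m q p.2) (j, c) *
        pd q b a) := by
    have l1 : ∀ i, ∑ l, metric m q i l • act (RhatInv m q)
        (fun p => coord m q i * (coord m q p.1 * pd q p.2 a)) (l, j) =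
        ∑ p : Fin m × Fin m, (∑ l, metric m q i l * RhatInv m q (l, j) p) •
          (coord m q i * (coord m q p.1 * pd q p.2 a)) := by
      intro i
      simp only [act, Finset.smul_sum, smul_smul, Finset.sum_smul]
      exact Finset.sum_comm
    have l2 : ∀ g : Fin m → Fin m → Fin m → Fin m → QPoly m q,
        ∑ i, ∑ x, ∑ b, ∑ c, g i x b c = ∑ c, ∑ b, ∑ i, ∑ x, g i x b c := by
      intro g
      calc ∑ i, ∑ x, ∑ b, ∑ c, g i x b c = ∑ i, ∑ x, ∑ c, ∑ b, g i x b c :=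
            Finset.sum_congr rfl fun i _ => Finset.sum_congr rfl fun x _ => Finset.sum_comm
        _ = ∑ i, ∑ c, ∑ x, ∑ b, g i x b c := Finset.sum_congr rfl fun i _ => Finset.sum_comm
        _ = ∑ c, ∑ i, ∑ x, ∑ b, g i x b c := Finset.sum_comm
        _ = ∑ c, ∑ i, ∑ b, ∑ x, g i x b c := Finset.sum_congr rfl fun c _ =>
            Finset.sum_congr rfl fun i _ => Finset.sum_comm
        _ = ∑ c, ∑ b, ∑ i, ∑ x, g i x b c := Finset.sum_congr rfl fun c _ => Finset.sum_comm
    have l3 := l2 fun i x b c => (Rhat m q (j, c) (i, x) * metric m q c b) •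
      (coord m q i * (coord m q x * pd q b a))
    have l4 : ∀ c b, metric m q c b • (act (Rhat m q) (fun p => coord m q p.1 * coord m q p.2) (j, c) *
        pd q b a) = ∑ i, ∑ x, (Rhat m q (j, c) (i, x) * metric m q c b) •
          (coord m q i * (coord m q x * pd q b a)) := by
      intro c b
      rw [act_mul_right, act, Fintype.sum_prod_type, Finset.smul_sum]
      refine Finset.sum_congr rfl fun i _ => ?_
      rw [Finset.smul_sum]
      refine Finset.sum_congr rfl fun x _ => ?_
      rw [smul_smul, mul_comm (metric m q c b), mul_assoc]
    simp only [l4, ← l3, l1, Fintype.sum_prod_type]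
    refine Finset.sum_congr rfl fun i _ => Finset.sum_congr rfl fun x _ =>
      Finset.sum_congr rfl fun b _ => ?_
    rw [RhatInv_partial_transpose hq, Finset.sum_smul]
  rw [e0, e1, e2]
  simp only [act_Rhat_coord hq, add_mul, smul_add, Finset.sum_add_distrib, smul_mul_assoc]
  have e3 : ∑ c, ∑ b, metric m q c b • (relCoef m q * metric m q j c) • (normSq m q * pd q b a) =
      relCoef m q • (normSq m q * pd q j a) := by
    rw [← sum_metric_metric_smul hq j (fun b => relCoef m q • (normSq m q * pd q b a))]
    refine Finset.sum_congr rfl fun c _ => Finset.sum_congr rfl fun b _ => ?_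
    simp only [smul_smul]
    congr 1
    ring
  have e4 : ∑ c, ∑ b, metric m q c b • (q : ℂ) • (coord m q j * coord m q c * pd q b a) =
      (q : ℂ) • (coord m q j * euler a) := by
    simp only [euler, Finset.mul_sum, mul_smul_comm, Finset.smul_sum, smul_comm (q : ℂ), mul_assoc]
  rw [e3, e4]
  module

/-- The square of the norm is central. -/
theorem normSq_mul_coord (hq : 0 < q) (i : Fin m) :
    normSq m q * coord m q i = coord m q i * normSq m q := by
  have hq0 : (q : ℂ) ≠ 0 := by exact_mod_cast hq.ne'
  have hmu : ((muConst m q : ℝ) : ℂ) ≠ 0 := by exact_mod_cast (muConst_pos hq).ne'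
  have h := braiding_Rhat (m := m) hq
  set t : Fin m × Fin m × Fin m → QPoly m q :=
    fun y => coord m q y.1 * (coord m q y.2.1 * coord m q y.2.2) with ht
  have t1 : act (cup12 m q).transpose t i = normSq m q * coord m q i := by
    rw [act_cap12, normSq_mul]
  have t2 : act (cup23 m q).transpose t i = coord m q i * normSq m q := by
    rw [act_cap23, mul_normSq]
  have r2 : act (leg2 (Rhat m q)) t = (q : ℂ) • t +
      relCoef m q • act (cup23 m q) (fun d => coord m q d * normSq m q) := by
    funext ⟨a, b, c⟩
    rw [act_leg2, Pi.add_apply, Pi.smul_apply, Pi.smul_apply, act_cup23]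
    simp only [ht]
    rw [← mul_act (Rhat m q) (fun p => coord m q p.1 * coord m q p.2), act_Rhat_coord hq, mul_add,
      mul_smul_comm, mul_smul_comm, mul_smul]
  have r1 : act (leg1 (Rhat m q)) t = (q : ℂ) • t +
      relCoef m q • act (cup12 m q) (fun d => normSq m q * coord m q d) := by
    funext ⟨a, b, c⟩
    rw [act_leg1, Pi.add_apply, Pi.smul_apply, Pi.smul_apply, act_cup12]
    simp only [ht, ← mul_assoc]
    rw [← act_mul_right (Rhat m q) (fun p => coord m q p.1 * coord m q p.2), act_Rhat_coord hq,
      add_mul, smul_mul_assoc, smul_mul_assoc, mul_smul]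
  have e := t1
  -- The cap on the first two places equals the cap on the last two after two crossings. Evaluating
  -- both crossings on the coordinates yields a linear relation between the two orders of the
  -- product, whose coefficients agree and do not vanish (`k1`, `k2`, `k3`).
  rw [← h.cap23_leg1_leg2, act_mul, r2, act_vec_add, act_vec_smul, act_vec_smul, ← act_mul,
    Matrix.mul_assoc, h.cap23_leg1_cup23 hq, act_mul, r1, act_vec_add, act_vec_smul, act_vec_smul,
    ← act_mul, cap23_mul_cup12 hq, act_one, act_smul, act_one] at e
  simp only [Pi.add_apply, Pi.smul_apply, t2] at e
  have k1 : (1 - (q : ℂ) * relCoef m q) = (1 + (q : ℂ) ^ 2 * (q : ℂ) ^ (2 - (m : ℤ))) / (muConst m q : ℝ) := by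
    rw [relCoef, eq_div_iff hmu, sub_mul, one_mul, ← mul_div_assoc, div_mul_cancel₀ _ hmu,
      muConst_cast, show (2 - (m : ℤ)) = 1 + (1 - m) by ring, zpow_add₀ hq0, zpow_one]
    ring
  have k2 : (q : ℂ) ^ 2 + relCoef m q * ((q : ℂ) ^ (1 - (m : ℤ)))⁻¹ =
      (1 + (q : ℂ) ^ 2 * (q : ℂ) ^ (2 - (m : ℤ))) / (muConst m q : ℝ) := by
    rw [relCoef_mul hq, eq_div_iff hmu, add_mul, div_mul_cancel₀ _ hmu, muConst_cast]
    ring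
  have k3 : (1 + (q : ℂ) ^ 2 * (q : ℂ) ^ (2 - (m : ℤ))) / (muConst m q : ℝ) ≠ 0 := by
    refine div_ne_zero ?_ hmu
    have : (0 : ℝ) < 1 + q ^ 2 * q ^ (2 - (m : ℤ)) := by positivity
    have h2 : ((1 + q ^ 2 * q ^ (2 - (m : ℤ)) : ℝ) : ℂ) ≠ 0 := by exact_mod_cast this.ne'
    push_cast at h2
    exact h2
  have e5 : (1 - (q : ℂ) * relCoef m q) • (normSq m q * coord m q i) =
      ((q : ℂ) ^ 2 + relCoef m q * ((q : ℂ) ^ (1 - (m : ℤ)))⁻¹) • (coord m q i * normSq m q) := by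
    have k4 : (1 - (q : ℂ) * relCoef m q) • (normSq m q * coord m q i) = normSq m q * coord m q i -
        ((q : ℂ) * relCoef m q) • (normSq m q * coord m q i) := by module
    rw [k4, sub_eq_iff_eq_add]
    refine e.symm.trans ?_
    module
  rw [k1, k2] at e5
  exact smul_right_injective _ k3 e5

theorem normSq_commute (hq : 0 < q) (a : QPoly m q) : Commute (normSq m q) a := by
  induction a using QPoly.induction_words with
  | one => exact Commute.one_right _
  | add a b ha hb => exact ha.add_right hb
  | smul c a ha => exact ha.smul_right c
  | mul j a ha => exact Commute.mul_right (normSq_mul_coord hq j) ha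

variable (q) in
/-- The `q²`-number `[k]` of a natural number as a complex number. -/
def qn (k : ℕ) : ℂ := ((q : ℂ) ^ (2 * k) - 1) / ((q : ℂ) ^ 2 - 1)

theorem sq_sub_one_ne_zero (hq : 0 < q) (hq1 : q < 1) : (q : ℂ) ^ 2 - 1 ≠ 0 := by
  have : q ^ 2 - 1 < 0 := by nlinarith
  have h : ((q ^ 2 - 1 : ℝ) : ℂ) ≠ 0 := by exact_mod_cast this.ne
  push_cast at h
  exact h

theorem laplace_one (hq : 0 < q) : laplace m q 1 = 0 := by simp [laplace_apply, pd_one hq]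

theorem euler_add (a b : QPoly m q) : euler (a + b) = euler a + euler b := by
  simp [euler, mul_add, Finset.sum_add_distrib]

theorem euler_smul (c : ℂ) (a : QPoly m q) : euler (c • a) = c • euler a := by
  simp only [euler, map_smul, mul_smul_comm, Finset.smul_sum, smul_comm c]

/-- The coefficient of `𝐱² Δ` is forced by induction: when a coordinate is multiplied on, the term
`𝐱² ∂^j` of `euler_coord_mul` must match the term `μ ∂^j` produced by `Δ`. -/
theorem euler_homog (hq : 0 < q) (hq1 : q < 1) {k : ℕ} {a : QPoly m q} (ha : a ∈ homog m q k) :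
    euler a = qn q k • a + ((q : ℂ) * relCoef m q / (muConst m q : ℝ)) •
      (normSq m q * laplace m q a) := by
  have hmu : ((muConst m q : ℝ) : ℂ) ≠ 0 := by exact_mod_cast (muConst_pos hq).ne'
  have hs := sq_sub_one_ne_zero hq hq1
  induction ha using homog_induction with
  | one => simp [euler, pd_one hq, laplace_one hq, qn]
  | zero => simp [euler]
  | add k a b _ _ ha hb => rw [euler_add, ha, hb, map_add, mul_add]; module
  | smul k c a _ ha => rw [euler_smul, ha, map_smul, mul_smul_comm]; module
  | mul k j a _ _ ha =>
    rw [euler_coord_mul hq, ha, laplace_coord_mul hq, mul_add, mul_add, mul_smul_comm, mul_smul_comm,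
      mul_smul_comm, mul_smul_comm, ← mul_assoc (normSq m q) (coord m q j), normSq_mul_coord hq,
      mul_assoc (coord m q j)]
    have hk : qn q (k + 1) = 1 + (q : ℂ) ^ 2 * qn q k := by
      unfold qn; field_simp; ring
    rw [hk]
    match_scalars <;> field_simp

/-- The skein relation applied to the metric, a common eigenvector of `R̂` and `R̂⁻¹`, determines
its norm. The index `j` provides a nonzero entry by which to divide. -/
theorem sum_metric_sq (hq : 0 < q) (hq1 : q < 1) (j : Fin m) :
    ∑ i, ∑ l, metric m q i l * metric m q i l =
      ((muConst m q : ℝ) : ℂ) * (((q : ℂ) ^ m - 1) / ((q : ℂ) ^ 2 - 1)) := by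
  have hq0 : (q : ℂ) ≠ 0 := by exact_mod_cast hq.ne'
  have hs := sq_sub_one_ne_zero hq hq1
  have h := act_RhatInv_metric hq (j, Fin.rev j)
  rw [RhatInv_eq hq, act_sub, act_smul, act_sub, act_one] at h
  simp only [Pi.sub_apply, Pi.smul_apply, act_traceProj, act_Rhat_metric hq, smul_eq_mul] at h
  have hm : metric m q j (Fin.rev j) ≠ 0 := by
    rw [metric_apply, if_pos rfl]; exact wt_ne_zero hq _
  set S := ∑ i, ∑ l, metric m q i l * metric m q i l
  have h2 : (q : ℂ) ^ (1 - (m : ℤ)) - ((q : ℂ) - (q : ℂ)⁻¹) * (1 - S) =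
      ((q : ℂ) ^ (1 - (m : ℤ)))⁻¹ := by
    refine mul_right_cancel₀ hm ?_
    rw [← h]; ring
  have e1 : (q : ℂ) ^ (1 - (m : ℤ)) = q / (q : ℂ) ^ m := by
    rw [zpow_sub₀ hq0, zpow_one, zpow_natCast]
  have e2 : (q : ℂ) ^ (2 - (m : ℤ)) = (q : ℂ) ^ 2 / (q : ℂ) ^ m := by
    rw [zpow_sub₀ hq0, zpow_natCast]; norm_cast
  rw [e1] at h2
  rw [muConst_cast, e2, ← mul_div_assoc, eq_div_iff hs]
  have hqm : (q : ℂ) ^ m ≠ 0 := pow_ne_zero _ hq0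
  field_simp at h2 ⊢
  linear_combination h2

/-- Moving `Δ` past the two coordinates of `𝐱²` leaves two Euler operators. By `euler_homog` they
contribute numbers, which combine to `[k + m/2]`, and multiples of `𝐱² Δ`, which lower the
coefficient `q⁴` to `q²`. -/
theorem laplace_normSq_mul (hq : 0 < q) (hq1 : q < 1) (i₀ : Fin m) {k : ℕ} {a : QPoly m q}
    (ha : a ∈ homog m q k) : laplace m q (normSq m q * a) =
      (((muConst m q : ℝ) : ℂ) ^ 2 * (((q : ℂ) ^ (2 * k + m) - 1) / ((q : ℂ) ^ 2 - 1))) • a +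
      (q : ℂ) ^ 2 • (normSq m q * laplace m q a) := by
  have hq0 : (q : ℂ) ≠ 0 := by exact_mod_cast hq.ne'
  have hmu : ((muConst m q : ℝ) : ℂ) ≠ 0 := by exact_mod_cast (muConst_pos hq).ne'
  have hs := sq_sub_one_ne_zero hq hq1
  have e1 : ∑ j, ∑ k, metric m q j k • pd q j (coord m q k * a) =
      (((muConst m q : ℝ) : ℂ) * (((q : ℂ) ^ m - 1) / ((q : ℂ) ^ 2 - 1))) • a +
      ((q : ℂ) * ((q : ℂ) ^ (1 - (m : ℤ)))⁻¹) • euler a := by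
    have hcap : ∀ p : Fin m × Fin m, ∑ j, ∑ k, metric m q j k * RhatInv m q (j, k) p =
        ((q : ℂ) ^ (1 - (m : ℤ)))⁻¹ * metric m q p.1 p.2 := by
      intro p
      rw [← act_RhatInv_metric hq p, act, Fintype.sum_prod_type]
      refine Finset.sum_congr rfl fun j _ => Finset.sum_congr rfl fun k _ => ?_
      rw [smul_eq_mul, mul_comm]
      congr 1
      exact congrFun (congrFun (RhatInv_symm hq) p) (j, k)
    simp only [pd_coord_mul hq, smul_add, Finset.sum_add_distrib, smul_smul, ← Finset.sum_smul,
      sum_metric_sq hq hq1 i₀]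
    congr 1
    have : ∑ j, ∑ k, (metric m q j k * (q : ℂ)) • act (RhatInv m q)
        (fun p => coord m q p.1 * pd q p.2 a) (j, k) = ∑ p : Fin m × Fin m,
        ((q : ℂ) * ∑ j, ∑ k, metric m q j k * RhatInv m q (j, k) p) •
          (coord m q p.1 * pd q p.2 a) := by
      simp only [act, Finset.smul_sum, Finset.mul_sum, Finset.sum_smul, smul_smul]
      rw [Finset.sum_congr rfl fun j _ => Finset.sum_comm, Finset.sum_comm]
      refine Finset.sum_congr rfl fun p _ => Finset.sum_congr rfl fun j _ =>
        Finset.sum_congr rfl fun k _ => ?_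
      congr 1
      ring
    rw [this]
    simp only [hcap, Fintype.sum_prod_type, euler, Finset.smul_sum, smul_smul, mul_assoc]
  have e2 : laplace m q (normSq m q * a) = ((muConst m q : ℝ) : ℂ) •
      (∑ j, ∑ k, metric m q j k • pd q j (coord m q k * a)) +
      ((q : ℂ) ^ 2 * ((muConst m q : ℝ) : ℂ)) • euler a +
      (q : ℂ) ^ 4 • (normSq m q * laplace m q a) := by
    simp only [normSq_mul, map_sum, map_smul, laplace_coord_mul hq, mul_add, mul_smul_comm, smul_add,
      Finset.sum_add_distrib, euler, Finset.smul_sum, smul_smul]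
    rw [add_assoc]
    congr 1
    · refine Finset.sum_congr rfl fun j _ => Finset.sum_congr rfl fun k _ => ?_
      congr 1; ring
    · congr 1 <;> refine Finset.sum_congr rfl fun j _ => Finset.sum_congr rfl fun k _ => ?_ <;>
      · congr 1; ring
  have e3 : (q : ℂ) ^ (1 - (m : ℤ)) = q / (q : ℂ) ^ m := by
    rw [zpow_sub₀ hq0, zpow_one, zpow_natCast]
  have e4 : (q : ℂ) ^ (2 - (m : ℤ)) = (q : ℂ) ^ 2 / (q : ℂ) ^ m := by
    rw [zpow_sub₀ hq0, zpow_natCast]; norm_cast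
  have hqm : (q : ℂ) ^ m ≠ 0 := pow_ne_zero _ hq0
  have e5 : ((muConst m q : ℝ) : ℂ) * (q : ℂ) ^ m = (q : ℂ) ^ m + (q : ℂ) ^ 2 := by
    rw [muConst_cast, e4]; field_simp
  rw [e2, e1, euler_homog hq hq1 ha, relCoef, qn, e3]
  set μ := ((muConst m q : ℝ) : ℂ)
  match_scalars
  · field_simp
    ring_nf
    linear_combination (1 - (q : ℂ) ^ (k * 2)) * e5
  · field_simp
    linear_combination ((q : ℂ) ^ 2 - 1) * e5

/-- The relation between the two calculi. -/
theorem pdBar_homog (hq : 0 < q) (hq1 : q < 1) {k : ℕ} {a : QPoly m q} (ha : a ∈ homog m q k)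
    (i : Fin m) : (q : ℂ) ^ (2 * k) • pdBar q i a = (q : ℂ) ^ 2 • (pd q i a +
      (((q : ℂ) ^ 2 - 1) / (muConst m q : ℝ)) • (coord m q i * laplace m q a)) := by
  have hq0 : (q : ℂ) ≠ 0 := by exact_mod_cast hq.ne'
  have hmu : ((muConst m q : ℝ) : ℂ) ≠ 0 := by exact_mod_cast (muConst_pos hq).ne'
  have hs := sq_sub_one_ne_zero hq hq1
  induction ha using homog_induction generalizing i with
  | one => simp [pd_one hq, pdBar_one hq, laplace_one hq]
  | zero => simp
  | add k a b _ _ ha hb => simp only [map_add, mul_add, smul_add, ha, hb]; module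
  | smul k c a _ ha =>
    rw [map_smul, smul_comm, ha, map_smul, map_smul, mul_smul_comm]; module
  | mul k j a hk _ ha =>
    have e1 : act (Rhat m q) (fun p => coord m q p.1 * ((q : ℂ) ^ (2 * k) • pdBar q p.2 a)) (i, j) =
        (q : ℂ) ^ 2 • (act (RhatInv m q) (fun p => coord m q p.1 * pd q p.2 a) (i, j) +
          ((q : ℂ) - (q : ℂ)⁻¹) • (coord m q i * pd q j a - metric m q i j • euler a) +
          (((q : ℂ) ^ 2 - 1) / (muConst m q : ℝ)) • ((q : ℂ) • (coord m q i * (coord m q j *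
            laplace m q a)) + (relCoef m q * metric m q i j) • (normSq m q * laplace m q a))) := by
      have f1 : (fun p : Fin m × Fin m => coord m q p.1 * ((q : ℂ) ^ (2 * k) • pdBar q p.2 a)) =
          (q : ℂ) ^ 2 • ((fun p : Fin m × Fin m => coord m q p.1 * pd q p.2 a) +
          (((q : ℂ) ^ 2 - 1) / (muConst m q : ℝ)) •
            fun p : Fin m × Fin m => coord m q p.1 * coord m q p.2 * laplace m q a) := by
        funext p
        simp only [ha, Pi.smul_apply, Pi.add_apply, mul_smul_comm, mul_add, mul_assoc]
      -- The skein relation passes from one calculus to the other: its identity part gives `x^i ∂^j`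
      -- and its trace part the Euler operator.
      have f2 : Rhat m q = RhatInv m q + ((q : ℂ) - (q : ℂ)⁻¹) • (1 - traceProj m q) := by
        rw [RhatInv_eq hq]; abel
      rw [f1, act_vec_smul, act_vec_add, act_vec_smul, Pi.smul_apply, Pi.add_apply, Pi.smul_apply,
        ← act_mul_right, act_Rhat_coord hq, f2, act_add, act_smul, act_sub, act_one, Pi.add_apply,
        Pi.smul_apply, Pi.sub_apply, act_traceProj, add_mul, smul_mul_assoc, smul_mul_assoc,
        mul_assoc]
      rfl
    have e2 : act (Rhat m q) (fun p => coord m q p.1 * ((q : ℂ) ^ (2 * k) • pdBar q p.2 a)) (i, j) =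
        (q : ℂ) ^ (2 * k) • act (Rhat m q) (fun p => coord m q p.1 * pdBar q p.2 a) (i, j) := by
      have f : (fun p : Fin m × Fin m => coord m q p.1 * ((q : ℂ) ^ (2 * k) • pdBar q p.2 a)) =
          (q : ℂ) ^ (2 * k) • (fun p : Fin m × Fin m => coord m q p.1 * pdBar q p.2 a) := by
        funext p
        simp only [mul_smul_comm, Pi.smul_apply]
      rw [f, act_vec_smul, Pi.smul_apply]
    have e3 : (q : ℂ) ^ (2 * (k + 1)) • pdBar q i (coord m q j * a) =
        ((q : ℂ) ^ (2 * (k + 1)) * metric m q i j) • a + (q : ℂ) • ((q : ℂ) ^ (2 * k) •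
          act (Rhat m q) (fun p => coord m q p.1 * pdBar q p.2 a) (i, j)) := by
      rw [pdBar_coord_mul hq]
      match_scalars <;> field_simp
      ring
    rw [e3, ← e2, e1, pd_coord_mul hq, laplace_coord_mul hq, euler_homog hq hq1 hk, qn]
    simp only [mul_add, mul_smul_comm]
    match_scalars <;> field_simp <;> ring

/-! #### Degrees -/

theorem coord_mem_homog (i : Fin m) : coord m q i ∈ homog m q 1 := by
  rw [homog, pow_one]; exact Submodule.subset_span ⟨i, rfl⟩

theorem mul_mem_homog {k l : ℕ} {a b : QPoly m q} (ha : a ∈ homog m q k) (hb : b ∈ homog m q l) :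
    a * b ∈ homog m q (k + l) := by
  rw [homog, pow_add]; exact Submodule.mul_mem_mul ha hb

theorem coord_mul_mem_homog (i : Fin m) {k : ℕ} {a : QPoly m q} (ha : a ∈ homog m q k) :
    coord m q i * a ∈ homog m q (k + 1) := by
  rw [add_comm]; exact mul_mem_homog (coord_mem_homog i) ha

theorem normSq_mem_homog : normSq m q ∈ homog m q 2 :=
  Submodule.sum_mem _ fun i _ => Submodule.sum_mem _ fun j _ => Submodule.smul_mem _ _
    (mul_mem_homog (coord_mem_homog i) (coord_mem_homog j))

theorem act_mem {κ ι : Type*} [Fintype κ] (T : Matrix ι κ ℂ) (u : κ → QPoly m q)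
    (W : Submodule ℂ (QPoly m q)) (hu : ∀ j, u j ∈ W) (i : ι) : act T u i ∈ W :=
  Submodule.sum_mem _ fun j _ => Submodule.smul_mem _ _ (hu j)

/-- Since `k - 1` is truncated, degree `0` needs the separate first clause, which the induction uses
to pass to degree `1`. -/
theorem polyPartial_mem {s : ℂ} {T T' : Matrix (Fin m × Fin m) (Fin m × Fin m) ℂ} {c : ℂ}
    (h : CalculusData q s T T' c) {k : ℕ} {a : QPoly m q} (ha : a ∈ homog m q k) (i : Fin m) :
    (k = 0 → polyPartial q s T i a = 0) ∧ polyPartial q s T i a ∈ homog m q (k - 1) := by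
  induction ha using homog_induction generalizing i with
  | one => rw [polyPartial_one h]; exact ⟨fun _ => rfl, Submodule.zero_mem _⟩
  | zero => rw [map_zero]; exact ⟨fun _ => rfl, Submodule.zero_mem _⟩
  | add k a b _ _ ha hb =>
    rw [map_add]
    exact ⟨fun hk => by rw [(ha i).1 hk, (hb i).1 hk, add_zero], Submodule.add_mem _ (ha i).2 (hb i).2⟩
  | smul k c a _ ha =>
    rw [map_smul]
    exact ⟨fun hk => by rw [(ha i).1 hk, smul_zero], Submodule.smul_mem _ _ (ha i).2⟩
  | mul k j a hk _ ha =>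
    refine ⟨fun hk => by omega, ?_⟩
    rw [polyPartial_coord_mul h, Nat.add_sub_cancel]
    refine Submodule.add_mem _ (Submodule.smul_mem _ _ hk) (Submodule.smul_mem _ _ (act_mem _ _ _ ?_ _))
    intro p
    rcases Nat.eq_zero_or_pos k with h0 | h0
    · rw [(ha p.2).1 h0, mul_zero]; exact Submodule.zero_mem _
    · have := coord_mul_mem_homog p.1 (ha p.2).2
      rwa [Nat.sub_add_cancel h0] at this

theorem pd_mem_homog (hq : 0 < q) {k : ℕ} {a : QPoly m q} (ha : a ∈ homog m q (k + 1)) (i : Fin m) :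
    pd q i a ∈ homog m q k := by
  rw [pd_eq hq]; exact (polyPartial_mem (calculusData_pd hq) ha i).2

theorem pd_homog_zero (hq : 0 < q) {a : QPoly m q} (ha : a ∈ homog m q 0) (i : Fin m) :
    pd q i a = 0 := by
  rw [pd_eq hq]; exact (polyPartial_mem (calculusData_pd hq) ha i).1 rfl

theorem pdBar_mem_homog (hq : 0 < q) {k : ℕ} {a : QPoly m q} (ha : a ∈ homog m q (k + 1))
    (i : Fin m) : pdBar q i a ∈ homog m q k :=
  (polyPartial_mem (calculusData_pdBar hq) ha i).2

theorem pdBar_homog_zero (hq : 0 < q) {a : QPoly m q} (ha : a ∈ homog m q 0) (i : Fin m) :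
    pdBar q i a = 0 :=
  (polyPartial_mem (calculusData_pdBar hq) ha i).1 rfl

theorem laplace_mem_homog (hq : 0 < q) {k : ℕ} {a : QPoly m q} (ha : a ∈ homog m q (k + 2)) :
    laplace m q a ∈ homog m q k := by
  rw [laplace_apply]
  exact Submodule.sum_mem _ fun i _ => Submodule.sum_mem _ fun j _ => Submodule.smul_mem _ _
    (pd_mem_homog hq (pd_mem_homog hq ha j) i)

theorem laplace_homog_zero (hq : 0 < q) {k : ℕ} (hk : k < 2) {a : QPoly m q}
    (ha : a ∈ homog m q k) : laplace m q a = 0 := by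
  rw [laplace_apply]
  refine Finset.sum_eq_zero fun i _ => Finset.sum_eq_zero fun j _ => ?_
  interval_cases k
  · rw [pd_homog_zero hq ha, map_zero, smul_zero]
  · rw [pd_homog_zero hq (pd_mem_homog hq ha j), smul_zero]

end operators
end QEuclid
end

noncomputable section

namespace QEuclid

open Finset

/-! ### The `p`-Gamma function -/

theorem multipliable_one_sub_rpow {p : ℝ} (hp0 : 0 < p) (hp1 : p < 1) (t : ℝ) :
    Multipliable fun k : ℕ => 1 - p ^ (t + (k : ℝ)) := by
  have h : Summable fun k : ℕ => -(p ^ (t + (k : ℝ))) := by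
    have := ((summable_geometric_of_lt_one hp0.le hp1).mul_left (p ^ t)).neg
    refine this.congr fun k => ?_
    rw [Real.rpow_add hp0, Real.rpow_natCast]
  simpa [sub_eq_add_neg] using multipliable_one_add_of_summable h.norm

/-- The shift of `t` removes the first factor of the infinite product in the denominator. -/
theorem qGamma_add_one {p : ℝ} (hp0 : 0 < p) (hp1 : p < 1) {t : ℝ} (ht : 0 < t) :
    qGamma p (t + 1) = qNum p t * qGamma p t := by
  have h1 : (∏' k : ℕ, (1 - p ^ (t + (k : ℝ)))) =
      (1 - p ^ t) * ∏' k : ℕ, (1 - p ^ (t + 1 + (k : ℝ))) := by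
    have e : ∀ k : ℕ, 1 - p ^ (t + 1 + (k : ℝ)) = 1 - p ^ (t + ((k + 1 : ℕ) : ℝ)) := by
      intro k; push_cast; ring_nf
    simp only [e]
    rw [tprod_eq_zero_mul']
    · simp
    · simp only [← e]
      exact multipliable_one_sub_rpow hp0 hp1 _
  have h2 : (1 - p) ^ (1 - t) = (1 - p) * (1 - p) ^ (1 - (t + 1)) := by
    rw [show 1 - t = 1 + (1 - (t + 1)) by ring, Real.rpow_add (by linarith), Real.rpow_one]
  have h3 : 1 - p ^ t ≠ 0 := by
    have := Real.rpow_lt_one hp0.le hp1 ht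
    linarith
  have h4 : p - 1 ≠ 0 := by linarith
  rw [qGamma, qGamma, qNum, h1, h2]
  -- In this case both sides are zero because division by zero gives zero, so the product need not
  -- be shown to be nonzero.
  by_cases h5 : ∏' k : ℕ, (1 - p ^ (t + 1 + (k : ℝ))) = 0
  · simp [h5]
  · field_simp
    ring

/-! ### Integration over the quantum sphere -/

section sphere

variable {m : ℕ} {q : ℝ}

variable (q) in
/-- The `q²`-number `[n / 2]`, as a complex number. -/
def halfNum (n : ℕ) : ℂ := ((q : ℂ) ^ n - 1) / ((q : ℂ) ^ 2 - 1)

theorem qNum_half (hq : 0 < q) (n : ℕ) :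
    ((qNum (q ^ 2) ((n : ℝ) / 2) : ℝ) : ℂ) = halfNum q n := by
  have : (q ^ 2) ^ ((n : ℝ) / 2) = q ^ n := by
    rw [← Real.rpow_natCast q 2, ← Real.rpow_mul hq.le, ← Real.rpow_natCast]
    congr 1
    push_cast
    ring
  rw [qNum, this, halfNum]
  push_cast
  rfl

theorem halfNum_ne_zero (hq : 0 < q) (hq1 : q < 1) {n : ℕ} (hn : n ≠ 0) : halfNum q n ≠ 0 := by
  refine div_ne_zero ?_ (sq_sub_one_ne_zero hq hq1)
  have : q ^ n - 1 < 0 := by linarith [pow_lt_one₀ hq.le hq1 hn]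
  have h : ((q ^ n - 1 : ℝ) : ℂ) ≠ 0 := by exact_mod_cast this.ne
  push_cast at h
  exact h

variable (m q) in
/-- The coefficient of `(Δ^k R)(0)` in the integral of `R` over the quantum sphere. -/
def sphereCoef (k : ℕ) : ℂ :=
  ((2 * qGamma (q ^ 2) (1 / 2) ^ m / (muConst m q ^ (2 * k) * qFactorial (q ^ 2) k *
    qGamma (q ^ 2) ((k : ℝ) + (m : ℝ) / 2)) : ℝ) : ℂ)

/-- The ratio of consecutive coefficients is the factor by which `Δ^(k+1)` acts on `𝐱²` times a
polynomial of degree `2 k`; the sphere integral is normalised so that `𝐱²` counts as `1`. -/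
theorem sphereCoef_succ (hq : 0 < q) (hq1 : q < 1) (hm : m ≠ 0) (k : ℕ) :
    sphereCoef m q k = sphereCoef m q (k + 1) *
      (((muConst m q : ℝ) : ℂ) ^ 2 * halfNum q (2 * k + 2) * halfNum q (2 * k + m)) := by
  have hmu : muConst m q ≠ 0 := (muConst_pos hq).ne'
  have hp0 : 0 < q ^ 2 := by positivity
  have hp1 : q ^ 2 < 1 := by nlinarith
  have e1 : qNum (q ^ 2) ((k : ℝ) + 1) ≠ 0 := by
    have := halfNum_ne_zero hq hq1 (n := 2 * k + 2) (by omega)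
    rw [← qNum_half hq] at this
    have h : (((2 * k + 2 : ℕ) : ℝ) / 2) = (k : ℝ) + 1 := by push_cast; ring
    rw [h] at this
    exact_mod_cast this
  have e2 : qNum (q ^ 2) ((k : ℝ) + (m : ℝ) / 2) ≠ 0 := by
    have := halfNum_ne_zero hq hq1 (n := 2 * k + m) (by omega)
    rw [← qNum_half hq] at this
    have h : (((2 * k + m : ℕ) : ℝ) / 2) = (k : ℝ) + (m : ℝ) / 2 := by push_cast; ring
    rw [h] at this
    exact_mod_cast this
  have hm' : (0 : ℝ) < (k : ℝ) + (m : ℝ) / 2 := by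
    have : (0 : ℝ) < m := by exact_mod_cast Nat.pos_of_ne_zero hm
    positivity
  have e3 : qGamma (q ^ 2) (((k + 1 : ℕ) : ℝ) + (m : ℝ) / 2) =
      qNum (q ^ 2) ((k : ℝ) + (m : ℝ) / 2) * qGamma (q ^ 2) ((k : ℝ) + (m : ℝ) / 2) := by
    rw [← qGamma_add_one hp0 hp1 hm']
    congr 1
    push_cast
    ring
  have e4 : qFactorial (q ^ 2) (k + 1) = qFactorial (q ^ 2) k * qNum (q ^ 2) ((k : ℝ) + 1) :=
    Finset.prod_range_succ _ _
  have h1 : halfNum q (2 * k + 2) = (qNum (q ^ 2) ((k : ℝ) + 1) : ℝ) := by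
    rw [← qNum_half hq]; congr 2; push_cast; ring
  have h2 : halfNum q (2 * k + m) = (qNum (q ^ 2) ((k : ℝ) + (m : ℝ) / 2) : ℝ) := by
    rw [← qNum_half hq]; congr 2; push_cast; ring
  rw [h1, h2, sphereCoef, sphereCoef]
  rw [← Complex.ofReal_pow, ← Complex.ofReal_mul, ← Complex.ofReal_mul, ← Complex.ofReal_mul, e3, e4]
  congr 1
  set a := qNum (q ^ 2) ((k : ℝ) + 1)
  set b := qNum (q ^ 2) ((k : ℝ) + (m : ℝ) / 2)
  set g := qGamma (q ^ 2) ((k : ℝ) + (m : ℝ) / 2)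
  have : muConst m q ^ (2 * (k + 1)) * (qFactorial (q ^ 2) k * a) * (b * g) =
      (muConst m q ^ (2 * k) * qFactorial (q ^ 2) k * g) * (muConst m q ^ 2 * a * b) := by ring
  have h3 : muConst m q ^ 2 * a * b ≠ 0 := mul_ne_zero (mul_ne_zero (pow_ne_zero 2 hmu) e1) e2
  rw [this, ← div_div _ _ (muConst m q ^ 2 * a * b), div_mul_cancel₀ _ h3]

theorem evalZero_coord_mul (i : Fin m) (a : QPoly m q) : evalZero m q (coord m q i * a) = 0 := by
  rw [map_mul]
  simp [evalZero, coord, mk]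

theorem evalZero_homog {k : ℕ} (hk : k ≠ 0) {a : QPoly m q} (ha : a ∈ homog m q k) :
    evalZero m q a = 0 := by
  induction ha using homog_induction with
  | one => exact absurd rfl hk
  | zero => exact map_zero _
  | add k a b _ _ ha hb => rw [map_add, ha hk, hb hk, add_zero]
  | smul k c a _ ha => rw [map_smul, ha hk, smul_zero]
  | mul k j a _ _ ha => exact evalZero_coord_mul j a

theorem evalZero_laplace_pow (hq : 0 < q) {k n : ℕ} (h : n ≠ 2 * k) {a : QPoly m q}
    (ha : a ∈ homog m q n) : evalZero m q ((laplace m q ^ k) a) = 0 := by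
  induction k generalizing n a with
  | zero => exact evalZero_homog (by simpa using h) ha
  | succ k ih =>
    rw [pow_succ, Module.End.mul_apply]
    rcases lt_or_ge n 2 with h2 | h2
    · rw [laplace_homog_zero hq h2 ha, map_zero, map_zero]
    · obtain ⟨n, rfl⟩ := Nat.exists_eq_add_of_le' h2
      exact ih (by omega) (laplace_mem_homog hq ha)

theorem sphereInt_even (hq : 0 < q) {k : ℕ} {a : QPoly m q} (ha : a ∈ homog m q (2 * k)) :
    sphereInt m q a = sphereCoef m q k * evalZero m q ((laplace m q ^ k) a) := by
  rw [sphereInt, finsum_eq_single _ k]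
  · rfl
  · intro l hl
    rw [evalZero_laplace_pow hq (by omega) ha, mul_zero]

theorem sphereInt_odd (hq : 0 < q) {n : ℕ} (hn : Odd n) {a : QPoly m q} (ha : a ∈ homog m q n) :
    sphereInt m q a = 0 := by
  obtain ⟨k, rfl⟩ := hn
  rw [sphereInt]
  refine finsum_eq_zero_of_forall_eq_zero fun l => ?_
  rw [evalZero_laplace_pow hq (by omega) ha, mul_zero]

variable (m q) in
/-- A linear form that agrees with integration over the sphere in degree `n`. -/
def sphereLin (n : ℕ) : QPoly m q →ₗ[ℂ] ℂ :=
  (if Even n then sphereCoef m q (n / 2) else 0) •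
    ((evalZero m q).toLinearMap ∘ₗ laplace m q ^ (n / 2))

theorem sphereInt_eq_lin (hq : 0 < q) {n : ℕ} {a : QPoly m q} (ha : a ∈ homog m q n) :
    sphereInt m q a = sphereLin m q n a := by
  rcases Nat.even_or_odd' n with ⟨k, rfl | rfl⟩
  · rw [sphereInt_even hq ha]
    simp [sphereLin]
  · rw [sphereInt_odd hq ⟨k, rfl⟩ ha]
    simp [sphereLin]

/-- Each step applies `laplace_normSq_mul`; its term with `𝐱² Δ` feeds the induction in degree two
lower and vanishes in degree `0`. -/
theorem laplace_pow_normSq_mul (hq : 0 < q) (hq1 : q < 1) (i₀ : Fin m) {k : ℕ} {a : QPoly m q}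
    (ha : a ∈ homog m q (2 * k)) : (laplace m q ^ (k + 1)) (normSq m q * a) =
      (((muConst m q : ℝ) : ℂ) ^ 2 * halfNum q (2 * k + 2) * halfNum q (2 * k + m)) •
        (laplace m q ^ k) a := by
  have hs := sq_sub_one_ne_zero hq hq1
  induction k generalizing a with
  | zero =>
    rw [zero_add, pow_one, laplace_normSq_mul hq hq1 i₀ ha, laplace_homog_zero hq (by omega) ha]
    simp [halfNum, hs]
  | succ k ih =>
    rw [pow_succ, Module.End.mul_apply, laplace_normSq_mul hq hq1 i₀ ha, map_add, map_smul, map_smul,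
      ih (laplace_mem_homog hq ha), ← Module.End.mul_apply, ← pow_succ, smul_smul, ← add_smul]
    congr 1
    unfold halfNum
    field_simp
    ring

theorem sphereInt_normSq_mul (hq : 0 < q) (hq1 : q < 1) (i₀ : Fin m) {n : ℕ} {a : QPoly m q}
    (ha : a ∈ homog m q n) : sphereInt m q (normSq m q * a) = sphereInt m q a := by
  have hN := mul_mem_homog normSq_mem_homog ha
  rcases Nat.even_or_odd' n with ⟨k, rfl | rfl⟩
  · rw [show 2 + 2 * k = 2 * (k + 1) by ring] at hN
    rw [sphereInt_even hq hN, sphereInt_even hq ha, laplace_pow_normSq_mul hq hq1 i₀ ha, map_smul,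
      sphereCoef_succ hq hq1 i₀.pos.ne' k, smul_eq_mul]
    ring
  · rw [sphereInt_odd hq ⟨k, rfl⟩ ha, sphereInt_odd hq ⟨k + 1, by ring⟩ hN]

theorem laplace_pow_coord_mul (hq : 0 < q) (hq1 : q < 1) (l : ℕ) (j : Fin m) (a : QPoly m q) :
    (laplace m q ^ (l + 1)) (coord m q j * a) =
      (q : ℂ) ^ (2 * l + 2) • (coord m q j * (laplace m q ^ (l + 1)) a) +
      (((muConst m q : ℝ) : ℂ) * halfNum q (2 * l + 2)) • pd q j ((laplace m q ^ l) a) := by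
  have hs := sq_sub_one_ne_zero hq hq1
  induction l with
  | zero => simp [laplace_coord_mul hq, halfNum, hs, add_comm]
  | succ l ih =>
    rw [pow_succ', Module.End.mul_apply, ih, map_add, map_smul, map_smul, laplace_coord_mul hq,
      laplace_pd hq, ← Module.End.mul_apply (laplace m q), ← pow_succ',
      ← Module.End.mul_apply (laplace m q), ← pow_succ']
    unfold halfNum
    match_scalars <;> field_simp <;> ring

theorem laplace_pow_pd (hq : 0 < q) (l : ℕ) (j : Fin m) (a : QPoly m q) :
    (laplace m q ^ l) (pd q j a) = pd q j ((laplace m q ^ l) a) := by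
  induction l with
  | zero => rfl
  | succ l ih =>
    rw [pow_succ', Module.End.mul_apply, ih, laplace_pd hq, Module.End.mul_apply]

/-- At the origin only the derivative term of `laplace_pow_coord_mul` survives, and `Δ` commutes
with `∂^j`; the ratio of consecutive coefficients supplies the rest. -/
theorem sphereInt_pd (hq : 0 < q) (hq1 : q < 1) (j : Fin m) {l : ℕ} {a : QPoly m q}
    (ha : a ∈ homog m q (2 * l + 1)) : sphereInt m q (pd q j a) =
      ((muConst m q : ℝ) : ℂ) * halfNum q (2 * l + m) * sphereInt m q (coord m q j * a) := by
  have h1 := coord_mul_mem_homog j ha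
  rw [show 2 * l + 1 + 1 = 2 * (l + 1) by ring] at h1
  rw [sphereInt_even hq (pd_mem_homog hq ha j), sphereInt_even hq h1, laplace_pow_coord_mul hq hq1,
    map_add, map_smul, map_smul, evalZero_coord_mul, laplace_pow_pd hq,
    sphereCoef_succ hq hq1 j.pos.ne' l]
  simp only [smul_eq_mul]
  ring

theorem sphereInt_laplace (hq : 0 < q) (hq1 : q < 1) (hm : m ≠ 0) {l : ℕ} {a : QPoly m q}
    (ha : a ∈ homog m q (2 * l + 2)) : sphereInt m q (laplace m q a) =
      ((muConst m q : ℝ) : ℂ) ^ 2 * halfNum q (2 * l + 2) * halfNum q (2 * l + m) *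
        sphereInt m q a := by
  have h1 := ha
  rw [show 2 * l + 2 = 2 * (l + 1) by ring] at h1
  rw [sphereInt_even hq (laplace_mem_homog hq ha), sphereInt_even hq h1,
    sphereCoef_succ hq hq1 hm l, pow_succ (laplace m q), Module.End.mul_apply]
  ring

/-- `pdBar_homog` leaves the integral of `x^j Δ a`. Applying `sphereInt_pd` to `Δ a` and
`sphereInt_laplace` to `∂^j a` shows that it is `μ [l] ∫ ∂^j a`, and `1 + (q² - 1) [l] = q^(2l)`. -/
theorem sphereInt_pdBar (hq : 0 < q) (hq1 : q < 1) (j : Fin m) {l : ℕ} {a : QPoly m q}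
    (ha : a ∈ homog m q (2 * l + 1)) :
    (q : ℂ) ^ (2 * l) * sphereInt m q (pdBar q j a) = sphereInt m q (pd q j a) := by
  have hq0 : (q : ℂ) ≠ 0 := by exact_mod_cast hq.ne'
  have hmu : ((muConst m q : ℝ) : ℂ) ≠ 0 := by exact_mod_cast (muConst_pos hq).ne'
  have hs := sq_sub_one_ne_zero hq hq1
  have h1 : sphereLin m q (2 * l) (coord m q j * laplace m q a) =
      ((muConst m q : ℝ) : ℂ) * halfNum q (2 * l) * sphereLin m q (2 * l) (pd q j a) := by
    rcases l with _ | l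
    · rw [laplace_homog_zero hq (by omega) ha]
      simp [halfNum]
    · have hb := halfNum_ne_zero hq hq1 (n := 2 * l + m) (by have := j.pos; omega)
      have hL : laplace m q a ∈ homog m q (2 * l + 1) := laplace_mem_homog hq ha
      rw [show 2 * (l + 1) = 2 * l + 2 by ring] at ha ⊢
      rw [← sphereInt_eq_lin hq (pd_mem_homog hq ha j),
        ← sphereInt_eq_lin hq (coord_mul_mem_homog j hL)]
      have e1 := sphereInt_pd hq hq1 j hL
      rw [← laplace_pd hq, sphereInt_laplace hq hq1 j.pos.ne' (pd_mem_homog hq ha j)] at e1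
      refine mul_left_cancel₀ (mul_ne_zero hmu hb) ?_
      linear_combination -e1
  have h2 := congrArg (sphereLin m q (2 * l)) (pdBar_homog hq hq1 ha j)
  rw [sphereInt_eq_lin hq (pdBar_mem_homog hq ha j), sphereInt_eq_lin hq (pd_mem_homog hq ha j)]
  simp only [map_smul, map_add, h1, smul_eq_mul, halfNum] at h2
  refine mul_left_cancel₀ (pow_ne_zero (2 * l + 2) hq0) ?_
  field_simp at h2
  linear_combination h2

end sphere
end QEuclid
end

noncomputable section

namespace QEuclid

open Filter Topology

/-! ### Taylor coefficients -/

/-- The Taylor coefficient of order `n` at the origin. -/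
def taylorCoef (f : ℝ → ℂ) (n : ℕ) : ℂ := iteratedDeriv n f 0 / (n.factorial : ℂ)

theorem coeff_eq_taylorCoef {f : ℝ → ℂ} {p : FormalMultilinearSeries ℝ ℝ ℂ}
    (h : HasFPowerSeriesAt f p 0) (n : ℕ) : p.coeff n = taylorCoef f n := by
  obtain ⟨r, hr⟩ := h
  have e := hr.factorial_smul 1 n
  rw [← iteratedDeriv_eq_iteratedFDeriv] at e
  have hn : (n.factorial : ℂ) ≠ 0 := by exact_mod_cast n.factorial_ne_zero
  rw [taylorCoef, ← e, eq_div_iff hn, nsmul_eq_mul, mul_comm]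
  rfl

theorem hasSum_taylorCoef {f : ℝ → ℂ} (hf : AnalyticAt ℝ f 0) :
    ∀ᶠ t : ℝ in 𝓝 0, HasSum (fun n => taylorCoef f n * (t : ℂ) ^ n) (f t) := by
  obtain ⟨p, hp⟩ := hf
  filter_upwards [hasFPowerSeriesAt_iff'.1 hp] with t ht
  refine ht.congr_fun fun n => ?_
  rw [coeff_eq_taylorCoef hp, sub_zero, Complex.real_smul, mul_comm]
  push_cast
  rfl

theorem hasFPowerSeriesAt_of_hasSum {f : ℝ → ℂ} {c : ℕ → ℂ}
    (h : ∀ᶠ t : ℝ in 𝓝 0, HasSum (fun n => c n * (t : ℂ) ^ n) (f t)) :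
    ∃ p : FormalMultilinearSeries ℝ ℝ ℂ, HasFPowerSeriesAt f p 0 ∧ ∀ n, p.coeff n = c n := by
  set p : FormalMultilinearSeries ℝ ℝ ℂ := fun n =>
    ContinuousMultilinearMap.mkPiRing ℝ (Fin n) (c n) with hp
  have hc : ∀ n, p.coeff n = c n := fun n => by simp [hp, FormalMultilinearSeries.coeff]
  refine ⟨p, ?_, hc⟩
  rw [hasFPowerSeriesAt_iff']
  filter_upwards [h] with t ht
  refine ht.congr_fun fun n => ?_
  rw [hc, sub_zero, Complex.real_smul, mul_comm]
  push_cast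
  rfl

theorem taylorCoef_eq_of_hasSum {f : ℝ → ℂ} {c : ℕ → ℂ}
    (h : ∀ᶠ t : ℝ in 𝓝 0, HasSum (fun n => c n * (t : ℂ) ^ n) (f t)) (n : ℕ) :
    taylorCoef f n = c n := by
  obtain ⟨p, hp, hc⟩ := hasFPowerSeriesAt_of_hasSum h
  rw [← hc, coeff_eq_taylorCoef hp]

theorem analyticAt_of_hasSum {f : ℝ → ℂ} {c : ℕ → ℂ}
    (h : ∀ᶠ t : ℝ in 𝓝 0, HasSum (fun n => c n * (t : ℂ) ^ n) (f t)) : AnalyticAt ℝ f 0 := by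
  obtain ⟨p, hp, -⟩ := hasFPowerSeriesAt_of_hasSum h
  exact hp.analyticAt

/-- A functional equation `f (s t) = (1 + b t) f t` as a recursion for Taylor coefficients. -/
theorem taylorCoef_of_scaling {f : ℝ → ℂ} (hf : AnalyticAt ℝ f 0) {s b : ℝ}
    (h : ∀ᶠ t : ℝ in 𝓝 0, f (s * t) = (1 + b * t) * f t) (l : ℕ) :
    (s : ℂ) ^ (l + 1) * taylorCoef f (l + 1) = taylorCoef f (l + 1) + b * taylorCoef f l := by
  have hs : Tendsto (fun t : ℝ => s * t) (𝓝 0) (𝓝 0) := by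
    have : Tendsto (fun t : ℝ => s * t) (𝓝 0) (𝓝 (s * 0)) := tendsto_id.const_mul s
    simpa using this
  have h1 : ∀ᶠ t : ℝ in 𝓝 0,
      HasSum (fun n => (s : ℂ) ^ n * taylorCoef f n * (t : ℂ) ^ n) (f (s * t)) := by
    filter_upwards [hs.eventually (hasSum_taylorCoef hf)] with t ht
    refine ht.congr_fun fun n => ?_
    push_cast
    ring
  have h2 : ∀ᶠ t : ℝ in 𝓝 0, HasSum (fun n => (taylorCoef f n +
      b * (if n = 0 then 0 else taylorCoef f (n - 1))) * (t : ℂ) ^ n) (f (s * t)) := by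
    filter_upwards [hasSum_taylorCoef hf, h] with t ht h
    have h3 : HasSum (fun n => (b * (if n = 0 then 0 else taylorCoef f (n - 1))) * (t : ℂ) ^ n)
        (b * t * f t) := by
      rw [← hasSum_nat_add_iff' 1]
      have := ht.mul_left ((b : ℂ) * t)
      simp only [Finset.range_one, Finset.sum_singleton, if_true, mul_zero, zero_mul, sub_zero]
      refine this.congr_fun fun n => ?_
      rw [if_neg (Nat.succ_ne_zero n), Nat.add_sub_cancel, pow_succ]
      ring
    rw [h, add_mul, one_mul]
    refine (ht.add h3).congr_fun fun n => ?_
    ring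
  have e := (taylorCoef_eq_of_hasSum h1 (l + 1)).symm.trans (taylorCoef_eq_of_hasSum h2 (l + 1))
  simpa using e

/-! ### The `p`-exponentials -/

section exponentials

variable {p : ℝ}

theorem one_sub_pow_succ_pos (hp0 : 0 < p) (hp1 : p < 1) (j : ℕ) : 0 < 1 - p ^ (j + 1) :=
  sub_pos.2 (pow_lt_one₀ hp0.le hp1 (Nat.succ_ne_zero j))

theorem qFactorial_succ (p : ℝ) (j : ℕ) :
    qFactorial p (j + 1) = qFactorial p j * ((1 - p ^ (j + 1)) / (1 - p)) := by
  rw [qFactorial, Finset.prod_range_succ, ← qFactorial, qNum]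
  congr 1
  rw [← neg_div_neg_eq]
  congr 1
  · rw [neg_sub, ← Real.rpow_natCast]; push_cast; rfl
  · ring

theorem qFactorial_pos (hp0 : 0 < p) (hp1 : p < 1) (j : ℕ) : 0 < qFactorial p j := by
  induction j with
  | zero => simp [qFactorial]
  | succ j ih =>
    rw [qFactorial_succ]
    have h2 := one_sub_pow_succ_pos hp0 hp1 j
    have h3 : 0 < 1 - p := by linarith
    positivity

theorem triangle_succ (j : ℕ) : (j + 1) * (j + 1 - 1) / 2 = j * (j - 1) / 2 + j := by
  rw [Nat.triangle_succ]

variable (p) in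
/-- The terms of the series of `E_p`. -/
def termE (t : ℝ) (j : ℕ) : ℝ := p ^ (j * (j - 1) / 2) * t ^ j / qFactorial p j

theorem termE_succ (hp0 : 0 < p) (hp1 : p < 1) (t : ℝ) (j : ℕ) :
    termE p t (j + 1) = (1 - p) * t * p ^ j / (1 - p ^ (j + 1)) * termE p t j := by
  have h1 := (qFactorial_pos hp0 hp1 j).ne'
  have h2 := (one_sub_pow_succ_pos hp0 hp1 j).ne'
  have h3 : 1 - p ≠ 0 := by linarith
  rw [termE, termE, triangle_succ, qFactorial_succ, pow_add, pow_succ]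
  field_simp

theorem summable_termE (hp0 : 0 < p) (hp1 : p < 1) (t : ℝ) : Summable (termE p t) := by
  have hlim : Tendsto (fun j : ℕ => |t| * p ^ j) atTop (𝓝 (|t| * 0)) :=
    (tendsto_pow_atTop_nhds_zero_of_lt_one hp0.le hp1).const_mul _
  rw [mul_zero] at hlim
  refine summable_of_ratio_norm_eventually_le (r := 1 / 2) (by norm_num) ?_
  filter_upwards [hlim.eventually_le_const (show (0 : ℝ) < 1 / 2 by norm_num)] with j hj
  rw [termE_succ hp0 hp1, norm_mul]
  refine mul_le_mul_of_nonneg_right ?_ (norm_nonneg _)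
  have h1 : p ^ (j + 1) ≤ p := by
    rw [pow_succ]; exact mul_le_of_le_one_left hp0.le (pow_le_one₀ hp0.le hp1.le)
  have h2 : 0 < 1 - p ^ (j + 1) := by linarith
  rw [Real.norm_eq_abs, abs_div, abs_mul, abs_mul, abs_of_pos h2, abs_of_pos (by linarith : 0 < 1 - p),
    abs_of_pos (pow_pos hp0 j), div_le_iff₀ h2]
  nlinarith

theorem hasSum_termE (hp0 : 0 < p) (hp1 : p < 1) (t : ℝ) : HasSum (termE p t) (qExpE p t) :=
  (summable_termE hp0 hp1 t).hasSum

/-- In the difference of the two series the factor `1 - p ^ (j + 1)` cancels the last factor of the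
`p`-factorial, which shifts the series by one term. -/
theorem qExpE_scaling (hp0 : 0 < p) (hp1 : p < 1) (t : ℝ) :
    qExpE p t = (1 + (1 - p) * t) * qExpE p (p * t) := by
  have h1 := (hasSum_nat_add_iff' 1).2 ((hasSum_termE hp0 hp1 t).sub (hasSum_termE hp0 hp1 (p * t)))
  have h2 := (hasSum_termE hp0 hp1 (p * t)).mul_left ((1 - p) * t)
  have h3 : ∀ j, termE p t (j + 1) - termE p (p * t) (j + 1) = (1 - p) * t * termE p (p * t) j := by
    intro j
    have h1 := (qFactorial_pos hp0 hp1 j).ne'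
    have h2 := (one_sub_pow_succ_pos hp0 hp1 j).ne'
    have h3 : 1 - p ≠ 0 := by linarith
    rw [termE_succ hp0 hp1, termE_succ hp0 hp1]
    simp only [termE, mul_pow]
    field_simp
    ring
  simp only [h3] at h1
  have := h1.unique h2
  simp [termE] at this
  linear_combination this

theorem qExpE_zero (hp0 : 0 < p) (hp1 : p < 1) : qExpE p 0 = 1 := by
  refine (hasSum_termE hp0 hp1 0).unique ?_
  convert hasSum_single 0 _ using 1
  · simp [termE, qFactorial]
  · intro j hj; simp [termE, hj]

theorem termE_le_qExpE (hp0 : 0 < p) (hp1 : p < 1) {t : ℝ} (ht : 0 ≤ t) (j : ℕ) :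
    termE p t j ≤ qExpE p t := by
  refine (summable_termE hp0 hp1 t).le_tsum j fun i _ => ?_
  have := qFactorial_pos hp0 hp1 i
  unfold termE
  positivity

theorem one_le_qExpE (hp0 : 0 < p) (hp1 : p < 1) {t : ℝ} (ht : 0 ≤ t) : 1 ≤ qExpE p t := by
  have := termE_le_qExpE hp0 hp1 ht 0
  simpa [termE, qFactorial] using this

theorem analyticAt_qExpE (hp0 : 0 < p) (hp1 : p < 1) (x : ℝ) : AnalyticAt ℝ (qExpE p) x := by
  set c : ℕ → ℝ := fun j => p ^ (j * (j - 1) / 2) / qFactorial p j with hc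
  have hr : (FormalMultilinearSeries.ofScalars ℝ c).radius = ⊤ := by
    refine FormalMultilinearSeries.radius_eq_top_of_summable_norm _ fun r => ?_
    have := (summable_termE hp0 hp1 r).norm
    refine this.congr fun j => ?_
    rw [FormalMultilinearSeries.ofScalars_norm]
    simp only [termE, hc, norm_mul, norm_div, norm_pow]
    rw [Real.norm_of_nonneg r.coe_nonneg]
    ring
  have h := (FormalMultilinearSeries.ofScalars ℝ c).hasFPowerSeriesOnBall (by rw [hr]; simp)
  rw [hr] at h
  have e : (FormalMultilinearSeries.ofScalars ℝ c).sum = qExpE p := by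
    funext t
    have := congrFun (FormalMultilinearSeries.ofScalarsSum_eq_tsum (E := ℝ) (c := c)) t
    rw [FormalMultilinearSeries.ofScalarsSum] at this
    rw [this, qExpE]
    refine tsum_congr fun j => ?_
    simp only [hc, smul_eq_mul]
    ring
  rw [e] at h
  exact h.analyticAt_of_mem (by simp)

variable (p) in
/-- The terms of the series of `e_p`. -/
def terme (t : ℝ) (j : ℕ) : ℝ := t ^ j / qFactorial p j

theorem terme_succ (hp0 : 0 < p) (hp1 : p < 1) (t : ℝ) (j : ℕ) :
    terme p t (j + 1) = (1 - p) * t / (1 - p ^ (j + 1)) * terme p t j := by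
  have h1 := (qFactorial_pos hp0 hp1 j).ne'
  have h2 := (one_sub_pow_succ_pos hp0 hp1 j).ne'
  have h3 : 1 - p ≠ 0 := by linarith
  rw [terme, terme, qFactorial_succ, pow_succ]
  field_simp

theorem summable_terme (hp0 : 0 < p) (hp1 : p < 1) {t : ℝ} (ht : |t| < 1 / (1 - p)) :
    Summable (terme p t) := by
  have h0 : 0 < 1 - p := by linarith
  have h1 : (1 - p) * |t| < 1 := by rwa [lt_div_iff₀ h0, mul_comm] at ht
  obtain ⟨r, hr1, hr2⟩ := exists_between h1
  have hlim : Tendsto (fun j : ℕ => (1 - p) * |t| / (1 - p ^ (j + 1))) atTop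
      (𝓝 ((1 - p) * |t| / (1 - 0))) :=
    tendsto_const_nhds.div (tendsto_const_nhds.sub
      ((tendsto_add_atTop_iff_nat 1).2 (tendsto_pow_atTop_nhds_zero_of_lt_one hp0.le hp1))) (by norm_num)
  rw [sub_zero, div_one] at hlim
  refine summable_of_ratio_norm_eventually_le hr2 ?_
  filter_upwards [hlim.eventually_le_const hr1] with j hj
  rw [terme_succ hp0 hp1, norm_mul]
  refine mul_le_mul_of_nonneg_right (le_trans (le_of_eq ?_) hj) (norm_nonneg _)
  have h2 := one_sub_pow_succ_pos hp0 hp1 j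
  rw [Real.norm_eq_abs, abs_div, abs_mul, abs_of_pos h2, abs_of_pos h0]

theorem hasSum_terme (hp0 : 0 < p) (hp1 : p < 1) {t : ℝ} (ht : |t| < 1 / (1 - p)) :
    HasSum (terme p t) (qExpe p t) := by
  rw [qExpe, if_pos ht]
  exact (summable_terme hp0 hp1 ht).hasSum

theorem qExpe_scaling (hp0 : 0 < p) (hp1 : p < 1) {t : ℝ} (ht : |t| < 1 / (1 - p)) :
    qExpe p (p * t) = (1 - (1 - p) * t) * qExpe p t := by
  have ht' : |p * t| < 1 / (1 - p) := by
    rw [abs_mul, abs_of_pos hp0]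
    nlinarith [abs_nonneg t]
  have h1 := (hasSum_nat_add_iff' 1).2 ((hasSum_terme hp0 hp1 ht).sub (hasSum_terme hp0 hp1 ht'))
  have h2 := (hasSum_terme hp0 hp1 ht).mul_left ((1 - p) * t)
  have h3 : ∀ j, terme p t (j + 1) - terme p (p * t) (j + 1) = (1 - p) * t * terme p t j := by
    intro j
    have h1 := (qFactorial_pos hp0 hp1 j).ne'
    have h2 := (one_sub_pow_succ_pos hp0 hp1 j).ne'
    have h3 : 1 - p ≠ 0 := by linarith
    rw [terme_succ hp0 hp1, terme_succ hp0 hp1]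
    simp only [terme, mul_pow]
    field_simp
    ring
  simp only [h3] at h1
  have := h1.unique h2
  simp [terme] at this
  linear_combination -this

theorem continuousAt_qExpe (hp0 : 0 < p) (hp1 : p < 1) : ContinuousAt (qExpe p) 0 := by
  have h0 : 0 < 1 / (1 - p) := by
    have : 0 < 1 - p := by linarith
    positivity
  have h : ∀ᶠ t : ℝ in 𝓝 0, HasSum (fun n => ((qFactorial p n)⁻¹ : ℂ) * (t : ℂ) ^ n)
      ((qExpe p t : ℝ) : ℂ) := by
    have : ∀ᶠ t : ℝ in 𝓝 0, |t| < 1 / (1 - p) := by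
      have := continuous_abs.tendsto (0 : ℝ)
      rw [abs_zero] at this
      exact this.eventually_lt_const h0
    filter_upwards [this] with t ht
    have := Complex.hasSum_ofReal.2 (hasSum_terme hp0 hp1 ht)
    refine this.congr_fun fun n => ?_
    simp only [terme]
    push_cast
    ring
  have := (analyticAt_of_hasSum h).continuousAt
  have h2 := Complex.continuous_re.continuousAt.comp this
  exact h2

/-- By the two functional equations `e_p(t) E_p(-t)` does not change under `t ↦ p t`. Iteration and
continuity at `0` give the value `1` on the disc; outside of it the claim is the definition. -/
theorem qExpe_eq_inv (hp0 : 0 < p) (hp1 : p < 1) (t : ℝ) : qExpe p t = (qExpE p (-t))⁻¹ := by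
  by_cases ht : |t| < 1 / (1 - p)
  · refine eq_inv_of_mul_eq_one_left ?_
    have h1 : ∀ n : ℕ, qExpe p (p ^ n * t) * qExpE p (-(p ^ n * t)) = qExpe p t * qExpE p (-t) := by
      intro n
      induction n with
      | zero => simp
      | succ n ih =>
        have hn : |p ^ n * t| < 1 / (1 - p) := by
          rw [abs_mul, abs_of_pos (pow_pos hp0 n)]
          exact (mul_le_of_le_one_left (abs_nonneg t) (pow_le_one₀ hp0.le hp1.le)).trans_lt ht
        rw [← ih, qExpE_scaling hp0 hp1 (-(p ^ n * t)), pow_succ', mul_assoc, qExpe_scaling hp0 hp1 hn,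
          mul_neg]
        ring_nf
    have hx : Tendsto (fun n : ℕ => p ^ n * t) atTop (𝓝 0) := by
      have := (tendsto_pow_atTop_nhds_zero_of_lt_one hp0.le hp1).mul_const t
      rwa [zero_mul] at this
    have hc : ContinuousAt (fun x => qExpe p x * qExpE p (-x)) 0 := by
      refine (continuousAt_qExpe hp0 hp1).mul ?_
      exact ContinuousAt.comp (analyticAt_qExpE hp0 hp1 _).continuousAt continuous_neg.continuousAt
    have h2 := hc.tendsto.comp hx
    have h3 : (fun x => qExpe p x * qExpE p (-x)) ∘ (fun n : ℕ => p ^ n * t) =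
        fun _ => qExpe p t * qExpE p (-t) := funext h1
    rw [h3] at h2
    have h4 := tendsto_nhds_unique h2 tendsto_const_nhds
    rw [← h4, neg_zero, qExpE_zero hp0 hp1, mul_one]
    refine (hasSum_terme hp0 hp1 ?_).unique ?_
    · simp; linarith
    · convert hasSum_single 0 _ using 1
      · simp [terme, qFactorial]
      · intro j hj; simp [terme, hj]
  · rw [qExpe, if_neg ht]

end exponentials

end QEuclid
end

noncomputable section

namespace QEuclid

open Filter Topology

/-! ### Partial derivatives of weighted polynomials -/

section series

variable {m : ℕ} {q : ℝ}

theorem toSeries_homog {k : ℕ} {a : QPoly m q} (ha : a ∈ homog m q k) :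
    toSeries m q a = PowerSeries.monomial k a := by
  induction ha using homog_induction with
  | one => rw [map_one, PowerSeries.monomial_zero_eq_C_apply, map_one]
  | zero => rw [map_zero, map_zero]
  | add k a b _ _ ha hb => rw [map_add, ha, hb, map_add]
  | smul k c a _ ha =>
    rw [map_smul, ha]
    ext n
    simp [PowerSeries.coeff_monomial]
  | mul k j a _ _ ha =>
    have : toSeries m q (coord m q j) = PowerSeries.monomial 1 (coord m q j) := by
      simp [toSeries, coord, mk]
    rw [map_mul, ha, this, PowerSeries.monomial_mul_monomial, add_comm]

theorem coeff_add_monomial_mul {R : Type*} [Semiring R] (k i : ℕ) (a : R) (φ : PowerSeries R) :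
    PowerSeries.coeff (k + i) (PowerSeries.monomial k a * φ) = a * PowerSeries.coeff i φ := by
  rw [PowerSeries.coeff_mul, Finset.sum_eq_single (k, i)]
  · rw [PowerSeries.coeff_monomial_same]
  · rintro ⟨b, c⟩ hbc hne
    rw [Finset.HasAntidiagonal.mem_antidiagonal] at hbc
    rw [PowerSeries.coeff_monomial, if_neg, zero_mul]
    rintro rfl
    exact hne (by simp at hbc ⊢; omega)
  · intro h
    rw [Finset.HasAntidiagonal.mem_antidiagonal] at h
    exact absurd rfl h

theorem coeff_monomial_mul_of_lt {R : Type*} [Semiring R] {k n : ℕ} (h : n < k) (a : R)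
    (φ : PowerSeries R) : PowerSeries.coeff n (PowerSeries.monomial k a * φ) = 0 := by
  rw [PowerSeries.coeff_mul]
  refine Finset.sum_eq_zero fun x hx => ?_
  rw [Finset.HasAntidiagonal.mem_antidiagonal] at hx
  rw [PowerSeries.coeff_monomial, if_neg (by omega), zero_mul]

theorem coeff_weighted (hq : 0 < q) {k : ℕ} {a : QPoly m q} (ha : a ∈ homog m q k) (f : ℝ → ℂ)
    (l : ℕ) : PowerSeries.coeff (k + 2 * l) (toSeries m q a * radial m q f) =
      taylorCoef f l • (normSq m q ^ l * a) := by
  rw [toSeries_homog ha, coeff_add_monomial_mul, radial, PowerSeries.coeff_mk, if_pos (by simp),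
    mul_smul_comm, ((normSq_commute hq a).pow_left l).eq]
  simp [taylorCoef]

theorem coeff_weighted_eq_zero {k n : ℕ} {a : QPoly m q} (ha : a ∈ homog m q k) (f : ℝ → ℂ)
    (h : ∀ l, n ≠ k + 2 * l) : PowerSeries.coeff n (toSeries m q a * radial m q f) = 0 := by
  rw [toSeries_homog ha]
  rcases lt_or_ge n k with hn | hn
  · exact coeff_monomial_mul_of_lt hn _ _
  · obtain ⟨i, rfl⟩ := Nat.exists_eq_add_of_le hn
    rw [coeff_add_monomial_mul, radial, PowerSeries.coeff_mk, if_neg, mul_zero]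
    rintro ⟨l, rfl⟩
    exact h l (by ring)

theorem normSq_pow_mem_homog (l : ℕ) : normSq m q ^ l ∈ homog m q (2 * l) := by
  induction l with
  | zero => rw [pow_zero, homog, mul_zero, pow_zero]; exact Submodule.one_le.1 le_rfl
  | succ l ih => rw [pow_succ]; exact mul_mem_homog ih normSq_mem_homog

/-- An operator that satisfies the Leibniz rule of the partial derivatives for the square of the
norm, applied to a polynomial that is weighted with a solution of `f (s t) = (1 + b t) f t`. -/
theorem seriesPartial_weighted (hq : 0 < q) {D : QPoly m q →ₗ[ℂ] QPoly m q} {j : Fin m} {κ s b : ℂ}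
    (hs : s - 1 ≠ 0) (hD : ∀ a, D (normSq m q * a) = κ • (coord m q j * a) + s • (normSq m q * D a))
    (hD0 : ∀ a ∈ homog m q 0, D a = 0) (hD1 : ∀ k, ∀ a ∈ homog m q (k + 1), D a ∈ homog m q k)
    {f : ℝ → ℂ} (hf : ∀ l, s ^ (l + 1) * taylorCoef f (l + 1) = taylorCoef f (l + 1) +
      b * taylorCoef f l) {k : ℕ} {a : QPoly m q} (ha : a ∈ homog m q k) :
    seriesPartial q D (toSeries m q a * radial m q f) =
      toSeries m q ((κ * b / (s - 1)) • (coord m q j * a)) * radial m q f +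
      toSeries m q (D a) * radial m q f + toSeries m q (b • (normSq m q * D a)) * radial m q f := by
  -- The iterated Leibniz rule. The truncated exponent `l - 1` is harmless at `l = 0`, where the
  -- coefficient vanishes.
  have hpow : ∀ l, D (normSq m q ^ l * a) =
      (κ * ((s ^ l - 1) / (s - 1))) • (normSq m q ^ (l - 1) * (coord m q j * a)) +
      s ^ l • (normSq m q ^ l * D a) := by
    intro l
    induction l with
    | zero => simp
    | succ l ih =>
      have hN : coord m q j * (normSq m q ^ l * a) = normSq m q ^ l * (coord m q j * a) := by
        rw [← mul_assoc, ← mul_assoc, ((normSq_commute hq (coord m q j)).pow_left l).eq]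
      rw [pow_succ', mul_assoc, hD, ih, hN, Nat.add_sub_cancel]
      rcases l with _ | l
      · simp [hs]
      · rw [Nat.add_sub_cancel]
        simp only [mul_add, mul_smul_comm, ← mul_assoc (normSq m q), ← pow_succ']
        match_scalars <;> field_simp <;> ring
  have hx := Submodule.smul_mem _ (κ * b / (s - 1)) (coord_mul_mem_homog j ha)
  ext n
  rw [seriesPartial, PowerSeries.coeff_mk, map_add, map_add]
  -- In other degrees all terms vanish. The cases `k = 0`, where `D a = 0`, and `l = 0`, where only
  -- `D a` reaches the lowest degree, are treated apart; elsewhere the recursion `hf` matches the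
  -- coefficients.
  by_cases h : ∃ l, n + 1 = k + 2 * l
  · obtain ⟨l, hl⟩ := h
    rw [hl, coeff_weighted hq ha, map_smul, hpow]
    rcases k with _ | k
    · obtain ⟨l, rfl⟩ := Nat.exists_eq_succ_of_ne_zero (show l ≠ 0 by omega)
      obtain rfl : n = 0 + 1 + 2 * l := by omega
      rw [hD0 a ha, coeff_weighted hq hx]
      simp only [mul_zero, smul_zero, map_zero, zero_mul, add_zero, Nat.succ_eq_add_one,
        Nat.add_sub_cancel, mul_smul_comm, smul_smul]
      congr 1
      have := hf l
      field_simp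
      linear_combination κ * this
    · have h1 := hD1 k a ha
      have h2 := Submodule.smul_mem _ b (mul_mem_homog (normSq_mem_homog (m := m) (q := q)) h1)
      rcases l with _ | l
      · obtain rfl : n = k := by omega
        have h3 := coeff_weighted hq h1 f 0
        rw [mul_zero, add_zero] at h3
        rw [h3, coeff_weighted_eq_zero hx _ (by omega), coeff_weighted_eq_zero h2 _ (by omega)]
        simp
      · obtain rfl : n = k + 2 * (l + 1) := by omega
        rw [coeff_weighted hq h1, show k + 2 * (l + 1) = k + 1 + 1 + 2 * l by ring,
          coeff_weighted hq hx, show k + 1 + 1 + 2 * l = 2 + k + 2 * l by ring, coeff_weighted hq h2]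
        have := hf l
        simp only [mul_smul_comm, ← mul_assoc _ (normSq m q), ← pow_succ, Nat.add_sub_cancel]
        match_scalars
        · field_simp
          linear_combination κ * this
        · linear_combination this
  · push Not at h
    rw [coeff_weighted_eq_zero ha _ h, map_zero, coeff_weighted_eq_zero hx _ fun l hl =>
      h (l + 1) (by omega), zero_add]
    rcases k with _ | k
    · rw [hD0 a ha]; simp
    · have h1 := hD1 k a ha
      have h2 := Submodule.smul_mem _ b (mul_mem_homog (normSq_mem_homog (m := m) (q := q)) h1)
      rw [coeff_weighted_eq_zero h1 _ fun l hl => h l (by omega),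
        coeff_weighted_eq_zero h2 _ fun l hl => h (l + 1) (by omega), add_zero]

theorem QPoly.induction_homog {P : QPoly m q → Prop} (add : ∀ a b, P a → P b → P (a + b))
    (homog : ∀ k, ∀ a ∈ homog m q k, P a) (a : QPoly m q) : P a := by
  have h : a ∈ ⨆ k, QEuclid.homog m q k := by
    induction a using QPoly.induction_words with
    | one =>
      refine Submodule.mem_iSup_of_mem 0 ?_
      simpa using normSq_pow_mem_homog (m := m) (q := q) 0
    | add a b ha hb => exact Submodule.add_mem _ ha hb
    | smul c a ha => exact Submodule.smul_mem _ _ ha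
    | mul j a ha =>
      induction ha using Submodule.iSup_induction' with
      | mem k a ha => exact Submodule.mem_iSup_of_mem (k + 1) (coord_mul_mem_homog j ha)
      | zero => rw [mul_zero]; exact Submodule.zero_mem _
      | add a b _ _ ha hb => rw [mul_add]; exact Submodule.add_mem _ ha hb
  induction h using Submodule.iSup_induction' with
  | mem k a ha => exact homog k a ha
  | zero => exact homog 0 0 (Submodule.zero_mem _)
  | add a b _ _ ha hb => exact add a b ha hb

end series

/-! ### Integrals of weighted polynomials -/

section integrals

variable {m : ℕ} {q : ℝ}

/-- Common form of the integrals over the quantum space and over quantum balls: `v` is a value of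
the integral of `F` with respect to the radial measure with masses `c y_l` at the points `x_l`. -/
def HasTermIntegral {ι : Type} (x : ι → ℝ) (y : ι → ℂ) (c : ℂ) (Y : Set ℝ)
    (F : PowerSeries (QPoly m q)) (v : ℂ) : Prop :=
  ∃ (n : ℕ) (k : Fin n → ℕ) (R : Fin n → QPoly m q) (f : Fin n → ℝ → ℂ),
    (∀ i, R i ∈ homog m q (k i)) ∧
    (∀ i, AnalyticOnNhd ℝ (f i) Y) ∧
    (∀ i, Summable fun l => (x l : ℂ) ^ (m + k i - 1) * f i (x l ^ 2) * y l) ∧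
    F = ∑ i, toSeries m q (R i) * radial m q (f i) ∧
    v = ∑ i, (c * ∑' l, (x l : ℂ) ^ (m + k i - 1) * f i (x l ^ 2) * y l) * sphereInt m q (R i)

theorem hasSpaceIntegral_iff {γ : ℝ} {F : PowerSeries (QPoly m q)} {v : ℂ} :
    HasSpaceIntegral q γ F v ↔ HasTermIntegral (fun l : ℤ => q ^ l * γ)
      (fun l => ((q ^ l : ℝ) : ℂ)) ((1 - q) * γ : ℝ) (Set.Ici 0) F v :=
  Iff.rfl

theorem hasBallIntegral_iff {lam : ℝ} {F : PowerSeries (QPoly m q)} {v : ℂ} :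
    HasBallIntegral q lam F v ↔ HasTermIntegral (fun l : ℕ => q ^ l * lam)
      (fun l => ((q ^ l : ℝ) : ℂ)) ((1 - q) * lam : ℝ) (Set.Icc 0 (lam ^ 2)) F v :=
  Iff.rfl

variable {ι : Type} {x : ι → ℝ} {y : ι → ℂ} {c : ℂ} {Y : Set ℝ}

theorem HasTermIntegral.add {F G : PowerSeries (QPoly m q)} {v w : ℂ}
    (hF : HasTermIntegral x y c Y F v) (hG : HasTermIntegral x y c Y G w) :
    HasTermIntegral x y c Y (F + G) (v + w) := by
  obtain ⟨n, k, R, f, h1, h2, h3, h4, h5⟩ := hF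
  obtain ⟨n', k', R', f', h1', h2', h3', h4', h5'⟩ := hG
  refine ⟨n + n', Fin.append k k', Fin.append R R', Fin.append f f', ?_, ?_, ?_, ?_, ?_⟩
  · intro i
    induction i using Fin.addCases with
    | left i => simpa using h1 i
    | right i => simpa using h1' i
  · intro i
    induction i using Fin.addCases with
    | left i => simpa using h2 i
    | right i => simpa using h2' i
  · intro i
    induction i using Fin.addCases with
    | left i => simpa using h3 i
    | right i => simpa using h3' i
  · simp [Fin.sum_univ_add, h4, h4']
  · simp [Fin.sum_univ_add, h5, h5']

theorem HasTermIntegral.single {k : ℕ} {a : QPoly m q} (ha : a ∈ homog m q k) {f : ℝ → ℂ}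
    (hf : AnalyticOnNhd ℝ f Y)
    (hs : Summable fun l => (x l : ℂ) ^ (m + k - 1) * f (x l ^ 2) * y l) :
    HasTermIntegral x y c Y (toSeries m q a * radial m q f)
      ((c * ∑' l, (x l : ℂ) ^ (m + k - 1) * f (x l ^ 2) * y l) * sphereInt m q a) :=
  ⟨1, fun _ => k, fun _ => a, fun _ => f, fun _ => ha, fun _ => hf, fun _ => hs, by simp, by simp⟩

/-- Powers of `𝐱²` do not change sphere integrals, so integrating the homogeneous parts turns a
weighted polynomial into the Taylor series of its integral over the sphere of radius `r`. -/
theorem hasSum_sphereLin_coeff (hq : 0 < q) (hq1 : q < 1) (i₀ : Fin m) {k : ℕ} {a : QPoly m q}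
    (ha : a ∈ homog m q k) {f : ℝ → ℂ} (hf : AnalyticAt ℝ f 0) :
    ∀ᶠ r : ℝ in 𝓝 0, HasSum (fun n => sphereLin m q n (PowerSeries.coeff n
      (toSeries m q a * radial m q f)) * (r : ℂ) ^ n) (sphereInt m q a * (r : ℂ) ^ k * f (r ^ 2)) := by
  have hsq : Tendsto (fun r : ℝ => r ^ 2) (𝓝 0) (𝓝 0) := by
    have := (continuous_pow 2).tendsto (0 : ℝ)
    simpa using this
  filter_upwards [hsq.eventually (hasSum_taylorCoef hf)] with r hr
  have hinj : Function.Injective fun l : ℕ => k + 2 * l := fun _ _ h => by simpa using h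
  rw [← hinj.hasSum_iff]
  · refine (hr.mul_left (sphereInt m q a * (r : ℂ) ^ k)).congr_fun fun l => ?_
    have hl : normSq m q ^ l * a ∈ homog m q (k + 2 * l) := by
      rw [add_comm]; exact mul_mem_homog (normSq_pow_mem_homog l) ha
    have hS : sphereInt m q (normSq m q ^ l * a) = sphereInt m q a := by
      clear hl
      induction l with
      | zero => simp
      | succ l ih =>
        rw [pow_succ', mul_assoc, sphereInt_normSq_mul hq hq1 i₀ (mul_mem_homog
          (normSq_pow_mem_homog l) ha), ih]
    simp only [Function.comp]
    rw [coeff_weighted hq ha, map_smul, ← sphereInt_eq_lin hq hl, hS, smul_eq_mul]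
    push_cast
    ring
  · intro n hn
    rw [coeff_weighted_eq_zero ha f fun l hl => hn ⟨l, hl.symm⟩, map_zero, zero_mul]

/-- The value of the integral does not depend on the representation of the series. -/
theorem HasTermIntegral.unique (hq : 0 < q) (hq1 : q < 1) (i₀ : Fin m) {X : Set ℝ}
    (hX : IsPreconnected X) (hX0 : 0 ∈ X) (hXY : ∀ r ∈ X, r ^ 2 ∈ Y) (hx : ∀ l, x l ∈ X)
    {F : PowerSeries (QPoly m q)} {v w : ℂ} (hv : HasTermIntegral x y c Y F v)
    (hw : HasTermIntegral x y c Y F w) : v = w := by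
  -- `G r` is the integral of `F` over the sphere of radius `r`. It is built from a representation,
  -- but its Taylor series at `0` involves only `F`, and `v` is a radial sum of `G`.
  have key : ∀ v, HasTermIntegral x y c Y F v → ∃ G : ℝ → ℂ, AnalyticOnNhd ℝ G X ∧
      (∀ᶠ r : ℝ in 𝓝 0, HasSum (fun n => sphereLin m q n (PowerSeries.coeff n F) * (r : ℂ) ^ n)
        (G r)) ∧ v = c * ∑' l, (x l : ℂ) ^ (m - 1) * G (x l) * y l := by
    rintro v ⟨n, k, R, f, h1, h2, h3, h4, h5⟩
    refine ⟨fun r => ∑ i, sphereInt m q (R i) * (r : ℂ) ^ k i * f i (r ^ 2), ?_, ?_, ?_⟩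
    · intro r hr
      refine Finset.analyticAt_fun_sum _ fun i _ => ?_
      have e1 : AnalyticAt ℝ (fun r : ℝ => (r : ℂ)) r := Complex.ofRealCLM.analyticAt r
      have e2 : AnalyticAt ℝ (fun r : ℝ => f i (r ^ 2)) r :=
        AnalyticAt.fun_comp (h2 i _ (hXY r hr)) (analyticAt_id.pow 2)
      exact (analyticAt_const.mul (e1.pow _)).mul e2
    · have := fun i => hasSum_sphereLin_coeff hq hq1 i₀ (h1 i)
        (h2 i 0 (by simpa using hXY 0 hX0))
      filter_upwards [eventually_all.2 this] with r hr
      refine (hasSum_sum fun i _ => hr i).congr_fun fun n => ?_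
      rw [h4, map_sum, map_sum, Finset.sum_mul]
    · rw [h5]
      have e : ∀ i l, sphereInt m q (R i) * ((x l : ℂ) ^ (m + k i - 1) * f i (x l ^ 2) * y l) =
          (x l : ℂ) ^ (m - 1) * (sphereInt m q (R i) * (x l : ℂ) ^ k i * f i (x l ^ 2)) * y l := by
        intro i l
        rw [show m + k i - 1 = (m - 1) + k i by have := i₀.pos; omega, pow_add]
        ring
      simp only [Finset.mul_sum, Finset.sum_mul, ← e]
      rw [Summable.tsum_finsetSum fun i _ => (h3 i).mul_left _, Finset.mul_sum]
      refine Finset.sum_congr rfl fun i _ => ?_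
      rw [tsum_mul_left]
      ring
  obtain ⟨G, hG1, hG2, rfl⟩ := key v hv
  obtain ⟨H, hH1, hH2, rfl⟩ := key w hw
  -- Equal Taylor series give equality near `0`, and the identity theorem extends it to the
  -- connected set `X` containing all lattice points.
  have hGH : G =ᶠ[𝓝 0] H := by
    filter_upwards [hG2, hH2] with r h1 h2
    exact h1.unique h2
  have := hG1.eqOn_of_preconnected_of_eventuallyEq hH1 hX hX0 hGH
  simp only [fun l => this (hx l)]

end integrals

end QEuclid
end

noncomputable section

namespace QEuclid

open Filter Topology

/-! ### A criterion for vanishing integrals -/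

section vanishing

variable {m : ℕ} {q : ℝ}

theorem seriesPartial_add (D : QPoly m q →ₗ[ℂ] QPoly m q) (F G : PowerSeries (QPoly m q)) :
    seriesPartial q D (F + G) = seriesPartial q D F + seriesPartial q D G := by
  ext n
  simp [seriesPartial]

/-- A criterion for the vanishing of the integrals of partial derivatives. -/
theorem hasTermIntegral_seriesPartial (hq : 0 < q) {ι : Type} {x : ι → ℝ} {y : ι → ℂ} {c : ℂ}
    {Y : Set ℝ} {D : QPoly m q →ₗ[ℂ] QPoly m q} {j : Fin m} {κ s b σ : ℂ} (hs : s - 1 ≠ 0)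
    (hD : ∀ a, D (normSq m q * a) = κ • (coord m q j * a) + s • (normSq m q * D a))
    (hD0 : ∀ a ∈ homog m q 0, D a = 0) (hD1 : ∀ k, ∀ a ∈ homog m q (k + 1), D a ∈ homog m q k)
    (hN : ∀ k, ∀ a ∈ homog m q k, sphereInt m q (normSq m q * a) = sphereInt m q a)
    {f : ℝ → ℂ} (hfY : AnalyticOnNhd ℝ f Y)
    (hf : ∀ l, s ^ (l + 1) * taylorCoef f (l + 1) = taylorCoef f (l + 1) + b * taylorCoef f l)
    (hsum : ∀ a : ℕ, Summable fun l => (x l : ℂ) ^ a * f (x l ^ 2) * y l)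
    (hrec : ∀ a : ℕ, (∑' l, (x l : ℂ) ^ a * f (x l ^ 2) * y l) +
      b * ∑' l, (x l : ℂ) ^ (a + 2) * f (x l ^ 2) * y l =
      σ ^ (a + 1) * ∑' l, (x l : ℂ) ^ a * f (x l ^ 2) * y l)
    (hS : ∀ l, ∀ a ∈ homog m q (2 * l + 1), κ * (σ ^ (2 * l + m) - 1) *
      sphereInt m q (coord m q j * a) + (s - 1) * σ ^ (2 * l + m) * sphereInt m q (D a) = 0)
    (R : QPoly m q) : HasTermIntegral x y c Y (seriesPartial q D (toSeries m q R * radial m q f)) 0 := by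
  induction R using QPoly.induction_homog with
  | add a b ha hb =>
    rw [map_add, add_mul, seriesPartial_add]
    simpa using ha.add hb
  | homog k a ha =>
    rw [seriesPartial_weighted hq hs hD hD0 hD1 hf ha]
    have hx := coord_mul_mem_homog j ha
    have smulS : ∀ {d : ℕ} {a : QPoly m q} (_ : a ∈ homog m q d) (z : ℂ),
        sphereInt m q (z • a) = z * sphereInt m q a := by
      intro d a ha z
      rw [sphereInt_eq_lin hq ha, sphereInt_eq_lin hq (Submodule.smul_mem _ z ha), map_smul,
        smul_eq_mul]
    rcases Nat.even_or_odd' k with ⟨l, rfl | rfl⟩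
    -- For even `k` all three terms have odd degree and their sphere integrals vanish. When `k = 0`,
    -- `D a = 0` belongs to every degree and is placed in degree `1`.
    · obtain ⟨d, hd, hDa⟩ : ∃ d, Odd d ∧ D a ∈ homog m q d := by
        rcases l with _ | l
        · refine ⟨1, odd_one, ?_⟩
          rw [hD0 a ha]
          exact Submodule.zero_mem _
        · exact ⟨2 * l + 1, ⟨l, rfl⟩, hD1 _ a ha⟩
      have hNa := mul_mem_homog (normSq_mem_homog (m := m) (q := q)) hDa
      have h := ((HasTermIntegral.single (c := c) (Submodule.smul_mem _ (κ * b / (s - 1)) hx) hfY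
        (hsum _)).add (HasTermIntegral.single hDa hfY (hsum _))).add
        (HasTermIntegral.single (Submodule.smul_mem _ b hNa) hfY (hsum _))
      rwa [smulS hx, smulS hNa, hN _ _ hDa, sphereInt_odd hq hd hDa, sphereInt_odd hq ⟨l, rfl⟩ hx,
        mul_zero, mul_zero, mul_zero, mul_zero, mul_zero, add_zero, add_zero] at h
    · have hDa := hD1 _ a ha
      have hNa := mul_mem_homog (normSq_mem_homog (m := m) (q := q)) hDa
      have h := ((HasTermIntegral.single (c := c) (Submodule.smul_mem _ (κ * b / (s - 1)) hx) hfY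
        (hsum _)).add (HasTermIntegral.single hDa hfY (hsum _))).add
        (HasTermIntegral.single (Submodule.smul_mem _ b hNa) hfY (hsum _))
      have hm := j.pos
      rw [smulS hx, smulS hNa, hN _ _ hDa,
        show m + (2 * l + 1 + 1) - 1 = (m + 2 * l - 1) + 2 by omega,
        show m + (2 + 2 * l) - 1 = (m + 2 * l - 1) + 2 by omega] at h
      -- With `A = m + 2 l - 1`, the three terms have radial exponents `A + 2`, `A`, `A + 2`. The
      -- recursion eliminates the moment `I_(A+2)`, and `hS` says that the resulting coefficient of
      -- `I_A` is zero.
      have e1 := hrec (m + 2 * l - 1)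
      have e2 := hS l a ha
      rw [show m + 2 * l - 1 + 1 = 2 * l + m by omega] at e1
      convert! h using 1
      set I := ∑' l_1, (x l_1 : ℂ) ^ (m + 2 * l - 1) * f (x l_1 ^ 2) * y l_1
      set I2 := ∑' l_1, (x l_1 : ℂ) ^ (m + 2 * l - 1 + 2) * f (x l_1 ^ 2) * y l_1
      field_simp
      linear_combination (-c * (κ * sphereInt m q (coord m q j * a) + (s - 1) *
        sphereInt m q (D a))) * e1 - c * I * e2

end vanishing

/-! ### The two Gaussians -/

section gaussians

variable {q : ℝ}

theorem sq_pos_lt_one (hq : 0 < q) (hq1 : q < 1) : 0 < q ^ 2 ∧ q ^ 2 < 1 :=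
  ⟨by positivity, by nlinarith⟩

theorem qExpe_neg_eq (hq : 0 < q) (hq1 : q < 1) (α : ℝ) :
    (fun t : ℝ => ((qExpe (q ^ 2) (-(α * t)) : ℝ) : ℂ)) =
      fun t => (((qExpE (q ^ 2) (α * t))⁻¹ : ℝ) : ℂ) := by
  obtain ⟨hp0, hp1⟩ := sq_pos_lt_one hq hq1
  funext t
  rw [qExpe_eq_inv hp0 hp1, neg_neg]

theorem analyticAt_qExpe_neg (hq : 0 < q) (hq1 : q < 1) {α t : ℝ} (ht : 0 ≤ α * t) :
    AnalyticAt ℝ (fun t : ℝ => ((qExpe (q ^ 2) (-(α * t)) : ℝ) : ℂ)) t := by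
  obtain ⟨hp0, hp1⟩ := sq_pos_lt_one hq hq1
  rw [qExpe_neg_eq hq hq1]
  have h1 : AnalyticAt ℝ (fun t : ℝ => qExpE (q ^ 2) (α * t)) t :=
    AnalyticAt.fun_comp (analyticAt_qExpE hp0 hp1 _) (analyticAt_const.mul analyticAt_id)
  have h2 := h1.inv (by have := one_le_qExpE hp0 hp1 ht; simp only [ne_eq]; linarith)
  exact AnalyticAt.fun_comp (Complex.ofRealCLM.analyticAt _) h2

theorem analyticAt_qExpE_neg (hq : 0 < q) (hq1 : q < 1) (β t : ℝ) :
    AnalyticAt ℝ (fun t : ℝ => ((qExpE (q ^ 2) (-(β * t)) : ℝ) : ℂ)) t := by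
  obtain ⟨hp0, hp1⟩ := sq_pos_lt_one hq hq1
  have h1 : AnalyticAt ℝ (fun t : ℝ => qExpE (q ^ 2) (-(β * t))) t :=
    AnalyticAt.fun_comp (analyticAt_qExpE hp0 hp1 _) (analyticAt_const.mul analyticAt_id).neg
  exact AnalyticAt.fun_comp (Complex.ofRealCLM.analyticAt _) h1

theorem qExpe_neg_scaling (hq : 0 < q) (hq1 : q < 1) {α t : ℝ}
    (ht : 0 < 1 + (1 - q ^ 2) * α * t) :
    ((qExpe (q ^ 2) (-(α * (q ^ 2 * t))) : ℝ) : ℂ) =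
      (1 + ((1 - q ^ 2) * α : ℝ) * t) * ((qExpe (q ^ 2) (-(α * t)) : ℝ) : ℂ) := by
  obtain ⟨hp0, hp1⟩ := sq_pos_lt_one hq hq1
  have h := qExpE_scaling hp0 hp1 (α * t)
  rw [qExpe_eq_inv hp0 hp1, qExpe_eq_inv hp0 hp1, neg_neg, neg_neg, h,
    show α * (q ^ 2 * t) = q ^ 2 * (α * t) by ring, ← mul_assoc (1 - q ^ 2), mul_inv]
  have h2 : (1 + (1 - q ^ 2) * α * t) * (1 + (1 - q ^ 2) * α * t)⁻¹ = 1 := mul_inv_cancel₀ ht.ne'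
  have h3 := congrArg (fun r : ℝ => (r : ℂ)) h2
  push_cast at h3 ⊢
  linear_combination -(h3 * ((qExpE (q ^ 2) (q ^ 2 * (α * t)) : ℝ) : ℂ)⁻¹)

theorem qExpE_neg_scaling (hq : 0 < q) (hq1 : q < 1) (β t : ℝ) :
    ((qExpE (q ^ 2) (-(β * ((q ^ 2)⁻¹ * t))) : ℝ) : ℂ) =
      (1 + (-((1 - q ^ 2) * β * (q ^ 2)⁻¹) : ℝ) * t) * ((qExpE (q ^ 2) (-(β * t)) : ℝ) : ℂ) := by
  obtain ⟨hp0, hp1⟩ := sq_pos_lt_one hq hq1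
  have h := qExpE_scaling hp0 hp1 (-(β * ((q ^ 2)⁻¹ * t)))
  rw [show q ^ 2 * -(β * ((q ^ 2)⁻¹ * t)) = -(β * t) by field_simp] at h
  rw [h]
  push_cast
  ring

/-- Convergence of the integrals of the first Gaussian. -/
theorem summable_qExpe_neg (hq : 0 < q) (hq1 : q < 1) {α γ : ℝ} (hα : 0 < α) (hγ : 0 < γ) (a : ℕ) :
    Summable fun l : ℤ => ((q ^ l * γ : ℝ) : ℂ) ^ a *
      ((qExpe (q ^ 2) (-(α * (q ^ l * γ) ^ 2)) : ℝ) : ℂ) * ((q ^ l : ℝ) : ℂ) := by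
  obtain ⟨hp0, hp1⟩ := sq_pos_lt_one hq hq1
  have key : Summable fun l : ℤ => (q ^ l * γ) ^ a * (qExpE (q ^ 2) (α * (q ^ l * γ) ^ 2))⁻¹ * q ^ l := by
    have hgeo := summable_geometric_of_lt_one hq.le hq1
    rw [summable_int_iff_summable_nat_and_neg]
    constructor
    · refine Summable.of_nonneg_of_le (fun n => ?_) (fun n => ?_) (hgeo.mul_left (γ ^ a))
      · have := one_le_qExpE hp0 hp1 (t := α * (q ^ (n : ℤ) * γ) ^ 2) (by positivity)
        positivity
      · have h1 := one_le_qExpE hp0 hp1 (t := α * (q ^ (n : ℤ) * γ) ^ 2) (by positivity)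
        rw [zpow_natCast] at h1 ⊢
        have h2 : q ^ n * γ ≤ γ := mul_le_of_le_one_left hγ.le (pow_le_one₀ hq.le hq1.le)
        refine mul_le_mul_of_nonneg_right ?_ (by positivity)
        calc (q ^ n * γ) ^ a * (qExpE (q ^ 2) (α * (q ^ n * γ) ^ 2))⁻¹ ≤ γ ^ a * 1 := by
              gcongr
              exact inv_le_one_of_one_le₀ h1
          _ = γ ^ a := mul_one _
    -- Towards infinity, `E` is bounded below by its single term of order `a + 1`, a multiple of
    -- `r^(2a+2)`; this beats `r^a` and the measure and leaves a geometric series.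
    · set C := termE (q ^ 2) α (a + 1) with hC
      have hCpos : 0 < C := by
        have := qFactorial_pos hp0 hp1 (a + 1)
        rw [hC, termE]
        positivity
      refine Summable.of_nonneg_of_le (fun n => ?_) (fun n => ?_)
        (hgeo.mul_left (C⁻¹ * (γ ^ (a + 2))⁻¹))
      · have := one_le_qExpE hp0 hp1 (t := α * (q ^ (-(n : ℤ)) * γ) ^ 2) (by positivity)
        positivity
      · have h1 := termE_le_qExpE hp0 hp1 (t := α * (q ^ (-(n : ℤ)) * γ) ^ 2) (by positivity) (a + 1)
        rw [zpow_neg, zpow_natCast] at h1 ⊢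
        set u := q ^ n with hu
        have hu0 : 0 < u := pow_pos hq n
        have hu1 : u ≤ 1 := pow_le_one₀ hq.le hq1.le
        have h2 : termE (q ^ 2) (α * (u⁻¹ * γ) ^ 2) (a + 1) = C * (u⁻¹ * γ) ^ (2 * a + 2) := by
          rw [hC, termE, termE, mul_pow α]
          ring
        rw [h2] at h1
        calc (u⁻¹ * γ) ^ a * (qExpE (q ^ 2) (α * (u⁻¹ * γ) ^ 2))⁻¹ * u⁻¹
            ≤ (u⁻¹ * γ) ^ a * (C * (u⁻¹ * γ) ^ (2 * a + 2))⁻¹ * u⁻¹ := by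
              gcongr
          _ = C⁻¹ * (γ ^ (a + 2))⁻¹ * u ^ (a + 1) := by
              have : 2 * a + 2 = a + (a + 2) := by ring
              rw [this, pow_add _ a (a + 2)]
              simp only [mul_pow, inv_pow]
              field_simp
              ring
          _ ≤ C⁻¹ * (γ ^ (a + 2))⁻¹ * u := by
              gcongr
              exact pow_le_of_le_one hu0.le hu1 (by omega)
  refine (Complex.ofRealCLM.summable key).congr fun l => ?_
  rw [qExpe_eq_inv hp0 hp1, neg_neg]
  simp

/-- The lattice `γ q^ℤ` is invariant under `r ↦ q r`; this substitution multiplies `r^a d_q r` by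
`q^(a+1)` and `f (r²)` by `1 + b r²`. -/
theorem jacksonInf_scaling (hq : 0 < q) {γ b : ℝ} {f : ℝ → ℂ} (hγ : 0 < γ)
    (hf : ∀ t, 0 ≤ t → f (q ^ 2 * t) = (1 + b * t) * f t)
    (hsum : ∀ a : ℕ, Summable fun l : ℤ => ((q ^ l * γ : ℝ) : ℂ) ^ a * f ((q ^ l * γ) ^ 2) *
      ((q ^ l : ℝ) : ℂ)) (a : ℕ) :
    (∑' l : ℤ, ((q ^ l * γ : ℝ) : ℂ) ^ a * f ((q ^ l * γ) ^ 2) * ((q ^ l : ℝ) : ℂ)) +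
      b * ∑' l : ℤ, ((q ^ l * γ : ℝ) : ℂ) ^ (a + 2) * f ((q ^ l * γ) ^ 2) * ((q ^ l : ℝ) : ℂ) =
      (q : ℂ)⁻¹ ^ (a + 1) *
        ∑' l : ℤ, ((q ^ l * γ : ℝ) : ℂ) ^ a * f ((q ^ l * γ) ^ 2) * ((q ^ l : ℝ) : ℂ) := by
  have hq0 : (q : ℂ) ≠ 0 := by exact_mod_cast hq.ne'
  rw [← (Equiv.addRight (1 : ℤ)).tsum_eq (fun l : ℤ => ((q ^ l * γ : ℝ) : ℂ) ^ a *
    f ((q ^ l * γ) ^ 2) * ((q ^ l : ℝ) : ℂ)), ← tsum_mul_left, ← tsum_mul_left]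
  -- The rewriting above shifted the sum on both sides; this one undoes the shift on the left.
  rw [(Equiv.addRight (1 : ℤ)).tsum_eq (fun l : ℤ => ((q ^ l * γ : ℝ) : ℂ) ^ a *
    f ((q ^ l * γ) ^ 2) * ((q ^ l : ℝ) : ℂ)), ← (hsum a).tsum_add ((hsum (a + 2)).mul_left _)]
  refine tsum_congr fun l => ?_
  have e : (q ^ (l + 1) * γ) ^ 2 = q ^ 2 * (q ^ l * γ) ^ 2 := by
    rw [zpow_add_one₀ hq.ne']; ring
  simp only [Equiv.coe_addRight]
  rw [e, hf _ (by positivity), zpow_add_one₀ hq.ne']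
  push_cast
  simp only [mul_pow, pow_add, inv_pow]
  field_simp

/-- Convergence of the integrals over balls. -/
theorem summable_ball (hq : 0 < q) (hq1 : q < 1) {lam : ℝ} (hlam : 0 ≤ lam) {f : ℝ → ℂ}
    (hf : ContinuousOn f (Set.Icc 0 (lam ^ 2))) (a : ℕ) :
    Summable fun l : ℕ => ((q ^ l * lam : ℝ) : ℂ) ^ a * f ((q ^ l * lam) ^ 2) *
      ((q ^ l : ℝ) : ℂ) := by
  obtain ⟨M, hM⟩ := isCompact_Icc.exists_bound_of_continuousOn hf
  refine Summable.of_norm_bounded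
    ((summable_geometric_of_lt_one hq.le hq1).mul_left (lam ^ a * M)) fun l => ?_
  have h1 : q ^ l * lam ≤ lam := mul_le_of_le_one_left hlam (pow_le_one₀ hq.le hq1.le)
  have h0 : 0 ≤ q ^ l * lam := by positivity
  have h2 := hM ((q ^ l * lam) ^ 2) ⟨by positivity, by gcongr⟩
  rw [norm_mul, norm_mul, norm_pow, Complex.norm_real, Complex.norm_real, Real.norm_of_nonneg h0,
    Real.norm_of_nonneg (by positivity : 0 ≤ q ^ l)]
  gcongr

/-- The substitution `r ↦ r / q` would move the outermost point off the half lattice; since `f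
(lam²) = 0`, the term `l = 0` on the left vanishes and the remaining ones are a shifted copy of the
whole sum. -/
theorem jackson_scaling (hq : 0 < q) {lam b : ℝ} {f : ℝ → ℂ}
    (hf : ∀ t, f ((q ^ 2)⁻¹ * t) = (1 + b * t) * f t) (hlam : f (lam ^ 2) = 0)
    (hsum : ∀ a : ℕ, Summable fun l : ℕ => ((q ^ l * lam : ℝ) : ℂ) ^ a * f ((q ^ l * lam) ^ 2) *
      ((q ^ l : ℝ) : ℂ)) (a : ℕ) :
    (∑' l : ℕ, ((q ^ l * lam : ℝ) : ℂ) ^ a * f ((q ^ l * lam) ^ 2) * ((q ^ l : ℝ) : ℂ)) +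
      b * ∑' l : ℕ, ((q ^ l * lam : ℝ) : ℂ) ^ (a + 2) * f ((q ^ l * lam) ^ 2) * ((q ^ l : ℝ) : ℂ) =
      (q : ℂ) ^ (a + 1) *
        ∑' l : ℕ, ((q ^ l * lam : ℝ) : ℂ) ^ a * f ((q ^ l * lam) ^ 2) * ((q ^ l : ℝ) : ℂ) := by
  rw [← tsum_mul_left, ← tsum_mul_left, ← (hsum a).tsum_add ((hsum (a + 2)).mul_left _),
    (((hsum a).add ((hsum (a + 2)).mul_left _))).tsum_eq_zero_add]
  simp only [pow_zero, one_mul, hlam, mul_zero, zero_mul, add_zero, zero_add]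
  refine tsum_congr fun l => ?_
  have h := hf ((q ^ (l + 1) * lam) ^ 2)
  rw [show (q ^ 2)⁻¹ * (q ^ (l + 1) * lam) ^ 2 = (q ^ l * lam) ^ 2 by
    field_simp; ring] at h
  rw [h]
  push_cast
  ring

end gaussians

end QEuclid
end

noncomputable section

namespace QEuclid

open Filter Topology

/-! ### The two Gaussian integrals -/

section main

variable {m : ℕ} {q : ℝ}

/-- The integrals of `∂^j F` over the quantum space vanish for polynomials weighted with the
Gaussian `e_{q²}(-α 𝐱²)`. -/
theorem hasSpaceIntegral_spd (hq : 0 < q) (hq1 : q < 1) (j : Fin m) {α γ : ℝ} (hα : 0 < α)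
    (hγ : 0 < γ) (R : QPoly m q) : HasSpaceIntegral q γ (spd q j (toSeries m q R *
      radial m q (fun t => ((qExpe (q ^ 2) (-(α * t)) : ℝ) : ℂ)))) 0 := by
  have hq0 : (q : ℂ) ≠ 0 := by exact_mod_cast hq.ne'
  have hs := sq_sub_one_ne_zero hq hq1
  obtain ⟨hp0, hp1⟩ := sq_pos_lt_one hq hq1
  set f : ℝ → ℂ := fun t => ((qExpe (q ^ 2) (-(α * t)) : ℝ) : ℂ) with hf
  have hfac : ∀ t : ℝ, 0 ≤ t → 0 < 1 + (1 - q ^ 2) * α * t := by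
    intro t ht
    have : 0 ≤ (1 - q ^ 2) * α * t := mul_nonneg (mul_nonneg (by linarith) hα.le) ht
    linarith
  have hscale : ∀ t, 0 ≤ t → f (q ^ 2 * t) = (1 + ((1 - q ^ 2) * α : ℝ) * t) * f t :=
    fun t ht => qExpe_neg_scaling hq hq1 (hfac t ht)
  have hT : ∀ l, ((q ^ 2 : ℝ) : ℂ) ^ (l + 1) * taylorCoef f (l + 1) = taylorCoef f (l + 1) +
      ((1 - q ^ 2) * α : ℝ) * taylorCoef f l := by
    -- The recursion needs the functional equation on both sides of `0`; the factor `1 + (1 - q²) α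
    -- t` stays positive for small negative `t`.
    refine taylorCoef_of_scaling (analyticAt_qExpe_neg hq hq1 (by simp)) ?_
    have hc : ContinuousAt (fun t : ℝ => 1 + (1 - q ^ 2) * α * t) 0 := by fun_prop
    filter_upwards [hc.eventually_const_lt (hfac 0 le_rfl)] with t ht
    exact qExpe_neg_scaling hq hq1 ht
  have hsum := summable_qExpe_neg hq hq1 hα hγ
  refine hasSpaceIntegral_iff.2 (hasTermIntegral_seriesPartial hq (σ := (q : ℂ)⁻¹) (j := j)
    (by push_cast; exact hs) (fun a => by push_cast; exact pd_normSq_mul hq j a)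
    (fun a ha => pd_homog_zero hq ha j) (fun k a ha => pd_mem_homog hq ha j)
    (fun k a ha => sphereInt_normSq_mul hq hq1 j ha)
    (fun t ht => analyticAt_qExpe_neg hq hq1 (mul_nonneg hα.le ht)) hT hsum
    (jacksonInf_scaling hq hγ hscale hsum) ?_ R)
  intro l a ha
  -- With `n = 2 l + m` the condition reads `μ (q^(-n) - 1) + (q² - 1) q^(-n) μ [n/2] = 0`.
  rw [sphereInt_pd hq hq1 j ha, halfNum]
  push_cast
  rw [inv_pow]
  field_simp
  ring

/-- The integrals of `∂̄^j F` over the quantum ball of radius `1 / √((1 - q²) β)` vanish for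
polynomials weighted with the Gaussian `E_{q²}(-β 𝐱²)`. -/
theorem hasBallIntegral_spdBar (hq : 0 < q) (hq1 : q < 1) (j : Fin m) {β : ℝ} (hβ : 0 < β)
    (R : QPoly m q) : HasBallIntegral q (1 / √((1 - q ^ 2) * β)) (spdBar q j (toSeries m q R *
      radial m q (fun t => ((qExpE (q ^ 2) (-(β * t)) : ℝ) : ℂ)))) 0 := by
  have hq0 : (q : ℂ) ≠ 0 := by exact_mod_cast hq.ne'
  have hs := sq_sub_one_ne_zero hq hq1
  obtain ⟨hp0, hp1⟩ := sq_pos_lt_one hq hq1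
  set f : ℝ → ℂ := fun t => ((qExpE (q ^ 2) (-(β * t)) : ℝ) : ℂ) with hf
  have hscale : ∀ t, f ((q ^ 2)⁻¹ * t) = (1 + (-((1 - q ^ 2) * β * (q ^ 2)⁻¹) : ℝ) * t) * f t :=
    qExpE_neg_scaling hq hq1 β
  have hpos : 0 < (1 - q ^ 2) * β := mul_pos (by linarith) hβ
  have hlam : f ((1 / √((1 - q ^ 2) * β)) ^ 2) = 0 := by
    -- The radius is chosen so that the first factor `1 + (1 - q²) t` of `E (t)` vanishes at `t = -β
    -- λ²`.
    have h := qExpE_scaling hp0 hp1 (-(β * (1 / √((1 - q ^ 2) * β)) ^ 2))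
    rw [div_pow, one_pow, Real.sq_sqrt hpos.le] at h ⊢
    have e : 1 + (1 - q ^ 2) * -(β * (1 / ((1 - q ^ 2) * β))) = 0 := by
      have : 1 - q ^ 2 ≠ 0 := by linarith
      field_simp
      ring
    rw [e, zero_mul] at h
    simp only [hf, h, Complex.ofReal_zero]
  have han : AnalyticOnNhd ℝ f (Set.Icc 0 ((1 / √((1 - q ^ 2) * β)) ^ 2)) :=
    fun t _ => analyticAt_qExpE_neg hq hq1 β t
  have hsum := summable_ball hq hq1 (by positivity : 0 ≤ 1 / √((1 - q ^ 2) * β)) han.continuousOn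
  refine hasBallIntegral_iff.2 (hasTermIntegral_seriesPartial hq (σ := (q : ℂ)) (j := j)
    (s := (((q ^ 2)⁻¹ : ℝ) : ℂ)) ?_ (fun a => by push_cast; exact pdBar_normSq_mul hq j a)
    (fun a ha => pdBar_homog_zero hq ha j) (fun k a ha => pdBar_mem_homog hq ha j)
    (fun k a ha => sphereInt_normSq_mul hq hq1 j ha) han
    (taylorCoef_of_scaling (analyticAt_qExpE_neg hq hq1 β 0) (Eventually.of_forall hscale)) hsum
    (jackson_scaling hq hscale hlam hsum) ?_ R)
  · push_cast
    intro h
    apply hs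
    field_simp at h
    linear_combination -h
  · intro l a ha
    -- The factor `q^(2l)` turns the integral of the barred derivative into that of `∂^j`, by
    -- `sphereInt_pdBar`.
    refine mul_left_cancel₀ (pow_ne_zero (2 * l) hq0) ?_
    have h := sphereInt_pdBar hq hq1 j ha
    rw [sphereInt_pd hq hq1 j ha, halfNum] at h
    have e : (q : ℂ) ^ ((m : ℤ) - 2) = (q : ℂ) ^ m / (q : ℂ) ^ 2 := by
      rw [zpow_sub₀ hq0, zpow_natCast]; norm_cast
    push_cast
    rw [e]
    field_simp at h ⊢
    linear_combination -(q : ℂ) ^ m * h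

end main

end QEuclid

end

theorem theorem4p4 (m : ℕ) (q : ℝ) (hq0 : 0 < q) (hq1 : q < 1) (j : Fin m) :
    (∀ α γ : ℝ, 0 < α → 0 < γ →
      ∀ F ∈ QEuclid.weighted m q (fun t => ((QEuclid.qExpe (q ^ 2) (-(α * t)) : ℝ) : ℂ)),
        QEuclid.HasSpaceIntegral q γ (QEuclid.spd q j F) 0 ∧
        ∀ v : ℂ, QEuclid.HasSpaceIntegral q γ (QEuclid.spd q j F) v → v = 0) ∧
    (∀ β : ℝ, 0 < β →
      ∀ F ∈ QEuclid.weighted m q (fun t => ((QEuclid.qExpE (q ^ 2) (-(β * t)) : ℝ) : ℂ)),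
        QEuclid.HasBallIntegral q (1 / √((1 - q ^ 2) * β)) (QEuclid.spdBar q j F) 0 ∧
        ∀ v : ℂ, QEuclid.HasBallIntegral q (1 / √((1 - q ^ 2) * β)) (QEuclid.spdBar q j F) v →
          v = 0) := by
  refine ⟨fun α γ hα hγ F hF => ?_, fun β hβ F hF => ?_⟩
  · obtain ⟨R, rfl⟩ := hF
    have h := QEuclid.hasSpaceIntegral_spd hq0 hq1 j hα hγ R
    -- The half line is connected and contains both the origin, where the series fixes the Taylor
    -- coefficients, and the lattice; any other value thus equals the value `0` just found.
    exact ⟨h, fun v hv => QEuclid.HasTermIntegral.unique hq0 hq1 j isPreconnected_Ici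
      Set.self_mem_Ici (fun r _ => sq_nonneg r) (fun l => Set.mem_Ici.2 (by positivity)) hv h⟩
  · obtain ⟨R, rfl⟩ := hF
    have h := QEuclid.hasBallIntegral_spdBar hq0 hq1 j hβ R
    have hlam : 0 ≤ 1 / √((1 - q ^ 2) * β) := by positivity
    exact ⟨h, fun v hv => QEuclid.HasTermIntegral.unique hq0 hq1 j isPreconnected_Icc
      (Set.left_mem_Icc.2 hlam)
      (fun r hr => Set.mem_Icc.2 ⟨sq_nonneg r, pow_le_pow_left₀ hr.1 hr.2 2⟩)
      (fun l => Set.mem_Icc.2 ⟨by positivity,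
        mul_le_of_le_one_left hlam (pow_le_one₀ hq0.le hq1.le)⟩) hv h⟩
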